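/- Let $K$ be a field of characteristic zero, $q\in K\smallsetminus\{0,1\}$, and let $F$ be an extension field of the field of rational functions $K(x)$, equipped with a field automorphism $\sigma_q$ extending $f(x)\mapsto f(qx)$ and with a derivation $\partial$ commuting with $\sigma_q$. A $q$-difference module over $F$ is a finite dimensional $F$-vector space $M$ with an invertible $\sigma_q$-semilinear operator $\Sigma_q$; a sub-$q$-difference module is a subspace $N$ with $\Sigma_q(N)=N$. The prolongation of $M$ is $F_\partial(M)=F[\partial]_{\le 1}\otimes_F M$ (with $\partial\lambda=\lambda\partial+\partial(\lambda)$ for $\lambda\in F$) and $\Sigma_q(\partial^k(m))=\partial^k(\Sigma_q(m))$, $k=0,1$. The constructions of differential linear algebra of $M$ are the members of the smallest family of spaces containing $M$ and closed under direct sums, tensor products, symmetric and exterior powers, duals and $F_\partial$; each is a $q$-difference module in a natural way. Let $\langle M\rangle^{\otimes,\partial}$ be the full abelian tensor subcategory of the category of $q$-difference modules over $F$ generated by $M$ and closed under $F_\partial$: its objects form the smallest class that contains $M$ and the unit object and is closed under subobjects, quotients, direct sums, tensor products, duals and $F_\partial$. For a commutative $F$-algebra $A$ with a derivation extending $\partial$,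 the group $\mathrm{GL}(M)(A)$ of $A$-linear automorphisms of $A\otimes_F M$ acts on $A\otimes_F W$ for every construction $W$ of $M$ (on prolongations by $g(\partial^k(v))=\partial^k(g(v))$). For a subspace $N\subset W$ the differential stabilizer $\mathrm{Stab}(N)$ is the functor $A\mapsto\{g\in\mathrm{GL}(M)(A): g(A\otimes_F N)\subset A\otimes_F N\}$. The parameterized generic Galois group $\mathrm{Gal}^\partial(M)$ is the functor that sends $A$ to the set of those $g\in \mathrm{GL}(M)(A)$ that belong to $\mathrm{Stab}(N)(A)$ for all sub-$q$-difference modules $N$ of all constructions of differential linear algebra of $M$. Then for every $q$-difference module $M$ over $F$ there are a construction $W$ of differential linear algebra of $M$ and a line (a one-dimensional $F$-subspace) $L\subset W$ such that $\mathrm{Gal}^\partial(M)=\mathrm{Stab}(L)$, i.e. $\mathrm{Gal}^\partial(M)(A)=\mathrm{Stab}(L)(A)$ for every $A$ as above. Moreover $L$ can be chosen to be a sub-$q$-difference module of $W$, which is then a $q$-difference module of rank one in $\langle M\rangle^{\otimes,\partial}$. -/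

import Mathlib

open scoped TensorProduct Differential
open Module

universe u v

namespace QDifference

section Functoriality

variable {R S : Type u} [CommRing R] [CommRing S] {φ : R →+* S}
variable {X Y X' Y' : Type u} [AddCommGroup X] [Module R X] [AddCommGroup Y] [Module S Y]
variable [AddCommGroup X'] [Module R X'] [AddCommGroup Y'] [Module S Y']

/-- A `φ`-semilinear map between finite free modules is a base change map if it carries some basis
to a basis, i.e. if the induced linear map `S ⊗_R X → Y` is an isomorphism. The linear automorphisms,
the bijective `σ`-semilinear operators and the maps `x ↦ 1 ⊗ x : X → S ⊗ X` are of this kind. The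
constructions of linear algebra, the dual included, are functorial for these maps. -/
def IsBaseChangeMap (f : X →ₛₗ[φ] Y) : Prop :=
  ∃ (n : ℕ) (b : Basis (Fin n) R X) (b' : Basis (Fin n) S Y), ∀ i, f (b i) = b' i

theorem IsBaseChangeMap.of_basis {ι : Type*} [Finite ι] {f : X →ₛₗ[φ] Y} (b : Basis ι R X)
    (b' : Basis ι S Y) (h : ∀ i, f (b i) = b' i) : IsBaseChangeMap f := by
  obtain ⟨n, ⟨e⟩⟩ := Finite.exists_equiv_fin ι
  exact ⟨n, b.reindex e, b'.reindex e, fun i => by simp [h]⟩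

/-- The direct sum of two semilinear maps. -/
def prodMap (f : X →ₛₗ[φ] Y) (g : X' →ₛₗ[φ] Y') : X × X' →ₛₗ[φ] Y × Y' where
  toFun p := (f p.1, g p.2)
  map_add' p q := by simp
  map_smul' r p := by simp

theorem IsBaseChangeMap.prodMap {f : X →ₛₗ[φ] Y} {g : X' →ₛₗ[φ] Y'} (hf : IsBaseChangeMap f) (hg : IsBaseChangeMap g) :
    IsBaseChangeMap (prodMap f g) := by
  obtain ⟨n, b, b', h⟩ := hf
  obtain ⟨m, c, c', h'⟩ := hg
  refine IsBaseChangeMap.of_basis (b.prod c) (b'.prod c') ?_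
  rintro (i | i) <;> simp [QDifference.prodMap, h, h']

theorem IsBaseChangeMap.tensorMap {f : X →ₛₗ[φ] Y} {g : X' →ₛₗ[φ] Y'} (hf : IsBaseChangeMap f) (hg : IsBaseChangeMap g) :
    IsBaseChangeMap (TensorProduct.map f g) := by
  obtain ⟨n, b, b', h⟩ := hf
  obtain ⟨m, c, c', h'⟩ := hg
  refine IsBaseChangeMap.of_basis (b.tensorProduct c) (b'.tensorProduct c') ?_
  rintro ⟨i, j⟩
  simp [h, h']

/-- The map `x₁ ∧ ⋯ ∧ xₙ ↦ f x₁ ∧ ⋯ ∧ f xₙ` on exterior powers. -/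
noncomputable def altMap (n : ℕ) (f : X →ₛₗ[φ] Y) : ⋀[R]^n X →ₛₗ[φ] ⋀[S]^n Y :=
  letI : Module R Y := Module.compHom Y φ
  letI : Module R (⋀[S]^n Y) := Module.compHom (⋀[S]^n Y) φ
  let a : X [⋀^Fin n]→ₗ[R] ⋀[S]^n Y :=
    { toFun := fun v => exteriorPower.ιMulti S n (fun i => f (v i))
      map_update_add' := fun {_} v i x y => by
        have key : ∀ z, (fun j => f (Function.update v i z j)) =
            Function.update (fun j => f (v j)) i (f z) := fun z => by
          ext j; by_cases hj : j = i
          · subst hj; simp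
          · simp [hj]
        rw [key, key, key, map_add, AlternatingMap.map_update_add]
      map_update_smul' := fun {_} v i r x => by
        have key : ∀ z, (fun j => f (Function.update v i z j)) =
            Function.update (fun j => f (v j)) i (f z) := fun z => by
          ext j; by_cases hj : j = i
          · subst hj; simp
          · simp [hj]
        rw [key, key, map_smulₛₗ, AlternatingMap.map_update_smul]
        rfl
      map_eq_zero_of_eq' := fun v i j hv hij =>
        AlternatingMap.map_eq_zero_of_eq _ _ (by simp [hv]) hij }
  let l : ⋀[R]^n X →ₗ[R] ⋀[S]^n Y := exteriorPower.alternatingMapLinearEquiv a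
  { toFun := l, map_add' := l.map_add, map_smul' := l.map_smul }

theorem altMap_ιMulti (n : ℕ) (f : X →ₛₗ[φ] Y) (v : Fin n → X) :
    altMap n f (exteriorPower.ιMulti R n v) = exteriorPower.ιMulti S n (fun i => f (v i)) := by
  let : Module R Y := Module.compHom Y φ
  let : Module R (⋀[S]^n Y) := Module.compHom (⋀[S]^n Y) φ
  exact exteriorPower.alternatingMapLinearEquiv_apply_ιMulti _ v

theorem IsBaseChangeMap.altMap (n : ℕ) {f : X →ₛₗ[φ] Y} (hf : IsBaseChangeMap f) : IsBaseChangeMap (altMap n f) := by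
  obtain ⟨m, b, b', h⟩ := hf
  refine IsBaseChangeMap.of_basis (b.exteriorPower n) (b'.exteriorPower n) fun s => ?_
  rw [exteriorPower.basis_apply, exteriorPower.basis_apply, exteriorPower.ιMulti_family,
    altMap_ιMulti, exteriorPower.ιMulti_family]
  simp [h, Function.comp_def]

variable (R X) in
/-- The `n`-th symmetric power: the degree `n` part of the symmetric algebra. -/
abbrev SymPower (n : ℕ) : Submodule R (SymmetricAlgebra R X) :=
  LinearMap.range (SymmetricAlgebra.ι R X) ^ n

/-- The ring homomorphism `ι x ↦ ι (f x)` between symmetric algebras. -/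
noncomputable def symAlgMap (f : X →ₛₗ[φ] Y) : SymmetricAlgebra R X →+* SymmetricAlgebra S Y :=
  letI : Algebra R (SymmetricAlgebra S Y) :=
    ((algebraMap S (SymmetricAlgebra S Y)).comp φ).toAlgebra
  (SymmetricAlgebra.lift (R := R) (M := X) (A := SymmetricAlgebra S Y)
    { toFun := fun x => SymmetricAlgebra.ι S Y (f x)
      map_add' := fun x y => by simp
      map_smul' := fun r x => by
        rw [map_smulₛₗ, map_smul, Algebra.smul_def, RingHom.id_apply, Algebra.smul_def]; rfl } :
    SymmetricAlgebra R X →ₐ[R] SymmetricAlgebra S Y).toRingHom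

theorem symAlgMap_ι (f : X →ₛₗ[φ] Y) (x : X) :
    symAlgMap f (SymmetricAlgebra.ι R X x) = SymmetricAlgebra.ι S Y (f x) := by
  let : Algebra R (SymmetricAlgebra S Y) :=
    ((algebraMap S (SymmetricAlgebra S Y)).comp φ).toAlgebra
  exact SymmetricAlgebra.lift_ι_apply _ x

theorem symAlgMap_smul (f : X →ₛₗ[φ] Y) (r : R) (x : SymmetricAlgebra R X) :
    symAlgMap f (r • x) = φ r • symAlgMap f x := by
  let : Algebra R (SymmetricAlgebra S Y) :=
    ((algebraMap S (SymmetricAlgebra S Y)).comp φ).toAlgebra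
  have h : symAlgMap f (algebraMap R (SymmetricAlgebra R X) r) =
      algebraMap S (SymmetricAlgebra S Y) (φ r) :=
    AlgHom.commutes (SymmetricAlgebra.lift _ : SymmetricAlgebra R X →ₐ[R] SymmetricAlgebra S Y) r
  rw [Algebra.smul_def, map_mul, h, Algebra.smul_def]

theorem symAlgMap_mem (n : ℕ) (f : X →ₛₗ[φ] Y) (x : SymmetricAlgebra R X)
    (hx : x ∈ SymPower R X n) : symAlgMap f x ∈ SymPower S Y n := by
  induction hx using Submodule.pow_induction_on_left' with
  | algebraMap r =>
    rw [Algebra.algebraMap_eq_smul_one, symAlgMap_smul, map_one]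
    refine Submodule.smul_mem _ _ ?_
    change _ ∈ LinearMap.range (SymmetricAlgebra.ι S Y) ^ 0
    rw [pow_zero]
    exact Submodule.one_le.mp le_rfl
  | add _ _ _ _ _ h h' => rw [map_add]; exact add_mem h h'
  | mem_mul m hm i x hx h =>
    obtain ⟨m, rfl⟩ := hm
    rw [map_mul, symAlgMap_ι]
    change _ ∈ LinearMap.range (SymmetricAlgebra.ι S Y) ^ (i + 1)
    rw [pow_succ']
    exact Submodule.mul_mem_mul ⟨_, rfl⟩ h

/-- The map `x₁ ⋯ xₙ ↦ f x₁ ⋯ f xₙ` on symmetric powers. -/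
noncomputable def symMap (n : ℕ) (f : X →ₛₗ[φ] Y) : SymPower R X n →ₛₗ[φ] SymPower S Y n where
  toFun x := ⟨symAlgMap f x, symAlgMap_mem n f x x.2⟩
  map_add' x y := Subtype.ext (map_add _ _ _)
  map_smul' r x := Subtype.ext (symAlgMap_smul f r x)

theorem symPower_eq {m : ℕ} (b : Basis (Fin m) R X) (n : ℕ) :
    Submodule.map (SymmetricAlgebra.equivMvPolynomial b).symm.toLinearEquiv.toLinearMap
      (MvPolynomial.restrictSupport R {d : Fin m →₀ ℕ | d.degree = n}) = SymPower R X n := by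
  have h1 : MvPolynomial.restrictSupport R {d : Fin m →₀ ℕ | d.degree = n} =
      (Submodule.span R (Set.range MvPolynomial.X)) ^ n := by
    rw [← MvPolynomial.homogeneousSubmodule_one_eq_span_X,
      MvPolynomial.homogeneousSubmodule_one_pow,
      MvPolynomial.homogeneousSubmodule_eq_finsupp_supported]
    rfl
  rw [h1]
  refine (Submodule.map_pow (Submodule.span R (Set.range MvPolynomial.X))
    (SymmetricAlgebra.equivMvPolynomial b).symm.toAlgHom n).trans ?_
  congr 1
  rw [Submodule.map_span, ← Set.range_comp, LinearMap.range_eq_map, ← b.span_eq,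
    Submodule.map_span, ← Set.range_comp]
  congr 2
  ext i
  exact SymmetricAlgebra.equivMvPolynomial_symm_X b i

theorem exists_basis_symPower {m : ℕ} (b : Basis (Fin m) R X) (n : ℕ) :
    ∃ B : Basis {d : Fin m →₀ ℕ | d.degree = n} R (SymPower R X n),
      ∀ d, (B d : SymmetricAlgebra R X) =
        d.1.prod fun i k => SymmetricAlgebra.ι R X (b i) ^ k := by
  refine ⟨((MvPolynomial.basisRestrictSupport R _).map
    ((SymmetricAlgebra.equivMvPolynomial b).symm.toLinearEquiv.submoduleMap _)).map
      (LinearEquiv.ofEq _ _ (symPower_eq b n)), fun d => ?_⟩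
  have h : ((MvPolynomial.basisRestrictSupport R {d : Fin m →₀ ℕ | d.degree = n} d :
      MvPolynomial.restrictSupport R {d : Fin m →₀ ℕ | d.degree = n}) : MvPolynomial (Fin m) R) =
      MvPolynomial.monomial d.1 1 := by
    have hm : MvPolynomial.monomial d.1 (1 : R) ∈
        MvPolynomial.restrictSupport R {d : Fin m →₀ ℕ | d.degree = n} :=
      (MvPolynomial.monomial_mem_restrictSupport R).mpr (Or.inl d.2)
    have : MvPolynomial.basisRestrictSupport R {d : Fin m →₀ ℕ | d.degree = n} d =
        ⟨MvPolynomial.monomial d.1 1, hm⟩ := by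
      rw [Basis.apply_eq_iff]
      ext e
      change MvPolynomial.coeff e.1 (MvPolynomial.monomial d.1 (1 : R)) = _
      rw [MvPolynomial.coeff_monomial, Finsupp.single_apply]
      simp only [Subtype.ext_iff]
    rw [this]
  change (SymmetricAlgebra.equivMvPolynomial b).symm
    (MvPolynomial.basisRestrictSupport R {d : Fin m →₀ ℕ | d.degree = n} d).1 = _
  rw [h, MvPolynomial.monomial_eq, map_one, one_mul, Finsupp.prod, map_prod]
  simp [Finsupp.prod]

theorem IsBaseChangeMap.symMap (n : ℕ) {f : X →ₛₗ[φ] Y} (hf : IsBaseChangeMap f) : IsBaseChangeMap (symMap n f) := by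
  obtain ⟨m, b, b', h⟩ := hf
  obtain ⟨B, hB⟩ := exists_basis_symPower b n
  obtain ⟨B', hB'⟩ := exists_basis_symPower b' n
  have : Finite {d : Fin m →₀ ℕ | d.degree = n} :=
    (Finsupp.finite_of_degree_eq n).to_subtype
  refine IsBaseChangeMap.of_basis B B' fun d => Subtype.ext ?_
  change symAlgMap f (B d) = B' d
  rw [hB, hB', Finsupp.prod, map_prod]
  simp [symAlgMap_ι, h, Finsupp.prod]

/-- The map on duals that sends the dual basis of `b` to the dual basis of `b'`. -/
noncomputable def dualMapOfBasis (φ : R →+* S) {n : ℕ} (b : Basis (Fin n) R X)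
    (b' : Basis (Fin n) S Y) : Dual R X →ₛₗ[φ] Dual S Y where
  toFun ξ := ∑ i, φ (ξ (b i)) • b'.coord i
  map_add' ξ η := by simp [add_smul, Finset.sum_add_distrib]
  map_smul' r ξ := by simp [mul_smul, Finset.smul_sum]

open Classical in
/-- The map induced on duals by a base change map `f`: it sends `ξ` to the only form `η` with
`η (f x) = φ (ξ x)`, see `dualMap_apply`. For `X = Y` and `f` bijective this is `ξ ↦ φ ∘ ξ ∘ f⁻¹`. -/
noncomputable def dualMap (f : X →ₛₗ[φ] Y) : Dual R X →ₛₗ[φ] Dual S Y :=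
  if h : IsBaseChangeMap f then
    dualMapOfBasis φ h.choose_spec.choose h.choose_spec.choose_spec.choose
  else 0

theorem dualMapOfBasis_apply {f : X →ₛₗ[φ] Y} {n : ℕ} (b : Basis (Fin n) R X)
    (b' : Basis (Fin n) S Y) (h : ∀ i, f (b i) = b' i) (ξ : Dual R X) (x : X) :
    dualMapOfBasis φ b b' ξ (f x) = φ (ξ x) := by
  rw [← b.sum_repr x]
  simp only [map_sum, map_smulₛₗ, h]
  simp only [dualMapOfBasis, LinearMap.coe_mk, AddHom.coe_mk, LinearMap.sum_apply,
    LinearMap.smul_apply, smul_eq_mul, RingHom.id_apply, Basis.coord_apply, Basis.repr_self,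
    Finsupp.single_apply]
  simp

theorem dualMap_apply {f : X →ₛₗ[φ] Y} (hf : IsBaseChangeMap f) (ξ : Dual R X) (x : X) :
    dualMap f ξ (f x) = φ (ξ x) := by
  rw [dualMap, dif_pos hf]
  exact dualMapOfBasis_apply _ _ hf.choose_spec.choose_spec.choose_spec ξ x

theorem IsBaseChangeMap.dualMap {f : X →ₛₗ[φ] Y} (hf : IsBaseChangeMap f) : IsBaseChangeMap (dualMap f) := by
  obtain ⟨n, b, b', h⟩ := id hf
  refine IsBaseChangeMap.of_basis b.dualBasis b'.dualBasis fun i => b'.ext fun j => ?_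
  rw [← h j, dualMap_apply hf, h j]
  simp [Finsupp.single_apply, apply_ite φ]


end Functoriality

/-- The prolongation `F_∂(X) = R[∂]_{≤ 1} ⊗ X`, where `R[∂]_{≤ 1}` is a right `R`-module by
`∂ λ = λ ∂ + ∂(λ)`. Every element is `v₀ + ∂(v₁)` for exactly one pair `(v₀, v₁)`, and the pair
stands for that element. -/
def Prolong (X : Type u) : Type u := X × X

namespace Prolong
variable {R S : Type u} [CommRing R] [CommRing S] {φ : R →+* S}
variable {X Y : Type u} [AddCommGroup X] [Module R X] [AddCommGroup Y] [Module S Y]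

instance : AddCommGroup (Prolong X) := inferInstanceAs (AddCommGroup (X × X))

/-- The element `v = 1 ⊗ v`. -/
def of (v : X) : Prolong X := (v, 0)
/-- The element `∂(v) = ∂ ⊗ v`. -/
def del (v : X) : Prolong X := (0, v)

/-- `λ (v₀ + ∂(v₁)) = (λ v₀ - ∂(λ) v₁) + ∂(λ v₁)`, since `λ ∂(v) = ∂(λ v) - ∂(λ) v`. -/
instance [Differential R] : Module R (Prolong X) where
  smul r p := (r • p.1 - r′ • p.2, r • p.2)
  one_smul p := by
    change (((1 : R) • p.1 - (1 : R)′ • p.2, (1 : R) • p.2) : X × X) = (p.1, p.2)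
    simp
  mul_smul r s p := by
    change (((r * s) • p.1 - (r * s)′ • p.2, (r * s) • p.2) : X × X) =
      (r • (s • p.1 - s′ • p.2) - r′ • (s • p.2), r • (s • p.2))
    ext
    · simp only [Derivation.leibniz, smul_eq_mul]
      module
    · exact mul_smul r s p.2
  smul_zero r := by
    change ((r • (0 : X) - r′ • (0 : X), r • (0 : X)) : X × X) = 0
    simp
  smul_add r p p' := by
    change ((r • (p.1 + p'.1) - r′ • (p.2 + p'.2), r • (p.2 + p'.2)) : X × X) =
      (r • p.1 - r′ • p.2, r • p.2) + (r • p'.1 - r′ • p'.2, r • p'.2)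
    ext
    · simp only [Prod.mk_add_mk]; module
    · exact smul_add r p.2 p'.2
  add_smul r s p := by
    change (((r + s) • p.1 - (r + s)′ • p.2, (r + s) • p.2) : X × X) =
      (r • p.1 - r′ • p.2, r • p.2) + (s • p.1 - s′ • p.2, s • p.2)
    ext
    · simp only [Prod.mk_add_mk, map_add]; module
    · exact add_smul r s p.2
  zero_smul p := by
    change (((0 : R) • p.1 - (0 : R)′ • p.2, (0 : R) • p.2) : X × X) = 0
    simp

theorem smul_def [Differential R] (r : R) (p : Prolong X) :
    r • p = (r • p.1 - r′ • p.2, r • p.2) := rfl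

/-- The Leibniz rule `∂(λ v) = λ ∂(v) + ∂(λ) v`. -/
theorem del_smul [Differential R] (r : R) (v : X) :
    del (r • v) = r • del v + r′ • of v := by
  change ((0, r • v) : X × X) =
    (r • (0 : X) - r′ • v, r • v) + (r′ • v - r′′ • (0 : X), r′ • (0 : X))
  simp

theorem eq_of_add_del (p : Prolong X) : p = of p.1 + del p.2 := by
  change ((p.1, p.2) : X × X) = (p.1 + 0, 0 + p.2)
  simp

@[simp] theorem of_fst (v : X) : (of v).1 = v := rfl
@[simp] theorem of_snd (v : X) : (of v).2 = 0 := rfl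
@[simp] theorem del_fst (v : X) : (del v).1 = 0 := rfl
@[simp] theorem del_snd (v : X) : (del v).2 = v := rfl

end Prolong

variable {R S : Type u} [CommRing R] [CommRing S] {φ : R →+* S}
variable {X Y : Type u} [AddCommGroup X] [Module R X] [AddCommGroup Y] [Module S Y]

/-- `F_∂(f)`: it sends `v` to `f v` and `∂(v)` to `∂(f v)`. Here `φ` commutes with the derivations. -/
def prolongMap [Differential R] [Differential S] (hφ : ∀ r, φ (r′) = (φ r)′) (f : X →ₛₗ[φ] Y) :
    Prolong X →ₛₗ[φ] Prolong Y where
  toFun p := (f p.1, f p.2)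
  map_add' p q := Prod.ext (f.map_add _ _) (f.map_add _ _)
  map_smul' r p := by
    change ((f (r • p.1 - r′ • p.2), f (r • p.2)) : Y × Y) =
      (φ r • f p.1 - (φ r)′ • f p.2, φ r • f p.2)
    simp [hφ]


/-- Coordinates in the basis `(e, ∂(e))` of the prolongation. -/
noncomputable def prolongEquivFun [Differential R] {n : ℕ} (b : Basis (Fin n) R X) :
    Prolong X ≃ₗ[R] (Fin n ⊕ Fin n → R) where
  toFun p := Sum.elim (fun i => b.repr p.1 i + (b.repr p.2 i)′) (fun i => b.repr p.2 i)
  invFun c := (∑ i, (c (Sum.inl i) - (c (Sum.inr i))′) • b i, ∑ i, c (Sum.inr i) • b i)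
  map_add' p q := by
    have h1 : (p + q).1 = p.1 + q.1 := rfl
    have h2 : (p + q).2 = p.2 + q.2 := rfl
    ext (i | i)
    · simp only [h1, h2, map_add, Sum.elim_inl, Pi.add_apply, Finsupp.add_apply]; ring
    · simp [h2]
  map_smul' r p := by
    ext (i | i)
    · simp [Prolong.smul_def]; ring
    · simp [Prolong.smul_def]
  left_inv p := by
    refine Prod.ext ?_ ?_
    · simp [b.sum_repr]
    · simp [b.sum_repr]
  right_inv c := by
    ext (i | i) <;> simp [Finsupp.single_apply]

theorem prolongEquivFun_inl [Differential R] {n : ℕ} (b : Basis (Fin n) R X) (p : Prolong X)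
    (i : Fin n) : prolongEquivFun b p (Sum.inl i) = b.repr p.1 i + (b.repr p.2 i)′ := rfl

theorem prolongEquivFun_inr [Differential R] {n : ℕ} (b : Basis (Fin n) R X) (p : Prolong X)
    (i : Fin n) : prolongEquivFun b p (Sum.inr i) = b.repr p.2 i := rfl

theorem prolongBasis_inl [Differential R] {n : ℕ} (b : Basis (Fin n) R X) (i : Fin n) :
    Basis.ofEquivFun (prolongEquivFun b) (Sum.inl i) = Prolong.of (b i) := by
  rw [Basis.coe_ofEquivFun, LinearEquiv.symm_apply_eq]
  ext (j | j)
  · simp [prolongEquivFun_inl, Pi.single_apply, Finsupp.single_apply, eq_comm]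
  · simp [prolongEquivFun_inr]

theorem prolongBasis_inr [Differential R] {n : ℕ} (b : Basis (Fin n) R X) (i : Fin n) :
    Basis.ofEquivFun (prolongEquivFun b) (Sum.inr i) = Prolong.del (b i) := by
  rw [Basis.coe_ofEquivFun, LinearEquiv.symm_apply_eq]
  ext (j | j)
  · by_cases h : i = j <;> simp [prolongEquivFun_inl, h]
  · simp [prolongEquivFun_inr, Pi.single_apply, Finsupp.single_apply, eq_comm]

theorem IsBaseChangeMap.prolongMap [Differential R] [Differential S] (hφ : ∀ r, φ (r′) = (φ r)′)
    {f : X →ₛₗ[φ] Y} (hf : IsBaseChangeMap f) : IsBaseChangeMap (prolongMap hφ f) := by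
  obtain ⟨n, b, b', h⟩ := hf
  refine IsBaseChangeMap.of_basis (Basis.ofEquivFun (prolongEquivFun b))
    (Basis.ofEquivFun (prolongEquivFun b')) ?_
  rintro (i | i)
  · rw [prolongBasis_inl, prolongBasis_inl, ← h]
    exact Prod.ext rfl (map_zero f)
  · rw [prolongBasis_inr, prolongBasis_inr, ← h]
    exact Prod.ext (map_zero f) rfl

/-- Codes for the constructions of differential linear algebra: the smallest family that contains
the given space (`base`) and is closed under direct sums, tensor products, symmetric and exterior
powers, duals and prolongation. -/
inductive Constr : Type
  | base : Constr
  | dsum : Constr → Constr → Constr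
  | tensor : Constr → Constr → Constr
  | sym : ℕ → Constr → Constr
  | alt : ℕ → Constr → Constr
  | dual : Constr → Constr
  | prolong : Constr → Constr

/-- The construction `c` applied to a module `X` over a differential ring `R`. -/
noncomputable def Constr.obj (R : Type u) [CommRing R] [Differential R] (X : Type u) [AddCommGroup X]
    [Module R X] : Constr → ModuleCat.{u} R
  | .base => .of R X
  | .dsum a b => .of R (obj R X a × obj R X b)
  | .tensor a b => .of R (obj R X a ⊗[R] obj R X b)
  | .sym n a => .of R (SymPower R (obj R X a) n)
  | .alt n a => .of R (⋀[R]^n (obj R X a))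
  | .dual a => .of R (Dual R (obj R X a))
  | .prolong a => .of R (Prolong (obj R X a))

/-- Functoriality of the construction `c` for base change maps over homomorphisms of differential
rings. It gives the action on `c(X)` of the automorphisms of `X`, the operator `Σ` on `c(M)`, and the
identification of `A ⊗ c(M)` with `c(A ⊗ M)`. -/
noncomputable def Constr.map [Differential R] [Differential S] (hφ : ∀ r, φ (r′) = (φ r)′)
    (f : X →ₛₗ[φ] Y) : (c : Constr) → c.obj R X →ₛₗ[φ] c.obj S Y
  | .base => f
  | .dsum a b => prodMap (map hφ f a) (map hφ f b)
  | .tensor a b => TensorProduct.map (map hφ f a) (map hφ f b)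
  | .sym n a => symMap n (map hφ f a)
  | .alt n a => altMap n (map hφ f a)
  | .dual a => dualMap (map hφ f a)
  | .prolong a => prolongMap hφ (map hφ f a)

theorem Constr.isBaseChangeMap_map [Differential R] [Differential S] (hφ : ∀ r, φ (r′) = (φ r)′)
    {f : X →ₛₗ[φ] Y} (hf : IsBaseChangeMap f) (c : Constr) : IsBaseChangeMap (c.map hφ f) := by
  induction c with
  | base => exact hf
  | dsum a b ha hb => exact ha.prodMap hb
  | tensor a b ha hb => exact ha.tensorMap hb
  | sym n a ha => exact ha.symMap n
  | alt n a ha => exact ha.altMap n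
  | dual a ha => exact ha.dualMap
  | prolong a ha => exact ha.prolongMap hφ

theorem IsBaseChangeMap.finite {f : X →ₛₗ[φ] Y} (hf : IsBaseChangeMap f) : Module.Finite R X := by
  obtain ⟨n, b, -, -⟩ := hf
  exact Module.Finite.of_basis b

theorem IsBaseChangeMap.bijective {f : X →ₛₗ[φ] Y} (hφ : Function.Bijective φ) (hf : IsBaseChangeMap f) :
    Function.Bijective f := by
  obtain ⟨n, b, b', h⟩ := hf
  have key : ∀ x i, b'.repr (f x) i = φ (b.repr x i) := fun x i => by
    have hx : f x = ∑ j, φ (b.repr x j) • b' j := by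
      conv_lhs => rw [← b.sum_repr x]
      simp only [map_sum, map_smulₛₗ, h]
    rw [hx]
    simp [Finsupp.single_apply]
  refine ⟨fun x y hxy => b.repr.injective (Finsupp.ext fun i => hφ.1 ?_), fun y => ?_⟩
  · rw [← key, ← key, hxy]
  · choose g hg using hφ.2
    refine ⟨∑ i, g (b'.repr y i) • b i, ?_⟩
    simp [h, hg, b'.sum_repr]

theorem IsBaseChangeMap.of_bijective {F : Type u} [Field F] {σ : F ≃+* F} {X Y : Type u} [AddCommGroup X]
    [Module F X] [Module.Finite F X] [AddCommGroup Y] [Module F Y]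
    {f : X →ₛₗ[(σ : F →+* F)] Y} (hf : Function.Bijective f) : IsBaseChangeMap f := by
  let b := Module.finBasis F X
  have hli : LinearIndependent F (fun i => f (b i)) := by
    rw [Fintype.linearIndependent_iff]
    intro g hg i
    have h1 : f (∑ i, σ.symm (g i) • b i) = 0 := by simpa using hg
    have h2 := hf.1 (h1.trans (map_zero f).symm)
    have h3 := Fintype.linearIndependent_iff.mp b.linearIndependent _ h2 i
    simpa using h3
  refine ⟨_, b, Basis.mk hli fun y _ => ?_, fun i => by simp⟩
  obtain ⟨x, rfl⟩ := hf.2 y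
  rw [← b.sum_repr x]
  simp only [map_sum, map_smulₛₗ]
  exact Submodule.sum_mem _ fun i _ => Submodule.smul_mem _ _ (Submodule.subset_span ⟨i, rfl⟩)

theorem isBaseChangeMap_linearEquiv [Module.Free R X] [Module.Finite R X] {X' : Type u}
    [AddCommGroup X'] [Module R X'] (g : X ≃ₗ[R] X') : IsBaseChangeMap g.toLinearMap :=
  IsBaseChangeMap.of_basis (Module.Free.chooseBasis R X) ((Module.Free.chooseBasis R X).map g)
    fun i => by simp

/-- The map `x ↦ 1 ⊗ x` from `X` to `A ⊗ X`, semilinear over the structure map `F → A`. -/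
noncomputable def toBaseChange (F A X : Type u) [CommRing F] [CommRing A] [Algebra F A]
    [AddCommGroup X] [Module F X] : X →ₛₗ[algebraMap F A] A ⊗[F] X where
  toFun x := 1 ⊗ₜ x
  map_add' x y := TensorProduct.tmul_add _ _ _
  map_smul' r x := by
    rw [TensorProduct.tmul_smul, algebraMap_smul]

theorem isBaseChangeMap_toBaseChange (F A X : Type u) [CommRing F] [CommRing A] [Algebra F A]
    [AddCommGroup X] [Module F X] [Module.Free F X] [Module.Finite F X] :
    IsBaseChangeMap (toBaseChange F A X) :=
  IsBaseChangeMap.of_basis (Module.Free.chooseBasis F X)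
    ((Module.Free.chooseBasis F X).baseChange A) fun i => by simp [toBaseChange]

/-- The automorphism `f(x) ↦ f(qx)` of `K(x)`. -/
noncomputable def qDilation {K : Type v} [Field K] (q : K) (hq : q ≠ 0) :
    RatFunc K →+* RatFunc K :=
  RatFunc.mapRingHom (Polynomial.compRingHom (Polynomial.C q * Polynomial.X)) (by
    intro p hp
    rw [Submonoid.mem_comap, mem_nonZeroDivisors_iff_ne_zero]
    rw [mem_nonZeroDivisors_iff_ne_zero] at hp
    intro h
    refine hp (Polynomial.ext fun n => ?_)
    have h1 := congrArg (fun r : Polynomial K => r.coeff n) h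
    simp only [Polynomial.coe_compRingHom_apply, Polynomial.comp_C_mul_X_coeff,
      Polynomial.coeff_zero] at h1
    simpa [hq] using h1)

/-- A `q`-difference module over `(F, σ)`: a finite dimensional `F`-vector space with an invertible
`σ`-semilinear operator. -/
structure QDiffModule (F : Type u) [Field F] (σ : F ≃+* F) where
  /-- The underlying vector space. -/
  carrier : Type u
  [addCommGroup : AddCommGroup carrier]
  [module : Module F carrier]
  [finite : Module.Finite F carrier]
  /-- The operator `Σ`. -/
  Sg : carrier →ₛₗ[(σ : F →+* F)] carrier
  bijective : Function.Bijective Sg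

attribute [instance] QDiffModule.addCommGroup QDiffModule.module QDiffModule.finite

namespace QDiffModule

variable {F : Type u} [Field F] {σ : F ≃+* F}

theorem isBaseChangeMap (M : QDiffModule F σ) : IsBaseChangeMap M.Sg :=
  IsBaseChangeMap.of_bijective M.bijective

/-- The `q`-difference module given by an operator that is a base change map. -/
def ofIsBaseChangeMap {X : Type u} [AddCommGroup X] [Module F X]
    (f : X →ₛₗ[(σ : F →+* F)] X) (hf : IsBaseChangeMap f) : QDiffModule F σ where
  carrier := X
  finite := hf.finite
  Sg := f
  bijective := hf.bijective σ.bijective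

/-- The unit object `(F, σ)`. -/
def unit (F : Type u) [Field F] (σ : F ≃+* F) : QDiffModule F σ where
  carrier := F
  Sg :=
    { toFun := σ
      map_add' := map_add σ
      map_smul' := fun r x => map_mul σ r x }
  bijective := σ.bijective

/-- Direct sum, with `Σ (x, y) = (Σ x, Σ y)`. -/
def prod (M N : QDiffModule F σ) : QDiffModule F σ :=
  ofIsBaseChangeMap (prodMap M.Sg N.Sg) (M.isBaseChangeMap.prodMap N.isBaseChangeMap)

/-- Tensor product, with `Σ (x ⊗ y) = Σ x ⊗ Σ y`. -/
noncomputable def tensor (M N : QDiffModule F σ) : QDiffModule F σ :=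
  ofIsBaseChangeMap (TensorProduct.map M.Sg N.Sg)
    (M.isBaseChangeMap.tensorMap N.isBaseChangeMap)

/-- Dual, with `Σ ξ = σ ∘ ξ ∘ Σ⁻¹`. -/
noncomputable def dual (M : QDiffModule F σ) : QDiffModule F σ :=
  ofIsBaseChangeMap (dualMap M.Sg) M.isBaseChangeMap.dualMap

/-- The restriction of `Σ` to a subspace `N` with `Σ(N) = N`. -/
def sub (M : QDiffModule F σ) (N : Submodule F M.carrier)
    (hN : M.Sg '' (N : Set M.carrier) = N) : QDiffModule F σ where
  carrier := N
  Sg :=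
    { toFun := fun x => ⟨M.Sg x, by
        have h : M.Sg x ∈ M.Sg '' (N : Set M.carrier) := ⟨x, x.2, rfl⟩
        rwa [hN] at h⟩
      map_add' := fun x y => Subtype.ext (map_add M.Sg _ _)
      map_smul' := fun r x => Subtype.ext (map_smulₛₗ M.Sg _ _) }
  bijective := by
    refine ⟨fun x y h => Subtype.ext (M.bijective.1 (Subtype.ext_iff.mp h)), fun y => ?_⟩
    have h : (y : M.carrier) ∈ M.Sg '' (N : Set M.carrier) := by rw [hN]; exact y.2
    obtain ⟨x, hx, hxy⟩ := h
    exact ⟨⟨x, hx⟩, Subtype.ext hxy⟩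

/-- A morphism of `q`-difference modules: a linear map that commutes with `Σ`. -/
def IsHom {M N : QDiffModule F σ} (f : M.carrier →ₗ[F] N.carrier) : Prop :=
  ∀ x, f (M.Sg x) = N.Sg (f x)

variable [Differential F]

/-- Prolongation, with `Σ (v) = Σ v` and `Σ (∂(v)) = ∂(Σ v)`. -/
def prolong (hσ : ∀ f : F, (σ : F →+* F) (f′) = ((σ : F →+* F) f)′) (M : QDiffModule F σ) :
    QDiffModule F σ :=
  ofIsBaseChangeMap (prolongMap hσ M.Sg) (M.isBaseChangeMap.prolongMap hσ)

/-- The `q`-difference module `c(M)` given by a construction `c` of differential linear algebra. -/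
noncomputable def constr (hσ : ∀ f : F, (σ : F →+* F) (f′) = ((σ : F →+* F) f)′)
    (M : QDiffModule F σ) (c : Constr) : QDiffModule F σ :=
  ofIsBaseChangeMap (c.map hσ M.Sg) (c.isBaseChangeMap_map hσ M.isBaseChangeMap)

/-- The objects of `⟨M⟩^{⊗,∂}`, the full abelian tensor subcategory of the category of
`q`-difference modules that is generated by `M` and closed under prolongation: it contains `M` and the
unit object, and is closed under subobjects, quotients, direct sums, tensor products, duals and
prolongation (and so under isomorphism). -/
inductive InTensorCategory (hσ : ∀ f : F, (σ : F →+* F) (f′) = ((σ : F →+* F) f)′)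
    (M : QDiffModule F σ) : QDiffModule F σ → Prop
  | gen : InTensorCategory hσ M M
  | unit : InTensorCategory hσ M (QDiffModule.unit F σ)
  | sub {X Y : QDiffModule F σ} (f : Y.carrier →ₗ[F] X.carrier) (hf : IsHom f)
      (hinj : Function.Injective f) : InTensorCategory hσ M X → InTensorCategory hσ M Y
  | quot {X Y : QDiffModule F σ} (f : X.carrier →ₗ[F] Y.carrier) (hf : IsHom f)
      (hsurj : Function.Surjective f) : InTensorCategory hσ M X → InTensorCategory hσ M Y
  | prod {X Y : QDiffModule F σ} :
      InTensorCategory hσ M X → InTensorCategory hσ M Y → InTensorCategory hσ M (X.prod Y)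
  | tensor {X Y : QDiffModule F σ} :
      InTensorCategory hσ M X → InTensorCategory hσ M Y → InTensorCategory hσ M (X.tensor Y)
  | dual {X : QDiffModule F σ} : InTensorCategory hσ M X → InTensorCategory hσ M X.dual
  | prolong {X : QDiffModule F σ} :
      InTensorCategory hσ M X → InTensorCategory hσ M (X.prolong hσ)

variable (A : Type u) [CommRing A] [Algebra F A] [Differential A]

section Stabilizer

variable [DifferentialAlgebra F A] {X : Type u} [AddCommGroup X] [Module F X]

/-- For a subspace `N` of `c(X)`, the submodule `A ⊗ N` of `A ⊗ c(X) = c(A ⊗ X)`. -/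
noncomputable def scalarExtension (c : Constr) (N : Submodule F (c.obj F X)) :
    Submodule A (c.obj A (A ⊗[F] X)) :=
  Submodule.span A (c.map (fun f => (deriv_algebraMap (A := F) (B := A) f).symm)
    (toBaseChange F A X) '' N)

/-- The `A`-points of the differential stabilizer of a subspace `N` of `c(X)`: the elements `g` of
`GL(X)(A)`, acting on `c(A ⊗ X)`, that map `A ⊗ N` to itself. -/
def stabilizer (c : Constr) (N : Submodule F (c.obj F X)) :
    Set ((A ⊗[F] X) ≃ₗ[A] (A ⊗[F] X)) :=
  {g | ∀ y ∈ scalarExtension A c N,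
    c.map (φ := RingHom.id A) (fun _ => rfl) g.toLinearMap y ∈ scalarExtension A c N}

end Stabilizer

/-- The `A`-points of the parameterized generic Galois group of `M`, for a differential `F`-algebra
`A`: the elements of `GL(M)(A)` that stabilize `A ⊗ N` for all sub-`q`-difference modules `N` of all
constructions of differential linear algebra of `M`. -/
def galoisGroup [DifferentialAlgebra F A]
    (hσ : ∀ f : F, (σ : F →+* F) (f′) = ((σ : F →+* F) f)′) (M : QDiffModule F σ) :
    Set ((A ⊗[F] M.carrier) ≃ₗ[A] (A ⊗[F] M.carrier)) :=
  {g | ∀ (c : Constr) (N : Submodule F (M.constr hσ c).carrier),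
    (M.constr hσ c).Sg '' (N : Set (M.constr hσ c).carrier) = N → g ∈ stabilizer A c N}

end QDiffModule

end QDifference

/-! The stabilizers of the sub-`q`-difference modules of all constructions form a downward directed
family of differential algebraic subgroups of `GL_n`: the stabilizer of `N ⊕ N'` lies in those of
`N` and of `N'` (`stabilizer_prod_subset`). If the family has a least member `Stab(N)`, this is the
Galois group. With `r = dim N`, an automorphism that preserves the line `⋀ʳ N` preserves `N`
(`stabilizer_span_ιMulti_subset`), and `⋀ʳ N` is again a sub-`q`-difference module, so the Galois
group preserves it. Hence `L = ⋀ʳ N` works.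

The substance is the existence of a least member, a descending chain condition
(`exists_least_of_directed`). The groups are functors on all differential algebras, nilpotents
allowed, so a basis theorem for radical differential ideals would not suffice; the group structure
is used instead. Let `I` be the union of the vanishing ideals of the members, `C` the quotient of
the coordinate ring by `I`, `g` its universal point and `a = g⁻¹ g′`. Then `C` is generated by the
entries of `g`, `g⁻¹`, `a`, `a′`, `a″`, and so on. Let `C_k` be the subalgebra generated by `g`,
`g⁻¹` and the derivatives of `a` of order less than `k`.

The cocycle rule for logarithmic derivatives shows that the map dual to `(g, h) ↦ g⁻¹ h` sends the
`k`-th derivative of `a` to `1 ⊗ a^(k)` modulo `C ⊗ C_k` (`comul_a`). By a Kolchin-Ostrowski theorem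
(`eq_zero_of_eval_eq_zero`), linear forms in `a^(k)` that are linearly independent modulo `C_k` are
algebraically independent over `C_k`. So every new relation comes from linear forms whose value lies
in `C_k`. The spaces of these forms grow with `k` inside a finite dimensional space and become
stationary; from then on new relations follow by differentiating old ones (`evalAt_eq_zero_succ`).
Thus the vanishing of all of `I` at a matrix follows from the vanishing of its elements in finitely
many variables. By Hilbert's basis theorem finitely many suffice, and by directedness one member of
the family satisfies them all. -/

namespace QDifference

/-! ### A Kolchin-Ostrowski theorem for Hopf algebras. -/

section KolchinOstrowski

/-- Contraction of the first factor of a tensor product with a linear form. -/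
noncomputable def contractLeft {F V N : Type*} [CommRing F] [AddCommGroup V] [Module F V]
    [AddCommGroup N] [Module F N] (ξ : V →ₗ[F] F) : V ⊗[F] N →ₗ[F] N :=
  (TensorProduct.lid F N).toLinearMap ∘ₗ ξ.rTensor N

@[simp] theorem contractLeft_tmul {F V N : Type*} [CommRing F] [AddCommGroup V] [Module F V]
    [AddCommGroup N] [Module F N] (ξ : V →ₗ[F] F) (v : V) (n : N) :
    contractLeft ξ (v ⊗ₜ[F] n) = ξ v • n := by
  simp [contractLeft]

theorem eq_zero_of_contractLeft {F V N : Type*} [Field F] [AddCommGroup V] [Module F V]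
    [AddCommGroup N] [Module F N] {z : V ⊗[F] N} (h : ∀ ξ : V →ₗ[F] F, contractLeft ξ z = 0) :
    z = 0 := by
  classical
  refine (TensorProduct.equivFinsuppOfBasisLeft (Basis.ofVectorSpace F V)).injective ?_
  ext i
  rw [TensorProduct.equivFinsuppOfBasisLeft_apply, map_zero]
  exact h _

variable {F : Type*} [Field F]

theorem contractLeft_map {R S R' S' : Type*} [CommRing R] [Algebra F R] [CommRing S] [Algebra F S]
    [CommRing R'] [Algebra F R'] [CommRing S'] [Algebra F S'] (i : R →ₐ[F] R') (j : S →ₐ[F] S')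
    (ξ : R' →ₗ[F] F) (z : R ⊗[F] S) :
    contractLeft ξ (Algebra.TensorProduct.map i j z) = j (contractLeft (ξ ∘ₗ i.toLinearMap) z) := by
  induction z with
  | zero => simp
  | add x y hx hy => simp only [map_add, hx, hy]
  | tmul x y => simp

section Constants

variable {R : Type*} [CommRing R] [Algebra F R]

/-- A submodule of a free module over a Hopf algebra that is stable under the coaction on
coefficients contains the constants obtained from its elements by the counit. -/
theorem counit_mem_of_stable {ε : R →ₐ[F] F} {L : R →ₐ[F] R ⊗[F] R}
    (hmul : ∀ r, Algebra.TensorProduct.lift (AlgHom.id F R) (AlgHom.id F R)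
      (fun _ _ => Commute.all _ _) (L r) = algebraMap F R (ε r))
    {s : Type*} [Finite s] {N : Submodule R (s → R)}
    (hN : ∀ f ∈ N, ∀ ξ : R →ₗ[F] F, (fun i => contractLeft ξ (L (f i))) ∈ N)
    {f : s → R} (hf : f ∈ N) : (fun i => algebraMap F R (ε (f i))) ∈ N := by
  classical
  have := Fintype.ofFinite s
  let e := Basis.ofVectorSpace F R
  let z : s → _ →₀ R := fun i => TensorProduct.equivFinsuppOfBasisLeft e (L (f i))
  let T := Finset.univ.biUnion fun i => (z i).support
  -- Multiplying the two factors of `L (f i) = ∑ e j ⊗ z i j` gives the counit on one side and an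
  -- `R`-combination of contractions, which lie in `N`, on the other.
  have key : (fun i => algebraMap F R (ε (f i))) =
      ∑ j ∈ T, e j • fun i => contractLeft (e.coord j) (L (f i)) := by
    ext i
    have h1 : L (f i) = (z i).sum fun j r => e j ⊗ₜ[F] r := by
      rw [← TensorProduct.equivFinsuppOfBasisLeft_symm_apply, LinearEquiv.symm_apply_apply]
    have h2 : (z i).sum (fun j r => e j ⊗ₜ[F] r) = ∑ j ∈ T, e j ⊗ₜ[F] z i j :=
      Finsupp.sum_of_support_subset _
        (Finset.subset_biUnion_of_mem (fun i => (z i).support) (Finset.mem_univ i)) _ (by simp)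
    rw [← hmul, h1, h2, map_sum, Finset.sum_apply]
    refine Finset.sum_congr rfl fun j _ => ?_
    rw [Algebra.TensorProduct.lift_tmul, Pi.smul_apply, smul_eq_mul]
    congr 1
    exact TensorProduct.equivFinsuppOfBasisLeft_apply ..
  rw [key]
  exact Submodule.sum_mem _ fun j _ => N.smul_mem _ (hN f hf _)

/-- The counit may kill a given nonzero vector of `N`. By `hinj` some contraction of it has nonzero
counit, and contractions stay in `N`. -/
theorem exists_const_mem_of_stable {ε : R →ₐ[F] F} {L : R →ₐ[F] R ⊗[F] R}
    (hmul : ∀ r, Algebra.TensorProduct.lift (AlgHom.id F R) (AlgHom.id F R)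
      (fun _ _ => Commute.all _ _) (L r) = algebraMap F R (ε r))
    (hinj : ∀ r, (∀ ξ : R →ₗ[F] F, ε (contractLeft ξ (L r)) = 0) → r = 0)
    {s : Type*} [Finite s] {N : Submodule R (s → R)}
    (hN : ∀ f ∈ N, ∀ ξ : R →ₗ[F] F, (fun i => contractLeft ξ (L (f i))) ∈ N)
    (hne : N ≠ ⊥) : ∃ c : s → F, c ≠ 0 ∧ (fun i => algebraMap F R (c i)) ∈ N := by
  obtain ⟨f, hf, hf0⟩ := N.ne_bot_iff.mp hne
  obtain ⟨i, hi⟩ := Function.ne_iff.mp hf0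
  obtain ⟨ξ, hξ⟩ := not_forall.mp (mt (hinj (f i)) hi)
  exact ⟨_, Function.ne_iff.mpr ⟨i, hξ⟩, counit_mem_of_stable hmul hN (hN f hf ξ)⟩

end Constants

section Degree

variable {ι : Type*} (R : Type*) [CommRing R]

variable (ι) in
/-- Polynomials of total degree less than `n`. -/
def degreeLT (n : ℕ) : Submodule R (MvPolynomial ι R) where
  carrier := {f | ∀ α, n ≤ α.degree → f.coeff α = 0}
  add_mem' hf hg α h := by rw [MvPolynomial.coeff_add, hf α h, hg α h, add_zero]
  zero_mem' α _ := MvPolynomial.coeff_zero α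
  smul_mem' r f hf α h := by rw [MvPolynomial.coeff_smul, hf α h, smul_zero]

variable {R}

theorem degreeLT_mono {m n : ℕ} (h : m ≤ n) : degreeLT ι R m ≤ degreeLT ι R n :=
  fun _ hf α hα => hf α (h.trans hα)

theorem eq_zero_of_mem_degreeLT_zero {f : MvPolynomial ι R} (hf : f ∈ degreeLT ι R 0) : f = 0 :=
  MvPolynomial.ext _ _ fun α => by rw [hf α (Nat.zero_le _), MvPolynomial.coeff_zero]

theorem exists_mem_degreeLT (f : MvPolynomial ι R) : ∃ n, f ∈ degreeLT ι R n := by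
  refine ⟨f.totalDegree + 1, fun α hα => MvPolynomial.coeff_eq_zero_of_totalDegree_lt ?_⟩
  rw [← Finsupp.degree_apply]
  omega

theorem C_mul_mem_degreeLT {n : ℕ} {f : MvPolynomial ι R} (r : R) (hf : f ∈ degreeLT ι R n) :
    MvPolynomial.C r * f ∈ degreeLT ι R n := by
  rw [← MvPolynomial.smul_eq_C_mul]
  exact Submodule.smul_mem _ _ hf

theorem monomial_mem_degreeLT {n : ℕ} {s : ι →₀ ℕ} (hs : s.degree < n) (r : R) :
    MvPolynomial.monomial s r ∈ degreeLT ι R n := fun α hα => by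
  classical
  rw [MvPolynomial.coeff_monomial, if_neg]
  rintro rfl
  omega

theorem X_mul_mem_degreeLT {n : ℕ} {f : MvPolynomial ι R} (i : ι) (hf : f ∈ degreeLT ι R n) :
    MvPolynomial.X i * f ∈ degreeLT ι R (n + 1) := fun α hα => by
  classical
  rw [MvPolynomial.coeff_X_mul']
  split_ifs with h
  · refine hf _ ?_
    have h1 : Finsupp.single i 1 ≤ α := by
      rw [Finsupp.single_le_iff]
      exact Nat.one_le_iff_ne_zero.mpr (Finsupp.mem_support_iff.mp h)
    have h2 := congrArg Finsupp.degree (tsub_add_cancel_of_le h1)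
    rw [map_add, Finsupp.degree_single] at h2
    omega
  · rfl

theorem pderiv_mem_degreeLT {n : ℕ} {f : MvPolynomial ι R} (i : ι)
    (hf : f ∈ degreeLT ι R (n + 1)) : MvPolynomial.pderiv i f ∈ degreeLT ι R n := fun α hα => by
  rw [MvPolynomial.coeff_pderiv, hf _ (by rw [map_add, Finsupp.degree_single]; omega), zero_mul]

/-- A partial derivative multiplies coefficients by exponents, and nonzero exponents are units in
any algebra over a field of characteristic zero, zero divisors or not. This is where characteristic
zero enters. -/
theorem exists_eq_C_of_pderiv_eq_zero [CharZero F] [Algebra F R] {f : MvPolynomial ι R}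
    (h : ∀ i, MvPolynomial.pderiv i f = 0) : ∃ r, f = MvPolynomial.C r := by
  classical
  refine ⟨f.coeff 0, MvPolynomial.ext _ _ fun α => ?_⟩
  rw [MvPolynomial.coeff_C]
  split_ifs with h0
  · rw [h0]
  · obtain ⟨i, hi⟩ : ∃ i, α i ≠ 0 := by
      by_contra! h1
      exact h0 (Finsupp.ext h1).symm
    have h1 : Finsupp.single i 1 ≤ α :=
      Finsupp.single_le_iff.mpr (Nat.one_le_iff_ne_zero.mpr hi)
    have h2 := congrArg (MvPolynomial.coeff (α - Finsupp.single i 1)) (h i)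
    rw [MvPolynomial.coeff_pderiv, tsub_add_cancel_of_le h1, MvPolynomial.coeff_zero] at h2
    have h3 : (((α - Finsupp.single i 1 : ι →₀ ℕ) i : ℕ) : R) + 1 = algebraMap F R (α i) := by
      rw [map_natCast]
      have : (α - Finsupp.single i 1 : ι →₀ ℕ) i + 1 = α i := by
        simp only [Finsupp.coe_tsub, Pi.sub_apply, Finsupp.single_eq_same]
        omega
      exact_mod_cast congrArg (Nat.cast (R := R)) this
    rw [h3] at h2
    have h4 : IsUnit (algebraMap F R (α i)) :=
      (IsUnit.mk0 _ (Nat.cast_ne_zero.mpr hi)).map _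
    exact (h4.mul_left_eq_zero).mp h2

end Degree

section Translation

variable {ι R S : Type*} [CommRing R] [CommRing S]

/-- The homomorphism `f(T) ↦ f^φ(T + q)` of polynomial rings. -/
noncomputable def translate (φ : R →+* S) (q : ι → S) : MvPolynomial ι R →+* MvPolynomial ι S :=
  MvPolynomial.eval₂Hom (MvPolynomial.C.comp φ) fun i => MvPolynomial.X i + MvPolynomial.C (q i)

@[simp] theorem translate_C (φ : R →+* S) (q : ι → S) (r : R) :
    translate φ q (MvPolynomial.C r) = MvPolynomial.C (φ r) := by
  simp [translate]

@[simp] theorem translate_X (φ : R →+* S) (q : ι → S) (i : ι) :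
    translate φ q (MvPolynomial.X i) = MvPolynomial.X i + MvPolynomial.C (q i) := by
  simp [translate]

/-- Used to see that the derivatives of a translation-invariant polynomial are again invariant. -/
theorem pderiv_translate (φ : R →+* S) (q : ι → S) (i : ι) (f : MvPolynomial ι R) :
    MvPolynomial.pderiv i (translate φ q f) = translate φ q (MvPolynomial.pderiv i f) := by
  classical
  induction f using MvPolynomial.induction_on with
  | C a => simp
  | add p q hp hq => simp [hp, hq]
  | mul_X p j hp =>
    simp only [map_mul, translate_X, Derivation.leibniz, hp, smul_eq_mul, map_add,
      MvPolynomial.pderiv_X, MvPolynomial.pderiv_C, add_zero]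
    congr 2
    simp only [Pi.single_apply]
    split_ifs <;> simp

/-- Translation changes only lower terms. Splitting off one variable, `(X + q) P - X m = X (P - m) +
q P`, where `P` is the translate of `m`. -/
theorem translate_monomial_sub (φ : R →+* S) (q : ι → S) (s : ι →₀ ℕ) :
    translate φ q (MvPolynomial.monomial s 1) - MvPolynomial.monomial s 1 ∈
      degreeLT ι S s.degree := by
  classical
  induction hn : s.degree generalizing s with
  | zero =>
    obtain rfl := (Finsupp.degree_eq_zero_iff s).mp hn
    simp
  | succ n ih =>
    obtain ⟨i, hi⟩ : ∃ i, s i ≠ 0 := by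
      by_contra! h
      have : s = 0 := Finsupp.ext h
      simp [this] at hn
    have h1 : Finsupp.single i 1 ≤ s :=
      Finsupp.single_le_iff.mpr (Nat.one_le_iff_ne_zero.mpr hi)
    obtain ⟨t, rfl⟩ := exists_add_of_le h1
    have ht : t.degree = n := by
      rw [map_add, Finsupp.degree_single] at hn
      omega
    have h2 {T : Type _} [CommRing T] : (MvPolynomial.monomial (Finsupp.single i 1 + t) 1 :
        MvPolynomial ι T) = MvPolynomial.X i * MvPolynomial.monomial t 1 := by
      rw [MvPolynomial.X, MvPolynomial.monomial_mul, mul_one]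
    have h2' : (MvPolynomial.monomial (Finsupp.single i 1 + t) 1 :
        MvPolynomial ι S) = MvPolynomial.X i * MvPolynomial.monomial t 1 := by
      rw [MvPolynomial.X, MvPolynomial.monomial_mul, mul_one]
    have h3 := ih t ht
    set P := translate φ q (MvPolynomial.monomial t 1)
    have h4 : P ∈ degreeLT ι S (n + 1) := by
      rw [← sub_add_cancel P (MvPolynomial.monomial t 1)]
      exact add_mem (degreeLT_mono (Nat.le_succ n) h3) (monomial_mem_degreeLT (by omega) 1)
    have h5 : translate φ q (MvPolynomial.X i * MvPolynomial.monomial t 1) -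
        MvPolynomial.X i * MvPolynomial.monomial t 1 =
        MvPolynomial.X i * (P - MvPolynomial.monomial t 1) + MvPolynomial.C (q i) * P := by
      rw [map_mul, translate_X]
      ring
    rw [h2, h2', h5]
    exact add_mem (X_mul_mem_degreeLT i h3) (C_mul_mem_degreeLT _ h4)

theorem translate_sub_map_mem (φ : R →+* S) (q : ι → S) {n : ℕ} {f : MvPolynomial ι R}
    (hf : f ∈ degreeLT ι R (n + 1)) :
    translate φ q f - MvPolynomial.map φ f ∈ degreeLT ι S n := by
  classical
  rw [f.as_sum, map_sum, map_sum, ← Finset.sum_sub_distrib]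
  refine Submodule.sum_mem _ fun s hs => ?_
  have hs' : s.degree ≤ n := by
    by_contra h
    exact MvPolynomial.mem_support_iff.mp hs (hf s (by omega))
  have h1 : MvPolynomial.monomial s (f.coeff s) =
      MvPolynomial.C (f.coeff s) * MvPolynomial.monomial s 1 := by
    rw [MvPolynomial.C_mul_monomial, mul_one]
  rw [h1, map_mul, map_mul, translate_C, MvPolynomial.map_C, MvPolynomial.map_monomial,
    φ.map_one, ← mul_sub]
  exact C_mul_mem_degreeLT _ (degreeLT_mono hs' (translate_monomial_sub φ q s))

end Translation


section Main

variable {ι R C : Type*} [CommRing R] [Algebra F R] [CommRing C] [Algebra F C]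

/-- Coefficientwise contraction with a linear form. -/
noncomputable def contractCoeff (ξ : C →ₗ[F] F) :
    MvPolynomial ι (C ⊗[F] R) →+ MvPolynomial ι R where
  toFun p := ∑ α ∈ p.support, MvPolynomial.monomial α (contractLeft ξ (p.coeff α))
  map_zero' := by simp
  map_add' p q := by
    classical
    refine MvPolynomial.ext _ _ fun α => ?_
    have h : ∀ p : MvPolynomial ι (C ⊗[F] R),
        (∑ α ∈ p.support, MvPolynomial.monomial α (contractLeft ξ (p.coeff α))).coeff α =
          contractLeft ξ (p.coeff α) := fun p => by
      simp only [MvPolynomial.coeff_sum, MvPolynomial.coeff_monomial, Finset.sum_ite_eq',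
        MvPolynomial.mem_support_iff]
      split_ifs with h0
      · rfl
      · rw [not_not.mp h0, map_zero]
    rw [MvPolynomial.coeff_add, h, h, h, MvPolynomial.coeff_add, map_add]

theorem coeff_contractCoeff (ξ : C →ₗ[F] F) (p : MvPolynomial ι (C ⊗[F] R)) (α : ι →₀ ℕ) :
    (contractCoeff ξ p).coeff α = contractLeft ξ (p.coeff α) := by
  classical
  simp only [contractCoeff, AddMonoidHom.coe_mk, ZeroHom.coe_mk, MvPolynomial.coeff_sum,
    MvPolynomial.coeff_monomial, Finset.sum_ite_eq', MvPolynomial.mem_support_iff]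
  split_ifs with h0
  · rfl
  · rw [not_not.mp h0, map_zero]

theorem contractCoeff_monomial (ξ : C →ₗ[F] F) (α : ι →₀ ℕ) (z : C ⊗[F] R) :
    contractCoeff ξ (MvPolynomial.monomial α z) = MvPolynomial.monomial α (contractLeft ξ z) := by
  classical
  refine MvPolynomial.ext _ _ fun β => ?_
  rw [coeff_contractCoeff, MvPolynomial.coeff_monomial, MvPolynomial.coeff_monomial]
  split_ifs <;> simp

/-- Turns a relation between the `1 ⊗ τ j` over `C ⊗ R` into relations between the `τ j` over `R`,
one for each form `ξ`. -/
theorem eval_contractCoeff (i : R →ₐ[F] C) (τ : ι → C) (ξ : C →ₗ[F] F)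
    (p : MvPolynomial ι (C ⊗[F] R)) :
    MvPolynomial.eval₂Hom (i : R →+* C) τ (contractCoeff ξ p) =
      contractLeft ξ (MvPolynomial.eval₂Hom
        (Algebra.TensorProduct.map (AlgHom.id F C) i : C ⊗[F] R →+* C ⊗[F] C)
        (fun j => 1 ⊗ₜ[F] τ j) p) := by
  induction p using MvPolynomial.induction_on' with
  | add p q hp hq => simp only [map_add, hp, hq]
  | monomial α z =>
    have h1 : (α.prod fun j k => (1 ⊗ₜ[F] τ j : C ⊗[F] C) ^ k) =
        1 ⊗ₜ[F] (α.prod fun j k => τ j ^ k) := by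
      have := map_prod (Algebra.TensorProduct.includeRight : C →ₐ[F] C ⊗[F] C)
        (fun j => τ j ^ α j) α.support
      simp only [Algebra.TensorProduct.includeRight_apply] at this
      rw [Finsupp.prod, Finsupp.prod, this]
      simp
    rw [contractCoeff_monomial, MvPolynomial.coe_eval₂Hom, MvPolynomial.coe_eval₂Hom,
      MvPolynomial.eval₂_monomial, MvPolynomial.eval₂_monomial, h1]
    induction z with
    | zero => simp
    | add x y hx hy => simp only [map_add, add_mul, hx, hy]
    | tmul x y => simp

/-- A Kolchin-Ostrowski theorem: let `R ⊆ C` be commutative Hopf algebras in characteristic zero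
and `τ` elements of `C` that are primitive modulo `C ⊗ R`. If no nontrivial linear combination of
the `τ j` with coefficients in the ground field lies in `R`, then they are algebraically independent
over `R`. Here `L` is the map dual to `(g, h) ↦ g⁻¹ h`. -/
theorem eq_zero_of_eval_eq_zero [CharZero F] [Finite ι] {i : R →ₐ[F] C}
    {L : C →ₐ[F] C ⊗[F] C} {LR : R →ₐ[F] R ⊗[F] R}
    (hi : Function.Injective i)
    (hLR : ∀ r, Algebra.TensorProduct.map i i (LR r) = L (i r)) {ε : C →ₐ[F] F}
    (hmul : ∀ x, Algebra.TensorProduct.lift (AlgHom.id F C) (AlgHom.id F C)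
      (fun _ _ => Commute.all _ _) (L x) = algebraMap F C (ε x))
    (hinj : ∀ x, (∀ ξ : C →ₗ[F] F, ε (contractLeft ξ (L x)) = 0) → x = 0)
    {τ : ι → C} {q : ι → C ⊗[F] R}
    (hq : ∀ j, L (τ j) = 1 ⊗ₜ τ j + Algebra.TensorProduct.map (AlgHom.id F C) i (q j))
    (hτ : ∀ (c : ι → F) (r : R), ∑ᶠ j, c j • τ j = i r → c = 0)
    {f : MvPolynomial ι R} (hf : MvPolynomial.eval₂Hom (i : R →+* C) τ f = 0) : f = 0 := by
  classical
  have := Fintype.ofFinite ι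
  let inc : C ⊗[F] R →ₐ[F] C ⊗[F] C := Algebra.TensorProduct.map (AlgHom.id F C) i
  let L₂ : R →ₐ[F] C ⊗[F] R := (Algebra.TensorProduct.map i (AlgHom.id F R)).comp LR
  have hL₂ : ∀ r, inc (L₂ r) = L (i r) := fun r => by
    rw [← hLR]
    change ((Algebra.TensorProduct.map (AlgHom.id F C) i).comp
      (Algebra.TensorProduct.map i (AlgHom.id F R))) (LR r) = _
    congr 1
    ext <;> simp
  have hLtriv : ∀ x, L x = 1 ⊗ₜ x → x = algebraMap F C (ε x) := fun x hx => by
    rw [← hmul, hx]; simp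
  let eτ := MvPolynomial.eval₂Hom (i : R →+* C) τ
  let E := MvPolynomial.eval₂Hom (inc : C ⊗[F] R →+* C ⊗[F] C) fun j => 1 ⊗ₜ[F] τ j
  -- By `hEtr` and `hEone`, `tr` lifts `L`, and `one` lifts `x ↦ 1 ⊗ x`, from values to polynomials.
  -- Invariance under the group becomes the equation `tr f = one f`.
  let tr : MvPolynomial ι R →+* MvPolynomial ι (C ⊗[F] R) := translate (L₂ : R →+* C ⊗[F] R) q
  let inR : R →ₐ[F] C ⊗[F] R := Algebra.TensorProduct.includeRight
  let one : MvPolynomial ι R →+* MvPolynomial ι (C ⊗[F] R) :=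
    MvPolynomial.map (inR : R →+* C ⊗[F] R)
  have hEtr : ∀ f, E (tr f) = L (eτ f) := fun f => by
    refine RingHom.congr_fun (f := E.comp tr) (g := (L : C →+* C ⊗[F] C).comp eτ) ?_ f
    refine MvPolynomial.ringHom_ext (fun r => ?_) fun j => ?_
    · simp [E, tr, eτ, hL₂]
    · simp [E, tr, eτ, hq, inc]
  have hEone : ∀ f, E (one f) = 1 ⊗ₜ eτ f := fun f => by
    refine RingHom.congr_fun (f := E.comp one)
      (g := ((Algebra.TensorProduct.includeRight : C →ₐ[F] C ⊗[F] C) : C →+* C ⊗[F] C).comp eτ) ?_ f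
    refine MvPolynomial.ringHom_ext (fun r => ?_) fun j => ?_
    · simp [E, one, eτ, inc, inR]
    · simp [E, one, eτ]
  by_contra hf0
  have hex : ∃ n, ∃ f : MvPolynomial ι R, f ≠ 0 ∧ eτ f = 0 ∧ f ∈ degreeLT ι R n := by
    obtain ⟨n, hn⟩ := exists_mem_degreeLT f
    exact ⟨n, f, hf0, hf, hn⟩
  have hmin : ∀ n < Nat.find hex, ∀ f : MvPolynomial ι R, eτ f = 0 → f ∈ degreeLT ι R n → f = 0 := by
    intro n hn f h1 h2
    by_contra h3
    exact Nat.find_min hex hn ⟨f, h3, h1, h2⟩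
  -- `degreeLT` bounds the degree strictly, so `d` is the least degree of a nontrivial relation.
  obtain ⟨d, hd⟩ : ∃ d, Nat.find hex = d + 1 := by
    refine Nat.exists_eq_succ_of_ne_zero fun h0 => ?_
    obtain ⟨f, h1, -, h2⟩ := Nat.find_spec hex
    rw [h0] at h2
    exact h1 (eq_zero_of_mem_degreeLT_zero h2)
  -- Minimality carries over to coefficients in `C ⊗ R`, because every contraction of `p` is a
  -- relation over `R` of degree below `d`.
  have hlow : ∀ p ∈ degreeLT ι (C ⊗[F] R) d, E p = 0 → p = 0 := fun p hp hEp => by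
    refine MvPolynomial.ext _ _ fun α => ?_
    rw [MvPolynomial.coeff_zero]
    refine eq_zero_of_contractLeft fun ξ => ?_
    rw [← coeff_contractCoeff, hmin d (by omega) (contractCoeff ξ p), MvPolynomial.coeff_zero]
    · exact (eval_contractCoeff i τ ξ p).trans (by rw [← map_zero (contractLeft ξ), ← hEp])
    · intro β hβ
      rw [coeff_contractCoeff, hp β hβ, map_zero]
  let top : MvPolynomial ι R →ₗ[R] ({α : ι →₀ ℕ | α.degree = d} → R) :=
    LinearMap.pi fun α => MvPolynomial.lcoeff R α.1
  have htop : ∀ f ∈ degreeLT ι R (d + 1), top f = 0 → f ∈ degreeLT ι R d := by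
    intro f hf h α hα
    rcases hα.eq_or_lt with h1 | h1
    · exact congrFun h ⟨α, h1.symm⟩
    · exact hf α h1
  let J : Submodule R (MvPolynomial ι R) :=
    (RingHom.ker eτ).restrictScalars R ⊓ degreeLT ι R (d + 1)
  have hfin : Finite {α : ι →₀ ℕ | α.degree = d} := (Finsupp.finite_of_degree_eq d).to_subtype
  have htrtop : ∀ f ∈ degreeLT ι R (d + 1), ∀ α : ι →₀ ℕ, d ≤ α.degree →
      (tr f).coeff α = L₂ (f.coeff α) := fun f hf α hα => by
    have h := translate_sub_map_mem (L₂ : R →+* C ⊗[F] R) q hf α hα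
    rw [MvPolynomial.coeff_sub, MvPolynomial.coeff_map, sub_eq_zero] at h
    exact h
  -- The leading forms of the relations of degree at most `d` make up an `R`-module that is stable
  -- under the coaction. Hence some relation of degree `d` has its leading coefficients in `F`.
  obtain ⟨c, hc0, f, hfJ, hfc⟩ : ∃ c : {α : ι →₀ ℕ | α.degree = d} → F, c ≠ 0 ∧
      ∃ f ∈ J, top f = fun α => algebraMap F R (c α) := by
    refine exists_const_mem_of_stable (ε := ε.comp i) (L := LR) (N := J.map top) ?_ ?_ ?_ ?_
    · intro r
      apply hi
      rw [AlgHom.commutes, AlgHom.comp_apply, ← hmul, ← hLR]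
      generalize LR r = z
      induction z with
      | zero => simp
      | add x y hx hy => simp only [map_add, hx, hy]
      | tmul x y => simp
    · intro r hr
      refine hi ((hinj _ fun ξ => ?_).trans (map_zero i).symm)
      have h := hr (ξ ∘ₗ i.toLinearMap)
      rw [AlgHom.comp_apply] at h
      rw [← hLR, ← h, contractLeft_map]
    · rintro _ ⟨f, ⟨hf1, hf2⟩, rfl⟩ ξ
      -- A retraction `g` of `i` extends a form on `R` to `C`, so that contractions in `C ⊗ R`
      -- induce those in `R ⊗ R`.
      obtain ⟨g, hg⟩ := LinearMap.exists_leftInverse_of_injective i.toLinearMap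
        (LinearMap.ker_eq_bot.mpr hi)
      refine ⟨contractCoeff (ξ ∘ₗ g) (tr f), ⟨?_, ?_⟩, ?_⟩
      · change eτ _ = 0
        rw [eval_contractCoeff]
        change contractLeft _ (E (tr f)) = 0
        rw [hEtr, show eτ f = 0 from hf1, map_zero, map_zero]
      · intro α hα
        rw [coeff_contractCoeff, htrtop f hf2 α (by omega), hf2 α hα, map_zero, map_zero]
      · ext ⟨α, hα⟩
        change (contractCoeff (ξ ∘ₗ g) (tr f)).coeff α = contractLeft ξ (LR (f.coeff α))
        rw [coeff_contractCoeff, htrtop f hf2 α hα.ge]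
        change contractLeft _ (Algebra.TensorProduct.map i (AlgHom.id F R) _) = _
        rw [contractLeft_map, LinearMap.comp_assoc, hg, LinearMap.comp_id, AlgHom.id_apply]
        rfl
    · obtain ⟨f, h1, h2, h3⟩ := Nat.find_spec hex
      rw [hd] at h3
      refine Submodule.ne_bot_iff _ |>.mpr ⟨top f, ⟨f, ⟨h2, h3⟩, rfl⟩, fun h => h1 ?_⟩
      exact hmin d (by omega) f h2 (htop f h3 h)
  -- Since the leading coefficients are scalars, both lifts have the same leading form. Their
  -- difference is a relation of degree below `d`, hence zero.
  have hinv : tr f = one f := by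
    refine sub_eq_zero.mp (hlow _ ?_ ?_)
    · intro α hα
      rw [MvPolynomial.coeff_sub, htrtop f hfJ.2 α hα, MvPolynomial.coeff_map, sub_eq_zero]
      rcases hα.eq_or_lt with h1 | h1
      · have h2 : f.coeff α = algebraMap F R (c ⟨α, h1.symm⟩) := congrFun hfc ⟨α, h1.symm⟩
        rw [h2, AlgHom.commutes]
        exact (AlgHom.commutes inR _).symm
      · rw [hfJ.2 α h1, map_zero, map_zero]
    · rw [map_sub, hEtr, hEone, show eτ f = 0 from hfJ.1]
      simp
  have hf0 : f ≠ 0 := by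
    rintro rfl
    refine hc0 (funext fun α => ?_)
    have := congrFun hfc α
    rw [map_zero, Pi.zero_apply] at this
    simpa using (congrArg (ε.comp i) this).symm
  have hfC : ∀ r, f ≠ MvPolynomial.C r := by
    rintro r rfl
    have h : eτ (MvPolynomial.C r) = 0 := hfJ.1
    have h2 : i r = 0 := by simpa [eτ] using h
    rw [(map_eq_zero_iff i hi).mp h2, map_zero] at hf0
    exact hf0 rfl
  have hconst : ∀ r, L₂ r = inR r → ∃ c : F, r = algebraMap F R c := fun r hr => by
    refine ⟨ε (i r), hi ?_⟩
    rw [AlgHom.commutes]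
    refine hLtriv _ ?_
    rw [← hL₂, hr]
    simp [inc, inR]
  -- Second minimality: a non-constant invariant polynomial of least degree has invariant
  -- derivatives of smaller degree. These are constant, so the polynomial is affine, with slopes in
  -- `F` by `hconst`.
  have hex' : ∃ n, ∃ g : MvPolynomial ι R, tr g = one g ∧ (∀ r, g ≠ MvPolynomial.C r) ∧
      g ∈ degreeLT ι R n := ⟨_, f, hinv, hfC, hfJ.2⟩
  obtain ⟨m, hm⟩ : ∃ m, Nat.find hex' = m + 1 := by
    refine Nat.exists_eq_succ_of_ne_zero fun h0 => ?_
    obtain ⟨g, -, h1, h2⟩ := Nat.find_spec hex'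
    rw [h0] at h2
    exact h1 0 (by rw [eq_zero_of_mem_degreeLT_zero h2, map_zero])
  obtain ⟨g, hg, hgC, hgd⟩ := Nat.find_spec hex'
  rw [hm] at hgd
  have hder : ∀ j, ∃ r, MvPolynomial.pderiv j g = MvPolynomial.C r := fun j => by
    by_contra! h
    refine Nat.find_min hex' (m := m) (by omega) ⟨_, ?_, h, pderiv_mem_degreeLT j hgd⟩
    rw [← pderiv_translate, show translate _ q g = one g from hg]
    exact MvPolynomial.pderiv_map
  choose r hr using hder
  have hrc : ∀ j, ∃ c : F, r j = algebraMap F R c := fun j => hconst _ <| by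
    have h1 := congrArg (MvPolynomial.pderiv j) hg
    rw [pderiv_translate, MvPolynomial.pderiv_map, hr] at h1
    simpa using h1
  choose c hc using hrc
  have hglin : ∃ h : R, g = MvPolynomial.C h + ∑ j, MvPolynomial.C (r j) * MvPolynomial.X j := by
    obtain ⟨h, hh⟩ := exists_eq_C_of_pderiv_eq_zero (F := F)
      (f := g - ∑ j, MvPolynomial.C (r j) * MvPolynomial.X j) fun j => by
        simp [hr, MvPolynomial.pderiv_X, Pi.single_apply]
    exact ⟨h, by rw [← hh]; ring⟩
  obtain ⟨h, hgl⟩ := hglin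
  -- The value of the affine polynomial is invariant, hence a scalar. So `∑ c j • τ j` lies in `R`,
  -- against `hτ` unless all slopes vanish.
  have h1 : L (eτ g) = 1 ⊗ₜ eτ g := by rw [← hEtr, ← hEone, hg]
  have h2 := hLtriv _ h1
  have h3 : eτ g = i h + ∑ j, c j • τ j := by
    rw [hgl]
    simp [eτ, hc, Algebra.smul_def]
  have h4 : c = 0 := by
    refine hτ c (algebraMap F R (ε (eτ g)) - h) ?_
    rw [finsum_eq_sum_of_fintype, map_sub, AlgHom.commutes, ← h2, h3]
    ring
  refine hgC h ?_
  rw [hgl]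
  simp [hc, h4]

end Main

end KolchinOstrowski


/-! ### The differential coordinate ring of `GL_n` and its universal points. -/

section DifferentialAlgebras

/-- The derivation of the quotient by a differential ideal. -/
noncomputable abbrev quotientDifferential {Q : Type*} [CommRing Q] [Differential Q] (I : Ideal Q)
    (hI : ∀ u ∈ I, u′ ∈ I) : Differential (Q ⧸ I) where
  deriv :=
    let d : Q ⧸ I →+ Q ⧸ I := QuotientAddGroup.map I.toAddSubgroup I.toAddSubgroup
      (Differential.deriv : Derivation ℤ Q Q).toLinearMap.toAddMonoidHom hI
    Derivation.mk' d.toIntLinearMap fun a b => by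
      obtain ⟨a, rfl⟩ := Ideal.Quotient.mk_surjective a
      obtain ⟨b, rfl⟩ := Ideal.Quotient.mk_surjective b
      change Ideal.Quotient.mk I ((a * b)′) =
        Ideal.Quotient.mk I a * Ideal.Quotient.mk I b′ +
          Ideal.Quotient.mk I b * Ideal.Quotient.mk I a′
      rw [Derivation.leibniz, smul_eq_mul, smul_eq_mul, map_add, map_mul, map_mul]

section Evaluation

/-- The entrywise derivative of a matrix. -/
def matrixDeriv {n : ℕ} {A : Type*} [CommRing A] [Differential A] (g : Matrix (Fin n) (Fin n) A) :
    Matrix (Fin n) (Fin n) A := g.map fun a => a′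

theorem matrixDeriv_mul {n : ℕ} {A : Type*} [CommRing A] [Differential A]
    (g h : Matrix (Fin n) (Fin n) A) :
    matrixDeriv (g * h) = matrixDeriv g * h + g * matrixDeriv h := by
  ext i j
  simp only [matrixDeriv, Matrix.map_apply, Matrix.mul_apply, Matrix.add_apply, map_sum,
    Derivation.leibniz, smul_eq_mul, ← Finset.sum_add_distrib]
  exact Finset.sum_congr rfl fun k _ => by ring

theorem matrixDeriv_one {n : ℕ} {A : Type*} [CommRing A] [Differential A] :
    matrixDeriv (1 : Matrix (Fin n) (Fin n) A) = 0 := by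
  ext i j
  by_cases h : i = j <;> simp [matrixDeriv, h]

/-- The logarithmic derivative `g⁻¹ g′`. -/
def matrixLogDeriv {n : ℕ} {A : Type*} [CommRing A] [Differential A] (g : (Matrix (Fin n) (Fin n) A)ˣ) :
    Matrix (Fin n) (Fin n) A := (g⁻¹).1 * matrixDeriv g.1

theorem matrixDeriv_eq {n : ℕ} {A : Type*} [CommRing A] [Differential A]
    (g : (Matrix (Fin n) (Fin n) A)ˣ) : matrixDeriv g.1 = g.1 * matrixLogDeriv g := by
  rw [matrixLogDeriv, ← mul_assoc, Units.mul_inv, one_mul]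

theorem matrixDeriv_inv_eq {n : ℕ} {A : Type*} [CommRing A] [Differential A]
    (g : (Matrix (Fin n) (Fin n) A)ˣ) : matrixDeriv (g⁻¹).1 = -(matrixLogDeriv g * (g⁻¹).1) := by
  have h := matrixDeriv_mul (g⁻¹).1 g.1
  rw [Units.inv_mul, matrixDeriv_one] at h
  have h2 : matrixDeriv (g⁻¹).1 * g.1 = -matrixLogDeriv g := (neg_eq_of_add_eq_zero_left h.symm).symm
  rw [← mul_one (matrixDeriv (g⁻¹).1), ← Units.mul_inv g, ← mul_assoc, h2, neg_mul]

/-- The variables of the coordinate ring of `GL_n`: the entries `x` of a matrix, the entries `y` of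
its inverse, and the derivatives `a k` of the entries of its logarithmic derivative. -/
inductive Var (n : ℕ) : Type
  | x (i j : Fin n) : Var n
  | y (i j : Fin n) : Var n
  | a (k : ℕ) (i j : Fin n) : Var n

variable {n : ℕ}

variable {F : Type*} [Field F]

open MvPolynomial in
/-- The values of the derivation of the coordinate ring at the variables: `x′ = x a`, `y′ = - a y`
and `a_k′ = a_(k + 1)`. -/
noncomputable def varDeriv (F : Type*) [Field F] : Var n → MvPolynomial (Var n) F
  | .x i j => ∑ k, X (.x i k) * X (.a 0 k j)
  | .y i j => - ∑ k, X (.a 0 i k) * X (.y k j)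
  | .a k i j => X (.a (k + 1) i j)

/-- The image of an invertible matrix under a homomorphism. -/
noncomputable def mapGL {A B : Type*} [CommRing A] [Algebra F A]
    [CommRing B] [Algebra F B] (φ : A →ₐ[F] B) :
    (Matrix (Fin n) (Fin n) A)ˣ →* (Matrix (Fin n) (Fin n) B)ˣ :=
  Units.map ((φ : A →+* B).mapMatrix : Matrix (Fin n) (Fin n) A →+* Matrix (Fin n) (Fin n) B)

theorem mapGL_apply {A B : Type*} [CommRing A] [Algebra F A]
    [CommRing B] [Algebra F B] (φ : A →ₐ[F] B)
    (g : (Matrix (Fin n) (Fin n) A)ˣ) : (mapGL φ g).1 = g.1.map φ := rfl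

theorem mapGL_inv_apply {A B : Type*} [CommRing A] [Algebra F A]
    [CommRing B] [Algebra F B] (φ : A →ₐ[F] B)
    (g : (Matrix (Fin n) (Fin n) A)ˣ) : ((mapGL φ g)⁻¹).1 = (g⁻¹).1.map φ := rfl

variable {A : Type*} [CommRing A] [Algebra F A] [Differential A]

/-- The values of the variables at an invertible matrix. -/
noncomputable def varEval (g : (Matrix (Fin n) (Fin n) A)ˣ) : Var n → A
  | .x i j => g.1 i j
  | .y i j => (g⁻¹).1 i j
  | .a k i j => (fun a : A => a′)^[k] (matrixLogDeriv g i j)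

variable (F) in
/-- Evaluation of an element of the coordinate ring at an invertible matrix. -/
noncomputable def evalAt (g : (Matrix (Fin n) (Fin n) A)ˣ) : MvPolynomial (Var n) F →ₐ[F] A :=
  MvPolynomial.aeval (varEval g)

@[simp] theorem evalAt_X (g : (Matrix (Fin n) (Fin n) A)ˣ) (i : Var n) :
    evalAt F g (MvPolynomial.X i) = varEval g i := by simp [evalAt]

theorem varEval_mapGL {B : Type*} [CommRing B] [Algebra F B] [Differential B]
    (φ : A →ₐ[F] B) (hφ : ∀ a, φ a′ = (φ a)′) (g : (Matrix (Fin n) (Fin n) A)ˣ) (i : Var n) :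
    varEval (mapGL φ g) i = φ (varEval g i) := by
  have hit : ∀ k a, φ ((fun a : A => a′)^[k] a) = (fun b : B => b′)^[k] (φ a) := fun k a =>
    (Function.Semiconj.iterate_right (f := φ) (fun a => hφ a) k) a
  cases i with
  | x i j => rfl
  | y i j => rfl
  | a k i j =>
    simp only [varEval, hit]
    congr 1
    simp only [matrixLogDeriv, mapGL_inv_apply, mapGL_apply, matrixDeriv, Matrix.mul_apply,
      Matrix.map_apply, map_sum, map_mul, hφ]

theorem evalAt_mapGL {B : Type*} [CommRing B] [Algebra F B] [Differential B]
    (φ : A →ₐ[F] B) (hφ : ∀ a, φ a′ = (φ a)′) (g : (Matrix (Fin n) (Fin n) A)ˣ)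
    (p : MvPolynomial (Var n) F) : evalAt F (mapGL φ g) p = φ (evalAt F g p) := by
  refine AlgHom.congr_fun (φ₁ := evalAt F (mapGL φ g)) (φ₂ := φ.comp (evalAt F g)) ?_ p
  refine MvPolynomial.algHom_ext fun i => ?_
  simp [varEval_mapGL φ hφ]

theorem varEval_deriv (g : (Matrix (Fin n) (Fin n) A)ˣ) (i : Var n) :
    evalAt F g (varDeriv F i) = (varEval g i)′ := by
  cases i with
  | x i j =>
    have h := congrFun (congrFun (matrixDeriv_eq g) i) j
    simp only [matrixDeriv, Matrix.map_apply] at h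
    simp [varDeriv, varEval, h, Matrix.mul_apply]
  | y i j =>
    have h := congrFun (congrFun (matrixDeriv_inv_eq g) i) j
    simp only [matrixDeriv, Matrix.map_apply] at h
    simp only [varDeriv, varEval, h, Matrix.mul_apply, Matrix.neg_apply, map_neg, map_sum, map_mul,
      evalAt_X, Function.iterate_zero_apply]
  | a k i j => simp [varDeriv, varEval, Function.iterate_succ_apply']

end Evaluation

variable {n : ℕ} {F : Type*} [Field F] [Differential F]

theorem deriv_smul {A : Type*} [CommRing A] [Algebra F A] [Differential A] [DifferentialAlgebra F A]
    (r : F) (a : A) : (r • a)′ = r′ • a + r • a′ := by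
  rw [Algebra.smul_def, Derivation.leibniz, deriv_algebraMap, smul_eq_mul, smul_eq_mul,
    Algebra.smul_def, Algebra.smul_def]
  ring

section Tensor

variable {A B : Type*} [CommRing A] [Algebra F A] [Differential A] [DifferentialAlgebra F A]
  [CommRing B] [Algebra F B] [Differential B] [DifferentialAlgebra F B]

variable (F A B) in
/-- The additive map `a ⊗ b ↦ a′ ⊗ b + a ⊗ b′`. -/
noncomputable def tensorDeriv : A ⊗[F] B →+ A ⊗[F] B :=
  TensorProduct.liftAddHom
    { toFun := fun a =>
        { toFun := fun b => a′ ⊗ₜ[F] b + a ⊗ₜ[F] b′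
          map_zero' := by simp
          map_add' := fun b b' => by
            simp only [TensorProduct.tmul_add, map_add]; abel }
      map_zero' := by ext; simp
      map_add' := fun a a' => by
        ext b
        simp only [TensorProduct.add_tmul, map_add, AddMonoidHom.coe_mk, ZeroHom.coe_mk,
          AddMonoidHom.add_apply]
        abel }
    fun r a b => by
      simp only [AddMonoidHom.coe_mk, ZeroHom.coe_mk, deriv_smul, TensorProduct.add_tmul,
        TensorProduct.tmul_add, TensorProduct.smul_tmul]
      abel

theorem tensorDeriv_tmul (a : A) (b : B) :
    tensorDeriv F A B (a ⊗ₜ b) = a′ ⊗ₜ b + a ⊗ₜ b′ := rfl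

noncomputable instance tensorDifferential : Differential (A ⊗[F] B) where
  deriv := Derivation.mk' (tensorDeriv F A B).toIntLinearMap fun x y => by
    simp only [AddMonoidHom.coe_toIntLinearMap, smul_eq_mul]
    induction x with
    | zero => simp
    | add x x' hx hx' => simp only [add_mul, mul_add, map_add, hx, hx']; ring
    | tmul a b =>
      induction y with
      | zero => simp
      | add y y' hy hy' => simp only [add_mul, mul_add, map_add, hy, hy']; ring
      | tmul a' b' =>
        simp only [Algebra.TensorProduct.tmul_mul_tmul, tensorDeriv_tmul, Derivation.leibniz,
          smul_eq_mul, TensorProduct.add_tmul, TensorProduct.tmul_add, mul_add, mul_comm]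
        abel

theorem tmul_deriv (a : A) (b : B) : (a ⊗ₜ[F] b)′ = a′ ⊗ₜ b + a ⊗ₜ b′ := rfl

instance : DifferentialAlgebra F (A ⊗[F] B) where
  deriv_algebraMap r := by
    rw [Algebra.TensorProduct.algebraMap_apply, tmul_deriv, deriv_algebraMap,
      Algebra.TensorProduct.algebraMap_apply]
    simp

theorem includeLeft_deriv (a : A) :
    (Algebra.TensorProduct.includeLeft : A →ₐ[F] A ⊗[F] B) a′ =
      ((Algebra.TensorProduct.includeLeft : A →ₐ[F] A ⊗[F] B) a)′ := by
  simp [tmul_deriv]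

theorem includeRight_deriv (b : B) :
    (Algebra.TensorProduct.includeRight : B →ₐ[F] A ⊗[F] B) b′ =
      ((Algebra.TensorProduct.includeRight : B →ₐ[F] A ⊗[F] B) b)′ := by
  simp [tmul_deriv]

theorem lift_deriv {D : Type*} [CommRing D] [Algebra F D] [Differential D] (f : A →ₐ[F] D)
    (g : B →ₐ[F] D) (hf : ∀ a, f a′ = (f a)′) (hg : ∀ b, g b′ = (g b)′) (z : A ⊗[F] B) :
    Algebra.TensorProduct.lift f g (fun _ _ => Commute.all _ _) z′ =
      (Algebra.TensorProduct.lift f g (fun _ _ => Commute.all _ _) z)′ := by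
  induction z with
  | zero => simp
  | add x y hx hy => simp only [map_add, hx, hy]
  | tmul a b => simp [tmul_deriv, hf, hg]; ring

end Tensor

/-- A derivation of a polynomial ring that extends the given one, with given values at the
variables. -/
theorem exists_derivation_mvPolynomial {s : Type*} (v : s → MvPolynomial s F) :
    ∃ D : Derivation ℤ (MvPolynomial s F) (MvPolynomial s F),
      (∀ a, D (MvPolynomial.C a) = MvPolynomial.C a′) ∧ ∀ i, D (MvPolynomial.X i) = v i := by
  -- A derivation `D` amounts to a ring homomorphism `p ↦ (p, D p)` into the trivial square-zero
  -- extension, and such a homomorphism can be prescribed on constants and variables.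
  let T := TrivSqZeroExt (MvPolynomial s F) (MvPolynomial s F)
  let c : F →+* T :=
    { toFun := fun a => (MvPolynomial.C a, MvPolynomial.C a′)
      map_one' := by ext <;> simp
      map_zero' := by ext <;> simp
      map_mul' := fun a b => by
        refine TrivSqZeroExt.ext ?_ ?_
        · change MvPolynomial.C (a * b) = MvPolynomial.C a * MvPolynomial.C b
          rw [map_mul]
        · change MvPolynomial.C (a * b)′ = MvPolynomial.C a * MvPolynomial.C b′ +
            MvPolynomial.C a′ * MvPolynomial.C b
          rw [Derivation.leibniz, ← map_mul, ← map_mul, ← map_add]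
          congr 1
          simp only [smul_eq_mul]
          ring
      map_add' := fun a b => by
        refine TrivSqZeroExt.ext ?_ ?_
        · exact map_add MvPolynomial.C a b
        · change MvPolynomial.C (a + b)′ = MvPolynomial.C a′ + MvPolynomial.C b′
          rw [map_add, map_add] }
  let Φ : MvPolynomial s F →+* T := MvPolynomial.eval₂Hom c fun i => (MvPolynomial.X i, v i)
  have hΦC : ∀ a, Φ (MvPolynomial.C a) = (MvPolynomial.C a, MvPolynomial.C a′) := fun a =>
    MvPolynomial.eval₂Hom_C _ _ _
  have hΦX : ∀ i, Φ (MvPolynomial.X i) = (MvPolynomial.X i, v i) := fun i =>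
    MvPolynomial.eval₂Hom_X' _ _ _
  have hfst : ∀ p, (Φ p).fst = p := fun p => by
    refine RingHom.congr_fun (f := ((TrivSqZeroExt.fstHom F (MvPolynomial s F)
      (MvPolynomial s F)) : T →+* MvPolynomial s F).comp Φ) (g := RingHom.id _) ?_ p
    refine MvPolynomial.ringHom_ext (fun a => ?_) fun i => ?_
    · change (Φ (MvPolynomial.C a)).fst = _
      rw [hΦC]; rfl
    · change (Φ (MvPolynomial.X i)).fst = _
      rw [hΦX]; rfl
  let d : MvPolynomial s F →+ MvPolynomial s F :=
    { toFun := fun p => (Φ p).snd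
      map_zero' := by rw [map_zero]; rfl
      map_add' := fun p q => by rw [map_add]; rfl }
  refine ⟨Derivation.mk' d.toIntLinearMap fun p q => ?_, fun a => ?_, fun i => ?_⟩
  · change (Φ (p * q)).snd = p * (Φ q).snd + q * (Φ p).snd
    rw [map_mul, TrivSqZeroExt.snd_mul, hfst, hfst]
    simp [mul_comm]
  · change (Φ _).snd = _
    rw [hΦC]; rfl
  · change (Φ _).snd = _
    rw [hΦX]; rfl

noncomputable instance coordDifferential : Differential (MvPolynomial (Var n) F) where
  deriv := (exists_derivation_mvPolynomial (varDeriv F)).choose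

theorem C_deriv (a : F) :
    (MvPolynomial.C a : MvPolynomial (Var n) F)′ = MvPolynomial.C a′ :=
  (exists_derivation_mvPolynomial (varDeriv F)).choose_spec.1 a

theorem X_deriv (i : Var n) : (MvPolynomial.X i : MvPolynomial (Var n) F)′ = varDeriv F i :=
  (exists_derivation_mvPolynomial (varDeriv F)).choose_spec.2 i

variable {A : Type*} [CommRing A] [Algebra F A] [Differential A]

theorem evalAt_deriv [DifferentialAlgebra F A] (g : (Matrix (Fin n) (Fin n) A)ˣ)
    (p : MvPolynomial (Var n) F) : evalAt F g p′ = (evalAt F g p)′ := by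
  induction p using MvPolynomial.induction_on with
  | C a =>
    rw [C_deriv, ← MvPolynomial.algebraMap_eq, AlgHom.commutes, AlgHom.commutes, deriv_algebraMap]
  | add p q hp hq => simp only [map_add, hp, hq]
  | mul_X p i hp =>
    simp only [Derivation.leibniz, smul_eq_mul, map_add, map_mul, hp, X_deriv, varEval_deriv,
      evalAt_X]

/-- The ideals of the coordinate ring that contain the relations `x y = y x = 1` and are closed under the
derivation. -/
structure IsCoordIdeal (I : Ideal (MvPolynomial (Var n) F)) : Prop where
  deriv_mem : ∀ u ∈ I, u′ ∈ I
  xy_mem : ∀ i j, (∑ k, MvPolynomial.X (.x i k) * MvPolynomial.X (.y k j)) -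
    (1 : Matrix (Fin n) (Fin n) (MvPolynomial (Var n) F)) i j ∈ I
  yx_mem : ∀ i j, (∑ k, MvPolynomial.X (.y i k) * MvPolynomial.X (.x k j)) -
    (1 : Matrix (Fin n) (Fin n) (MvPolynomial (Var n) F)) i j ∈ I

/-- The derivation of the quotient of the coordinate ring. -/
noncomputable abbrev IsCoordIdeal.differential {I : Ideal (MvPolynomial (Var n) F)}
    (hI : IsCoordIdeal I) : Differential (MvPolynomial (Var n) F ⧸ I) :=
  quotientDifferential I hI.deriv_mem

theorem IsCoordIdeal.mk_deriv {I : Ideal (MvPolynomial (Var n) F)}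
    (hI : IsCoordIdeal I) (p : MvPolynomial (Var n) F) :
    letI := hI.differential
    (Ideal.Quotient.mk I p)′ = Ideal.Quotient.mk I p′ := rfl

theorem IsCoordIdeal.differentialAlgebra {I : Ideal (MvPolynomial (Var n) F)}
    (hI : IsCoordIdeal I) :
    letI := hI.differential
    DifferentialAlgebra F (MvPolynomial (Var n) F ⧸ I) :=
  letI := hI.differential
  ⟨fun a => by
    change (Ideal.Quotient.mk I (MvPolynomial.C a))′ = Ideal.Quotient.mk I (MvPolynomial.C a′)
    rw [hI.mk_deriv, C_deriv]⟩

/-- The universal point. -/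
noncomputable def IsCoordIdeal.point {I : Ideal (MvPolynomial (Var n) F)} (hI : IsCoordIdeal I) :
    (Matrix (Fin n) (Fin n) (MvPolynomial (Var n) F ⧸ I))ˣ where
  val := Matrix.of fun i j => Ideal.Quotient.mk I (MvPolynomial.X (.x i j))
  inv := Matrix.of fun i j => Ideal.Quotient.mk I (MvPolynomial.X (.y i j))
  val_inv := by
    ext i j
    have h := Ideal.Quotient.eq.mpr (hI.xy_mem i j)
    rw [map_sum] at h
    simp only [Matrix.mul_apply, Matrix.of_apply, ← map_mul, h, Matrix.one_apply]
    split_ifs <;> simp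
  inv_val := by
    ext i j
    have h := Ideal.Quotient.eq.mpr (hI.yx_mem i j)
    rw [map_sum] at h
    simp only [Matrix.mul_apply, Matrix.of_apply, ← map_mul, h, Matrix.one_apply]
    split_ifs <;> simp

/-- Makes vanishing at the universal point the same as membership in `I`. For the variables `a k`,
the rule `x′ = x a` in the quotient forces `a` to be the logarithmic derivative of `x`. -/
theorem IsCoordIdeal.evalAt_point {I : Ideal (MvPolynomial (Var n) F)} (hI : IsCoordIdeal I)
    (p : MvPolynomial (Var n) F) :
    letI := hI.differential
    evalAt F hI.point p = Ideal.Quotient.mk I p := by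
  let := hI.differential
  refine AlgHom.congr_fun (φ₁ := evalAt F hI.point) (φ₂ := Ideal.Quotient.mkₐ F I) ?_ p
  refine MvPolynomial.algHom_ext fun i => ?_
  rw [evalAt_X, Ideal.Quotient.mkₐ_eq_mk]
  cases i with
  | x i j => rfl
  | y i j => rfl
  | a k i j =>
    have h0 : matrixLogDeriv hI.point i j = Ideal.Quotient.mk I (MvPolynomial.X (.a 0 i j)) := by
      let a : Matrix (Fin n) (Fin n) (MvPolynomial (Var n) F ⧸ I) :=
        Matrix.of fun i j => Ideal.Quotient.mk I (MvPolynomial.X (.a 0 i j))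
      have h1 : matrixDeriv hI.point.1 = hI.point.1 * a := by
        ext i j
        change (Ideal.Quotient.mk I (MvPolynomial.X (.x i j)))′ = _
        rw [hI.mk_deriv, X_deriv, varDeriv, map_sum]
        simp only [map_mul]
        rfl
      rw [matrixLogDeriv, h1, ← mul_assoc, Units.inv_mul, one_mul]
      rfl
    rw [varEval, h0]
    induction k with
    | zero => rfl
    | succ k ih => rw [Function.iterate_succ_apply', ih, hI.mk_deriv, X_deriv, varDeriv]

end DifferentialAlgebras


/-! ### The filtration by the order of derivatives. -/

section LevelFiltration

variable {n : ℕ}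

/-- The level of a variable: the order of the derivatives of `x` needed to express it. -/
def Var.level : Var n → ℕ
  | .x _ _ => 0
  | .y _ _ => 0
  | .a k _ _ => k + 1

theorem finite_setOf_level_le (m : ℕ) : {v : Var n | v.level ≤ m}.Finite := by
  refine ((Set.finite_range fun p : Fin n × Fin n => Var.x p.1 p.2).union
    ((Set.finite_range fun p : Fin n × Fin n => Var.y p.1 p.2).union
      (Set.finite_range fun p : Fin (m + 1) × Fin n × Fin n => Var.a p.1 p.2.1 p.2.2))).subset ?_
  rintro (⟨i, j⟩ | ⟨i, j⟩ | ⟨k, i, j⟩) hv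
  · exact Or.inl ⟨(i, j), rfl⟩
  · exact Or.inr (Or.inl ⟨(i, j), rfl⟩)
  · have : k + 1 ≤ m := hv
    exact Or.inr (Or.inr ⟨(⟨k, by omega⟩, i, j), rfl⟩)

variable (n) in
/-- The polynomials in the variables of level at most `m`. -/
noncomputable def levelPoly (F : Type*) [Field F] (m : ℕ) :
    Subalgebra F (MvPolynomial (Var n) F) :=
  MvPolynomial.supported F {v : Var n | v.level ≤ m}

variable {F : Type*} [Field F]

theorem levelPoly_mono {m m' : ℕ} (h : m ≤ m') : levelPoly n F m ≤ levelPoly n F m' :=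
  MvPolynomial.supported_mono fun _ hv => le_trans hv h

theorem X_mem_levelPoly {m : ℕ} {v : Var n} (h : v.level ≤ m) :
    MvPolynomial.X v ∈ levelPoly n F m :=
  Algebra.subset_adjoin ⟨v, h, rfl⟩

theorem exists_mem_levelPoly (p : MvPolynomial (Var n) F) : ∃ m, p ∈ levelPoly n F m := by
  induction p using MvPolynomial.induction_on with
  | C a => exact ⟨0, Subalgebra.algebraMap_mem _ a⟩
  | add p q hp hq =>
    obtain ⟨m, hm⟩ := hp
    obtain ⟨m', hm'⟩ := hq
    exact ⟨max m m', add_mem (levelPoly_mono (le_max_left _ _) hm)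
      (levelPoly_mono (le_max_right _ _) hm')⟩
  | mul_X p v hp =>
    obtain ⟨m, hm⟩ := hp
    exact ⟨max m v.level, mul_mem (levelPoly_mono (le_max_left _ _) hm)
      (X_mem_levelPoly (le_max_right _ _))⟩

instance (m : ℕ) : IsNoetherianRing (levelPoly n F m) := by
  have := (finite_setOf_level_le (n := n) m).to_subtype
  exact isNoetherianRing_of_ringEquiv _
    (MvPolynomial.supportedEquivMvPolynomial {v : Var n | v.level ≤ m} (R := F)).symm.toRingEquiv

theorem deriv_mem_levelPoly [Differential F] {m : ℕ} {p : MvPolynomial (Var n) F}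
    (hp : p ∈ levelPoly n F m) : p′ ∈ levelPoly n F (m + 1) := by
  have hle := levelPoly_mono (n := n) (F := F) (Nat.le_succ m)
  induction hp using Algebra.adjoin_induction with
  | mem x hx =>
    obtain ⟨v, hv, rfl⟩ := hx
    rw [X_deriv]
    cases v with
    | x i j =>
      exact sum_mem fun k _ => mul_mem (X_mem_levelPoly (Nat.zero_le _))
        (X_mem_levelPoly (Nat.succ_le_succ (Nat.zero_le _)))
    | y i j =>
      exact neg_mem (sum_mem fun k _ => mul_mem (X_mem_levelPoly (Nat.succ_le_succ (Nat.zero_le _)))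
        (X_mem_levelPoly (Nat.zero_le _)))
    | a k i j => exact X_mem_levelPoly (Nat.succ_le_succ hv)
  | algebraMap r =>
    rw [MvPolynomial.algebraMap_eq, C_deriv]
    exact Subalgebra.algebraMap_mem _ _
  | add x y _ _ hx hy => rw [map_add]; exact add_mem hx hy
  | mul x y hx hy hx' hy' =>
    rw [Derivation.leibniz]
    exact add_mem (mul_mem (hle hx) hy') (mul_mem (hle hy) hx')

variable {A : Type*} [CommRing A] [Algebra F A] [Differential A]

variable (F) in
/-- The values at an invertible matrix of the polynomials in the variables of level at most `m`. -/
noncomputable def levelAlg (g : (Matrix (Fin n) (Fin n) A)ˣ) (m : ℕ) : Subalgebra F A :=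
  (levelPoly n F m).map (evalAt F g)

theorem levelAlg_mono (g : (Matrix (Fin n) (Fin n) A)ˣ) {m m' : ℕ} (h : m ≤ m') :
    levelAlg F g m ≤ levelAlg F g m' :=
  Subalgebra.map_mono (levelPoly_mono h)

theorem varEval_mem_levelAlg (g : (Matrix (Fin n) (Fin n) A)ˣ) {m : ℕ} {v : Var n}
    (h : v.level ≤ m) : varEval g v ∈ levelAlg F g m :=
  ⟨_, X_mem_levelPoly h, evalAt_X g v⟩

theorem deriv_mem_levelAlg [Differential F] [DifferentialAlgebra F A]
    (g : (Matrix (Fin n) (Fin n) A)ˣ) {m : ℕ} {z : A} (h : z ∈ levelAlg F g m) :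
    z′ ∈ levelAlg F g (m + 1) := by
  obtain ⟨p, hp, rfl⟩ := h
  exact ⟨_, deriv_mem_levelPoly hp, evalAt_deriv g p⟩

end LevelFiltration

/-! ### The Hopf structure and algebraic independence of logarithmic derivatives. -/

section GroupPoint

variable {n : ℕ} {F : Type*} [Field F]

theorem mapGL_comp {A B D : Type*} [CommRing A] [Algebra F A] [CommRing B] [Algebra F B]
    [CommRing D] [Algebra F D] (φ : A →ₐ[F] B) (ψ : B →ₐ[F] D) (g : (Matrix (Fin n) (Fin n) A)ˣ) :
    mapGL (ψ.comp φ) g = mapGL ψ (mapGL φ g) := rfl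

theorem mapGL_id {A : Type*} [CommRing A] [Algebra F A] (g : (Matrix (Fin n) (Fin n) A)ˣ) :
    mapGL (AlgHom.id F A) g = g := rfl

theorem lift_comp_includeRight' {A B D : Type*} [CommRing A] [Algebra F A] [CommRing B]
    [Algebra F B] [CommRing D] [Algebra F D] (f : A →ₐ[F] D) (g : B →ₐ[F] D) :
    (Algebra.TensorProduct.lift f g (fun _ _ => Commute.all _ _)).comp
      Algebra.TensorProduct.includeRight = g := by
  ext; simp

/-- A linear combination of the entries of the `k`-th derivative of the logarithmic derivative. -/
noncomputable def linComb {A : Type*} [CommRing A] [Algebra F A] [Differential A]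
    (g : (Matrix (Fin n) (Fin n) A)ˣ) (k : ℕ) :
    (Fin n × Fin n → F) →ₗ[F] A :=
  Fintype.linearCombination F fun p => varEval g (.a k p.1 p.2)

theorem linComb_apply {A : Type*} [CommRing A] [Algebra F A] [Differential A]
    (g : (Matrix (Fin n) (Fin n) A)ˣ) (k : ℕ) (c : Fin n × Fin n → F) :
    linComb g k c = ∑ p : Fin n × Fin n, c p • varEval g (.a k p.1 p.2) := rfl

/-- The derivative of `h` enters only through the bare term `matrixLogDeriv h`; the correction
contains `h` and `h⁻¹` undifferentiated. This is why logarithmic derivatives serve as coordinates.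
-/
theorem matrixLogDeriv_inv_mul {A : Type*} [CommRing A] [Differential A]
    (g h : (Matrix (Fin n) (Fin n) A)ˣ) : matrixLogDeriv (g⁻¹ * h) =
      matrixLogDeriv h - (h⁻¹).1 * (g.1 * matrixLogDeriv g * (g⁻¹).1) * h.1 := by
  have e : g.1 * ((g⁻¹).1 * matrixDeriv h.1) = matrixDeriv h.1 := by
    rw [← mul_assoc, Units.mul_inv, one_mul]
  rw [matrixLogDeriv, Units.val_mul, matrixDeriv_mul, matrixDeriv_inv_eq, mul_inv_rev, inv_inv,
    Units.val_mul, mul_add, mul_assoc _ g.1 ((g⁻¹).1 * _), e, matrixLogDeriv.eq_1 h]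
  noncomm_ring

variable {C : Type*} [CommRing C] [Algebra F C] [Differential C]

/-- Reduces the Hopf algebra identities below to identities between invertible matrices. -/
theorem hom_ext_of_surjective {g : (Matrix (Fin n) (Fin n) C)ˣ}
    (hg : Function.Surjective (evalAt F g)) {B : Type*} [CommRing B] [Algebra F B] [Differential B]
    {φ ψ : C →ₐ[F] B} (hφ : ∀ a, φ a′ = (φ a)′) (hψ : ∀ a, ψ a′ = (ψ a)′)
    (h : mapGL φ g = mapGL ψ g) (x : C) : φ x = ψ x := by
  obtain ⟨p, rfl⟩ := hg x
  rw [← evalAt_mapGL φ hφ, ← evalAt_mapGL ψ hψ, h]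

/-- The image of `levelAlg F g a ⊗ levelAlg F g b` in `C ⊗ C`. -/
noncomputable def levelTensor (g : (Matrix (Fin n) (Fin n) C)ˣ) (a b : ℕ) :
    Subalgebra F (C ⊗[F] C) :=
  (Algebra.TensorProduct.map (levelAlg F g a).val (levelAlg F g b).val).range

theorem tmul_mem_levelTensor {g : (Matrix (Fin n) (Fin n) C)ˣ} {a b : ℕ} {x y : C}
    (hx : x ∈ levelAlg F g a) (hy : y ∈ levelAlg F g b) : x ⊗ₜ[F] y ∈ levelTensor g a b :=
  ⟨⟨x, hx⟩ ⊗ₜ ⟨y, hy⟩, by simp⟩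

theorem levelTensor_induction {g : (Matrix (Fin n) (Fin n) C)ˣ} {a b : ℕ} {p : C ⊗[F] C → Prop}
    (h0 : p 0) (hadd : ∀ x y, p x → p y → p (x + y))
    (htmul : ∀ x ∈ levelAlg F g a, ∀ y ∈ levelAlg F g b, p (x ⊗ₜ y)) {z : C ⊗[F] C}
    (hz : z ∈ levelTensor g a b) : p z := by
  obtain ⟨w, rfl⟩ := hz
  induction w with
  | zero => simpa using h0
  | add x y hx hy => simpa using hadd _ _ hx hy
  | tmul x y => simpa using htmul _ x.2 _ y.2

theorem levelTensor_mono {g : (Matrix (Fin n) (Fin n) C)ˣ} {a b a' b' : ℕ} (ha : a ≤ a')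
    (hb : b ≤ b') : levelTensor (F := F) g a b ≤ levelTensor g a' b' := fun _ hz =>
  levelTensor_induction (p := fun z => z ∈ levelTensor g a' b') (zero_mem _)
    (fun _ _ => add_mem) (fun _ hx _ hy => tmul_mem_levelTensor (levelAlg_mono g ha hx)
      (levelAlg_mono g hb hy)) hz

variable [Differential F] [DifferentialAlgebra F C]

variable (F) in
/-- A point that generates its algebra, which is the coordinate ring of a differential algebraic
group: the maps dual to `(g, h) ↦ g⁻¹ h`, to the neutral element and to `g ↦ g⁻¹` exist. -/
structure IsGroupPoint (g : (Matrix (Fin n) (Fin n) C)ˣ) : Prop where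
  surjective : Function.Surjective (evalAt F g)
  exists_comul : ∃ L : C →ₐ[F] C ⊗[F] C, (∀ a, L a′ = (L a)′) ∧
    mapGL L g = (mapGL (Algebra.TensorProduct.includeLeft : C →ₐ[F] C ⊗[F] C) g)⁻¹ *
      mapGL (Algebra.TensorProduct.includeRight : C →ₐ[F] C ⊗[F] C) g
  exists_counit : ∃ ε : C →ₐ[F] F, (∀ a, ε a′ = (ε a)′) ∧ mapGL ε g = 1
  exists_antipode : ∃ S : C →ₐ[F] C, (∀ a, S a′ = (S a)′) ∧ mapGL S g = g⁻¹

theorem deriv_mem_levelTensor {g : (Matrix (Fin n) (Fin n) C)ˣ} {a b : ℕ} {z : C ⊗[F] C}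
    (hz : z ∈ levelTensor g a b) : z′ ∈ levelTensor (F := F) g (a + 1) (b + 1) := by
  refine levelTensor_induction (p := fun z => z′ ∈ levelTensor g (a + 1) (b + 1)) ?_ ?_ ?_ hz
  · simp
  · intro x y hx hy
    rw [map_add]
    exact add_mem hx hy
  · intro x hx y hy
    rw [tmul_deriv]
    exact add_mem
      (tmul_mem_levelTensor (deriv_mem_levelAlg g hx) (levelAlg_mono g (Nat.le_succ b) hy))
      (tmul_mem_levelTensor (levelAlg_mono g (Nat.le_succ a) hx) (deriv_mem_levelAlg g hy))

theorem iterate_deriv_mem_levelTensor {g : (Matrix (Fin n) (Fin n) C)ˣ} {a b : ℕ} {z : C ⊗[F] C}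
    (hz : z ∈ levelTensor g a b) (k : ℕ) :
    (fun z : C ⊗[F] C => z′)^[k] z ∈ levelTensor (F := F) g (a + k) (b + k) := by
  induction k with
  | zero => exact hz
  | succ k ih => rw [Function.iterate_succ_apply']; exact deriv_mem_levelTensor ih

/-- The correction term of `matrixLogDeriv_inv_mul` has level one in the first factor and level zero
in the second, and `k` derivations raise both by `k`. The second factor thus stays below the level
`k + 1` of the variable itself. -/
theorem comul_a {g : (Matrix (Fin n) (Fin n) C)ˣ} {L : C →ₐ[F] C ⊗[F] C}
    (hL : ∀ a, L a′ = (L a)′)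
    (hLg : mapGL L g = (mapGL (Algebra.TensorProduct.includeLeft : C →ₐ[F] C ⊗[F] C) g)⁻¹ *
      mapGL (Algebra.TensorProduct.includeRight : C →ₐ[F] C ⊗[F] C) g) (k : ℕ) (i j : Fin n) :
    ∃ w ∈ levelTensor (F := F) g (k + 1) k,
      L (varEval g (.a k i j)) = 1 ⊗ₜ varEval g (.a k i j) + w := by
  set g₁ := mapGL (Algebra.TensorProduct.includeLeft : C →ₐ[F] C ⊗[F] C) g with hg₁
  set g₂ := mapGL (Algebra.TensorProduct.includeRight : C →ₐ[F] C ⊗[F] C) g with hg₂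
  let W := (g₂⁻¹).1 * (g₁.1 * matrixLogDeriv g₁ * (g₁⁻¹).1) * g₂.1
  have h₁ : ∀ v, varEval g₁ v = varEval g v ⊗ₜ 1 := fun v =>
    varEval_mapGL _ (includeLeft_deriv (F := F)) g v
  have h₂ : ∀ v, varEval g₂ v = 1 ⊗ₜ varEval g v := fun v =>
    varEval_mapGL _ (includeRight_deriv (F := F)) g v
  have hl : ∀ v : Var n, v.level ≤ 1 → varEval g₁ v ∈ levelTensor (F := F) g 1 0 := fun v hv => by
    rw [h₁]
    exact tmul_mem_levelTensor (varEval_mem_levelAlg g hv) (one_mem _)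
  have hr : ∀ v : Var n, v.level ≤ 0 → varEval g₂ v ∈ levelTensor (F := F) g 1 0 := fun v hv => by
    rw [h₂]
    exact tmul_mem_levelTensor (one_mem _) (varEval_mem_levelAlg g hv)
  have hW : W i j ∈ levelTensor (F := F) g 1 0 := by
    simp only [W, Matrix.mul_apply]
    refine sum_mem fun l _ => mul_mem (sum_mem fun l' _ => mul_mem (hr (.y _ _) le_rfl)
      (sum_mem fun l'' _ => mul_mem (sum_mem fun _ _ => mul_mem (hl (.x _ _) (Nat.zero_le _))
        (hl (.a 0 _ _) le_rfl)) (hl (.y _ _) (Nat.zero_le _)))) (hr (.x _ _) le_rfl)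
  have hit : ∀ k (a b : C ⊗[F] C), (fun z : C ⊗[F] C => z′)^[k] (a - b) =
      (fun z : C ⊗[F] C => z′)^[k] a - (fun z : C ⊗[F] C => z′)^[k] b := fun k a b => by
    induction k with
    | zero => rfl
    | succ k ih => rw [Function.iterate_succ_apply', Function.iterate_succ_apply',
        Function.iterate_succ_apply', ih, map_sub]
  refine ⟨-(fun z : C ⊗[F] C => z′)^[k] (W i j), neg_mem ?_, ?_⟩
  · have := iterate_deriv_mem_levelTensor hW k
    rwa [add_comm, zero_add] at this
  · rw [← varEval_mapGL L hL, hLg, ← h₂, varEval, matrixLogDeriv_inv_mul, Matrix.sub_apply, hit,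
      ← sub_eq_add_neg]
    rfl

/-- Makes each `levelAlg F g m` stable under `L`, so that it can be the smaller Hopf algebra in
`eq_zero_of_eval_eq_zero`. -/
theorem comul_mem_levelTensor {g : (Matrix (Fin n) (Fin n) C)ˣ} {L : C →ₐ[F] C ⊗[F] C}
    (hL : ∀ a, L a′ = (L a)′)
    (hLg : mapGL L g = (mapGL (Algebra.TensorProduct.includeLeft : C →ₐ[F] C ⊗[F] C) g)⁻¹ *
      mapGL (Algebra.TensorProduct.includeRight : C →ₐ[F] C ⊗[F] C) g) {m : ℕ} {z : C}
    (hz : z ∈ levelAlg F g m) : L z ∈ levelTensor (F := F) g m m := by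
  obtain ⟨p, hp, rfl⟩ := hz
  have hx : ∀ i j, varEval g (.x i j) ∈ levelAlg F g m := fun i j =>
    varEval_mem_levelAlg g (Nat.zero_le _)
  have hy : ∀ i j, varEval g (.y i j) ∈ levelAlg F g m := fun i j =>
    varEval_mem_levelAlg g (Nat.zero_le _)
  have key : (levelPoly n F m) ≤ (levelTensor (F := F) g m m).comap (L.comp (evalAt F g)) := by
    refine Algebra.adjoin_le ?_
    rintro _ ⟨v, hv, rfl⟩
    change L (evalAt F g (MvPolynomial.X v)) ∈ levelTensor (F := F) g m m
    rw [evalAt_X]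
    cases v with
    | x i j =>
      rw [← varEval_mapGL L hL, hLg, varEval, Units.val_mul, Matrix.mul_apply]
      refine Subalgebra.sum_mem _ fun k _ => Subalgebra.mul_mem _ ?_ ?_
      · exact (tmul_mem_levelTensor (hy _ _) (one_mem _) :
          varEval g (.y i k) ⊗ₜ[F] 1 ∈ levelTensor (F := F) g m m)
      · exact (tmul_mem_levelTensor (one_mem _) (hx _ _) :
          1 ⊗ₜ[F] varEval g (.x k j) ∈ levelTensor (F := F) g m m)
    | y i j =>
      rw [← varEval_mapGL L hL, hLg, varEval, mul_inv_rev, inv_inv, Units.val_mul,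
        Matrix.mul_apply]
      refine Subalgebra.sum_mem _ fun k _ => Subalgebra.mul_mem _ ?_ ?_
      · exact (tmul_mem_levelTensor (one_mem _) (hy _ _) :
          1 ⊗ₜ[F] varEval g (.y i k) ∈ levelTensor (F := F) g m m)
      · exact (tmul_mem_levelTensor (hx _ _) (one_mem _) :
          varEval g (.x k j) ⊗ₜ[F] 1 ∈ levelTensor (F := F) g m m)
    | a k i j =>
      obtain ⟨w, hw, h⟩ := comul_a hL hLg k i j
      have hk : k + 1 ≤ m := hv
      rw [h]
      exact add_mem (tmul_mem_levelTensor (one_mem _) (varEval_mem_levelAlg g hv))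
        (levelTensor_mono hk (by omega) hw)
  exact key hp

/-- The Kolchin-Ostrowski theorem over `levelAlg F g k`: by `comul_a`, linear forms in the `a k` are
primitive modulo `C ⊗ levelAlg F g k`. -/
theorem algebraicIndependent_linComb [CharZero F] {g : (Matrix (Fin n) (Fin n) C)ˣ}
    (hg : IsGroupPoint F g) {k r : ℕ} {c : Fin r → Fin n × Fin n → F}
    (hc : ∀ d : Fin r → F, linComb g k (∑ j, d j • c j) ∈ levelAlg F g k → d = 0)
    {f : MvPolynomial (Fin r) (levelAlg F g k)}
    (hf : MvPolynomial.eval₂Hom ((levelAlg F g k).val : levelAlg F g k →+* C)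
      (fun j => linComb g k (c j)) f = 0) : f = 0 := by
  obtain ⟨L, hL, hLg⟩ := hg.exists_comul
  obtain ⟨ε, hε, hεg⟩ := hg.exists_counit
  obtain ⟨S, hS, hSg⟩ := hg.exists_antipode
  let i := (levelAlg F g k).val
  have hi : Function.Injective i := Subtype.val_injective
  -- Over a field the tensor square of an inclusion is injective, so `L` restricts to a map `LR`
  -- into the tensor square of the subalgebra.
  have hmap : Function.Injective (Algebra.TensorProduct.map i i) := by
    have h1 := Module.Flat.rTensor_preserves_injective_linearMap (M := levelAlg F g k)
      i.toLinearMap hi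
    have h2 := Module.Flat.lTensor_preserves_injective_linearMap (M := C) i.toLinearMap hi
    have h3 : ⇑(Algebra.TensorProduct.map i i) =
        (i.toLinearMap.lTensor C) ∘ (i.toLinearMap.rTensor (levelAlg F g k)) := by
      ext z
      rw [Function.comp_apply, ← LinearMap.comp_apply, LinearMap.lTensor_comp_rTensor]
      rfl
    rw [h3]
    exact h2.comp h1
  let LR : levelAlg F g k →ₐ[F] levelAlg F g k ⊗[F] levelAlg F g k :=
    (AlgEquiv.ofInjective _ hmap).symm.toAlgHom.comp
      ((L.comp i).codRestrict (levelTensor (F := F) g k k) fun z =>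
        comul_mem_levelTensor hL hLg z.2)
  have hLR : ∀ r, Algebra.TensorProduct.map i i (LR r) = L (i r) := fun r => by
    have := (AlgEquiv.ofInjective _ hmap).apply_symm_apply
      (((L.comp i).codRestrict (levelTensor (F := F) g k k) fun z =>
        comul_mem_levelTensor hL hLg z.2) r)
    exact congrArg Subtype.val this
  have hmul : ∀ x, Algebra.TensorProduct.lift (AlgHom.id F C) (AlgHom.id F C)
      (fun _ _ => Commute.all _ _) (L x) = algebraMap F C (ε x) := by
    refine hom_ext_of_surjective hg.surjective
      (φ := (Algebra.TensorProduct.lift (AlgHom.id F C) (AlgHom.id F C)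
        (fun _ _ => Commute.all _ _)).comp L) (ψ := (Algebra.ofId F C).comp ε) ?_ ?_ ?_
    · intro a
      rw [AlgHom.comp_apply, hL, lift_deriv _ _ (fun _ => rfl) fun _ => rfl]
      rfl
    · intro a
      rw [AlgHom.comp_apply, hε]
      exact (deriv_algebraMap _).symm
    · rw [mapGL_comp, mapGL_comp, hLg, hεg, map_mul, map_inv, map_one, ← mapGL_comp, ← mapGL_comp,
        Algebra.TensorProduct.lift_comp_includeLeft, lift_comp_includeRight', inv_mul_cancel]
  have hS2 : ∀ x, S (S x) = x := by
    refine hom_ext_of_surjective hg.surjective (φ := S.comp S) (ψ := AlgHom.id F C) ?_ ?_ ?_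
    · intro a
      simp only [AlgHom.comp_apply, hS]
    · exact fun _ => rfl
    · rw [mapGL_comp, hSg, map_inv, hSg, inv_inv, mapGL_id]
  -- `E ∘ L` is dual to `g ↦ g⁻¹ · 1`. Hence the counits of the contractions of `L x` are the values
  -- of the linear forms at `S x`, and `S` is injective as an involution; this gives `hinj`.
  let E : C ⊗[F] C →ₐ[F] C := Algebra.TensorProduct.lift (AlgHom.id F C)
    ((Algebra.ofId F C).comp ε) (fun _ _ => Commute.all _ _)
  have hεC : ∀ a, (Algebra.ofId F C).comp ε a′ = ((Algebra.ofId F C).comp ε a)′ := fun a => by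
    rw [AlgHom.comp_apply, hε]
    exact (deriv_algebraMap _).symm
  have hES : ∀ x, E (L x) = S x := by
    refine hom_ext_of_surjective hg.surjective (φ := E.comp L) (ψ := S) ?_ hS ?_
    · intro a
      rw [AlgHom.comp_apply, hL, lift_deriv _ _ (fun _ => rfl) hεC]
      rfl
    · rw [mapGL_comp, hLg, hSg, map_mul, map_inv, ← mapGL_comp, ← mapGL_comp,
        Algebra.TensorProduct.lift_comp_includeLeft, lift_comp_includeRight',
        mapGL_comp, hεg, map_one, mul_one, mapGL_id]
  have hξE : ∀ (ξ : C →ₗ[F] F) z, ξ (E z) = ε (contractLeft ξ z) := fun ξ z => by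
    induction z with
    | zero => simp
    | add x y hx hy => simp only [map_add, hx, hy]
    | tmul a b =>
      simp only [E, Algebra.TensorProduct.lift_tmul, AlgHom.id_apply, AlgHom.comp_apply,
        Algebra.ofId_apply, contractLeft_tmul, map_smul, smul_eq_mul]
      rw [mul_comm a, ← Algebra.smul_def, map_smul, smul_eq_mul, mul_comm]
  have hinj : ∀ x, (∀ ξ : C →ₗ[F] F, ε (contractLeft ξ (L x)) = 0) → x = 0 := fun x hx => by
    have : S x = 0 := (Module.forall_dual_apply_eq_zero_iff F (S x)).mp fun ξ => by
      rw [← hES, hξE, hx]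
    rw [← hS2 x, this, map_zero]
  have hq : ∀ j, ∃ q : C ⊗[F] levelAlg F g k, L (linComb g k (c j)) =
      1 ⊗ₜ linComb g k (c j) + Algebra.TensorProduct.map (AlgHom.id F C) i q := by
    intro j
    choose w hw hLw using fun p : Fin n × Fin n => comul_a hL hLg k p.1 p.2
    have hw' : ∀ p, ∃ q : C ⊗[F] levelAlg F g k,
        w p = Algebra.TensorProduct.map (AlgHom.id F C) i q := fun p => by
      refine levelTensor_induction (p := fun w => ∃ q : C ⊗[F] levelAlg F g k,
        w = Algebra.TensorProduct.map (AlgHom.id F C) i q) ⟨0, by simp⟩ ?_ ?_ (hw p)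
      · rintro _ _ ⟨q, rfl⟩ ⟨q', rfl⟩
        exact ⟨q + q', by simp⟩
      · intro x _ y hy
        exact ⟨x ⊗ₜ ⟨y, hy⟩, by simp [i]⟩
    choose q hq using hw'
    refine ⟨∑ p, c j p • q p, ?_⟩
    simp only [linComb_apply, map_sum, map_smul, hLw, hq, smul_add, Finset.sum_add_distrib,
      TensorProduct.tmul_sum, TensorProduct.tmul_smul]
  choose q hq using hq
  refine eq_zero_of_eval_eq_zero hi hLR hmul hinj hq ?_ hf
  intro d r hd
  refine hc d ?_
  rw [map_sum]
  simp only [map_smul]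
  rw [← finsum_eq_sum_of_fintype, hd]
  exact r.2

end GroupPoint


/-! ### Relations of high order follow from those of bounded order. -/

section Noetherian

variable {n : ℕ} {F : Type*} [Field F]

/-- The linear form `linComb` as a polynomial. -/
noncomputable def linPoly (k : ℕ) (c : Fin n × Fin n → F) : MvPolynomial (Var n) F :=
  ∑ p : Fin n × Fin n, c p • MvPolynomial.X (.a k p.1 p.2)

theorem linPoly_mem (k : ℕ) (c : Fin n × Fin n → F) : linPoly k c ∈ levelPoly n F (k + 1) := by
  refine Subalgebra.sum_mem _ fun p _ => Subalgebra.smul_mem _ ?_ _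
  exact X_mem_levelPoly (v := .a k p.1 p.2) (le_refl (k + 1))

theorem evalAt_linPoly {A : Type*} [CommRing A] [Algebra F A] [Differential A]
    (g : (Matrix (Fin n) (Fin n) A)ˣ) (k : ℕ) (c : Fin n × Fin n → F) :
    evalAt F g (linPoly k c) = linComb g k c := by
  simp [linComb_apply, linPoly]

variable [Differential F]
variable {C : Type*} [CommRing C] [Algebra F C] [Differential C] [DifferentialAlgebra F C]
variable {A : Type*} [CommRing A] [Algebra F A] [Differential A] [DifferentialAlgebra F A]

theorem linComb_deriv (g : (Matrix (Fin n) (Fin n) A)ˣ) (k : ℕ) (c : Fin n × Fin n → F) :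
    (linComb g k c)′ = linComb g k (fun p => (c p)′) + linComb g (k + 1) c := by
  simp only [linComb_apply, map_sum, deriv_smul, Finset.sum_add_distrib]
  simp only [varEval, Function.iterate_succ_apply']

/-- The linear forms in the `k`-th derivative of the logarithmic derivative of `g` whose value can be
expressed by derivatives of lower order. -/
noncomputable def formSpace (g : (Matrix (Fin n) (Fin n) C)ˣ) (k : ℕ) :
    Submodule F (Fin n × Fin n → F) :=
  (Subalgebra.toSubmodule (levelAlg F g k)).comap (linComb g k)

/-- Differentiating a value of level at most `k` gives level at most `k + 1`. The Leibniz terms with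
differentiated coefficients are forms in the `a k`, which already have level `k + 1`. -/
theorem formSpace_mono (g : (Matrix (Fin n) (Fin n) C)ˣ) :
    Monotone (formSpace (F := F) g) := by
  refine monotone_nat_of_le_succ fun k c hc => ?_
  have h1 : linComb g (k + 1) c = (linComb g k c)′ - linComb g k (fun p => (c p)′) := by
    rw [linComb_deriv]; ring
  change linComb g (k + 1) c ∈ levelAlg F g (k + 1)
  rw [h1]
  refine sub_mem (deriv_mem_levelAlg g hc) ?_
  rw [linComb_apply]
  refine Subalgebra.sum_mem _ fun p _ => Subalgebra.smul_mem _ ?_ _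
  exact varEval_mem_levelAlg (v := .a k p.1 p.2) g (le_refl (k + 1))

/-- The forms in the `a (k + 1)` split into `formSpace g (k + 1)` and a complement. The former are
eliminated by differentiating relations of level `k + 1`, which hold at `h` too. The latter are
algebraically independent at `g` over lower level, so the coefficients of the remaining polynomial
vanish at `g`, hence at `h`. The matrix `h` itself is arbitrary. -/
theorem evalAt_eq_zero_succ [CharZero F] {g : (Matrix (Fin n) (Fin n) C)ˣ} (hg : IsGroupPoint F g)
    (h : (Matrix (Fin n) (Fin n) A)ˣ) {k : ℕ} (hk : formSpace (F := F) g (k + 1) ≤ formSpace g k)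
    (hH : ∀ p ∈ levelPoly n F (k + 1), evalAt F g p = 0 → evalAt F h p = 0)
    {e : MvPolynomial (Var n) F} (he : e ∈ levelPoly n F (k + 2)) (he0 : evalAt F g e = 0) :
    evalAt F h e = 0 := by
  classical
  -- By `hk` the form `l` already has a value of lower level one order down. This is a relation of
  -- level `k + 1`, valid at both points; its derivative expresses the form in the `a (k + 1)` by
  -- the same polynomial at both.
  have hrel : ∀ l ∈ formSpace (F := F) g (k + 1), ∃ r ∈ levelPoly n F (k + 1),
      evalAt F g r = linComb g (k + 1) l ∧ evalAt F h r = linComb h (k + 1) l := by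
    intro l hl
    obtain ⟨r, hr, hrg⟩ := hk hl
    have hrg' : evalAt F g r = linComb g k l := hrg
    have hrh : evalAt F h r = linComb h k l := by
      rw [← evalAt_linPoly, ← sub_eq_zero, ← map_sub]
      refine hH _ (sub_mem (levelPoly_mono (Nat.le_succ k) hr) (linPoly_mem k l)) ?_
      rw [map_sub, hrg', evalAt_linPoly, sub_self]
    refine ⟨r′ - linPoly k fun p => (l p)′, sub_mem (deriv_mem_levelPoly hr) (linPoly_mem _ _),
      ?_, ?_⟩
    · rw [map_sub, evalAt_deriv, hrg', evalAt_linPoly, linComb_deriv]; ring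
    · rw [map_sub, evalAt_deriv, hrh, evalAt_linPoly, linComb_deriv]; ring
  obtain ⟨W, hW⟩ := Submodule.exists_isCompl (formSpace (F := F) g (k + 1))
  let b := Module.finBasis F W
  set r := Module.finrank F W
  let c : Fin r → Fin n × Fin n → F := fun j => b j
  have hc : ∀ d : Fin r → F, linComb g (k + 1) (∑ j, d j • c j) ∈ levelAlg F g (k + 1) → d = 0 := by
    intro d hd
    have h1 : ∑ j, d j • c j ∈ formSpace (F := F) g (k + 1) := hd
    have h2 : ∑ j, d j • c j = ((∑ j, d j • b j : W) : Fin n × Fin n → F) := by simp [c]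
    have h3 := Submodule.disjoint_def.mp hW.disjoint _ h1 (h2 ▸ (∑ j, d j • b j : W).2)
    rw [h2] at h3
    exact funext (Fintype.linearIndependent_iff.mp b.linearIndependent d (Subtype.ext h3))
  have hdec : ∀ v : Fin n × Fin n → F, ∃ l ∈ formSpace (F := F) g (k + 1), ∃ s : Fin r → F,
      v = l + ∑ j, s j • c j := by
    intro v
    obtain ⟨l, hl, w, hw, rfl⟩ := Submodule.mem_sup.mp
      (hW.sup_eq_top ▸ Submodule.mem_top : v ∈ formSpace (F := F) g (k + 1) ⊔ W)
    refine ⟨l, hl, fun j => b.repr ⟨w, hw⟩ j, ?_⟩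
    have := congrArg Subtype.val (b.sum_repr ⟨w, hw⟩)
    simp only [Submodule.coe_sum, Submodule.coe_smul] at this
    rw [this]
  let Eg : MvPolynomial (Fin r) (levelPoly n F (k + 1)) →+* C :=
    MvPolynomial.eval₂Hom (((evalAt F g).comp (levelPoly n F (k + 1)).val :) : _ →+* C)
      fun j => linComb g (k + 1) (c j)
  let Eh : MvPolynomial (Fin r) (levelPoly n F (k + 1)) →+* A :=
    MvPolynomial.eval₂Hom (((evalAt F h).comp (levelPoly n F (k + 1)).val :) : _ →+* A)
      fun j => linComb h (k + 1) (c j)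
  have hC : ∀ p : levelPoly n F (k + 1), evalAt F g p = Eg (MvPolynomial.C p) ∧
      evalAt F h p = Eh (MvPolynomial.C p) := fun p => by simp [Eg, Eh]
  -- Up to relations valid at both points, `e` is a polynomial in the complementary forms with
  -- coefficients of level at most `k + 1`.
  have hf : ∃ f, evalAt F g e = Eg f ∧ evalAt F h e = Eh f := by
    clear he0
    induction he using Algebra.adjoin_induction with
    | mem x hx =>
      obtain ⟨v, hv, rfl⟩ := hx
      rcases Nat.lt_or_ge v.level (k + 2) with hv' | hv'
      · exact ⟨_, hC ⟨_, X_mem_levelPoly (Nat.lt_succ_iff.mp hv')⟩⟩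
      · cases v with
        | x i j => simp [Var.level] at hv'
        | y i j => simp [Var.level] at hv'
        | a k' i j =>
          obtain rfl : k' = k + 1 := by
            have h1 : k' + 1 ≤ k + 2 := hv
            have h2 : k + 2 ≤ k' + 1 := hv'
            omega
          obtain ⟨l, hl, s, hs⟩ := hdec (Pi.single (i, j) 1)
          obtain ⟨p, hp, hpg, hph⟩ := hrel l hl
          have hs' : linPoly (k + 1) (Pi.single (i, j) 1) =
              MvPolynomial.X (R := F) (.a (k + 1) i j) := by
            simp [linPoly, Pi.single_apply]
          refine ⟨MvPolynomial.C ⟨p, hp⟩ +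
            ∑ j, MvPolynomial.C (algebraMap F _ (s j)) * MvPolynomial.X j, ?_, ?_⟩
          · rw [← hs', evalAt_linPoly, hs, map_add, map_add, ← (hC _).1, hpg, map_sum, map_sum]
            simp only [map_smul]
            simp [Eg, Algebra.smul_def]
          · rw [← hs', evalAt_linPoly, hs, map_add, map_add, ← (hC _).2, hph, map_sum, map_sum]
            simp only [map_smul]
            simp [Eh, Algebra.smul_def]
    | algebraMap a => exact ⟨_, hC (algebraMap F _ a)⟩
    | add x y _ _ hx hy =>
      obtain ⟨f, hf1, hf2⟩ := hx
      obtain ⟨f', hf1', hf2'⟩ := hy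
      exact ⟨f + f', by rw [map_add, map_add, hf1, hf1'], by rw [map_add, map_add, hf2, hf2']⟩
    | mul x y _ _ hx hy =>
      obtain ⟨f, hf1, hf2⟩ := hx
      obtain ⟨f', hf1', hf2'⟩ := hy
      exact ⟨f * f', by rw [map_mul, map_mul, hf1, hf1'], by rw [map_mul, map_mul, hf2, hf2']⟩
  obtain ⟨f, hfg, hfh⟩ := hf
  let ρ : levelPoly n F (k + 1) →ₐ[F] levelAlg F g (k + 1) :=
    ((evalAt F g).comp (levelPoly n F (k + 1)).val).codRestrict _ fun p => ⟨p.1, p.2, rfl⟩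
  have hzero : MvPolynomial.map (ρ : _ →+* levelAlg F g (k + 1)) f = 0 := by
    refine algebraicIndependent_linComb hg hc ?_
    rw [MvPolynomial.coe_eval₂Hom, MvPolynomial.eval₂_map, ← he0, hfg]
    rfl
  have hzero' : MvPolynomial.map
      (((evalAt F h).comp (levelPoly n F (k + 1)).val :) : levelPoly n F (k + 1) →+* A) f = 0 := by
    refine MvPolynomial.ext _ _ fun α => ?_
    have h1 := congrArg (MvPolynomial.coeff α) hzero
    rw [MvPolynomial.coeff_map, MvPolynomial.coeff_zero] at h1
    rw [MvPolynomial.coeff_map, MvPolynomial.coeff_zero]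
    exact hH _ (f.coeff α).2 (congrArg Subtype.val h1)
  rw [hfh]
  change MvPolynomial.eval₂ _ _ f = 0
  rw [← RingHom.id_comp (((evalAt F h).comp (levelPoly n F (k + 1)).val :) :
    levelPoly n F (k + 1) →+* A), ← MvPolynomial.eval₂_map, hzero', MvPolynomial.eval₂_zero]

/-- From `m` on the form spaces are stationary, so `evalAt_eq_zero_succ` applies at every further
level. -/
theorem evalAt_eq_zero_of_level [CharZero F] {g : (Matrix (Fin n) (Fin n) C)ˣ}
    (hg : IsGroupPoint F g) (h : (Matrix (Fin n) (Fin n) A)ˣ) {m : ℕ}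
    (hm : ∀ k ≥ m, formSpace (F := F) g m = formSpace g k)
    (hH : ∀ p ∈ levelPoly n F (m + 1), evalAt F g p = 0 → evalAt F h p = 0)
    {p : MvPolynomial (Var n) F} (hp : evalAt F g p = 0) : evalAt F h p = 0 := by
  have key : ∀ d, ∀ p ∈ levelPoly n F (m + d + 1), evalAt F g p = 0 → evalAt F h p = 0 := by
    intro d
    induction d with
    | zero => exact hH
    | succ d ih =>
      intro p hp hp0
      refine evalAt_eq_zero_succ hg h (k := m + d) ?_ ih hp hp0
      rw [← hm (m + d + 1) (by omega), ← hm (m + d) (by omega)]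
  obtain ⟨d, hd⟩ := exists_mem_levelPoly p
  exact key d p (levelPoly_mono (by omega) hd) hp

end Noetherian

/-- Differential algebraic subgroups of `GL_n` in characteristic zero, reduced or not, satisfy the
descending chain condition. -/
theorem exists_least_of_directed {n : ℕ} {F : Type u} [Field F] [CharZero F] [Differential F]
    {ι : Type*} [Nonempty ι]
    (G : ι → ∀ (A : Type u) [CommRing A] [Algebra F A] [Differential A] [DifferentialAlgebra F A],
      Subgroup (Matrix (Fin n) (Fin n) A)ˣ)
    (hG : ∀ s, ∃ E : Set (MvPolynomial (Var n) F), ∀ (A : Type u) [CommRing A] [Algebra F A]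
      [Differential A] [DifferentialAlgebra F A] (g : (Matrix (Fin n) (Fin n) A)ˣ),
        g ∈ G s A ↔ ∀ e ∈ E, evalAt F g e = 0)
    (hdir : ∀ s t, ∃ r, ∀ (A : Type u) [CommRing A] [Algebra F A] [Differential A]
      [DifferentialAlgebra F A], G r A ≤ G s A ∧ G r A ≤ G t A) :
    ∃ s, ∀ t, ∀ (A : Type u) [CommRing A] [Algebra F A] [Differential A] [DifferentialAlgebra F A],
      G s A ≤ G t A := by
  choose E hE using hG
  -- The union of the vanishing ideals of the members; directedness closes it under addition.
  let I : Ideal (MvPolynomial (Var n) F) :=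
    { carrier := {u | ∃ s, ∀ (A : Type u) [CommRing A] [Algebra F A] [Differential A]
        [DifferentialAlgebra F A], ∀ g ∈ G s A, evalAt F g u = 0}
      zero_mem' := ⟨Classical.arbitrary ι, fun A _ _ _ _ g _ => map_zero _⟩
      add_mem' := by
        rintro u v ⟨s, hs⟩ ⟨t, ht⟩
        obtain ⟨r, hr⟩ := hdir s t
        exact ⟨r, fun A _ _ _ _ g hg => by
          rw [map_add, hs A g ((hr A).1 hg), ht A g ((hr A).2 hg), add_zero]⟩
      smul_mem' := by
        rintro c u ⟨s, hs⟩
        exact ⟨s, fun A _ _ _ _ g hg => by rw [smul_eq_mul, map_mul, hs A g hg, mul_zero]⟩ }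
  have hI : IsCoordIdeal I :=
    { deriv_mem := by
        rintro u ⟨s, hs⟩
        exact ⟨s, fun A _ _ _ _ g hg => by rw [evalAt_deriv, hs A g hg, map_zero]⟩
      xy_mem := fun i j => ⟨Classical.arbitrary ι, fun A _ _ _ _ g _ => by
        have h := congrFun (congrFun g.mul_inv i) j
        rw [Matrix.mul_apply] at h
        simp only [map_sub, map_sum, map_mul, evalAt_X, varEval, h, Matrix.one_apply]
        split_ifs <;> simp⟩
      yx_mem := fun i j => ⟨Classical.arbitrary ι, fun A _ _ _ _ g _ => by
        have h := congrFun (congrFun g.inv_mul i) j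
        rw [Matrix.mul_apply] at h
        simp only [map_sub, map_sum, map_mul, evalAt_X, varEval, h, Matrix.one_apply]
        split_ifs <;> simp⟩ }
  let := hI.differential
  have := hI.differentialAlgebra
  let C := MvPolynomial (Var n) F ⧸ I
  let g : (Matrix (Fin n) (Fin n) C)ˣ := hI.point
  have hev : ∀ p, evalAt F g p = Ideal.Quotient.mk I p := hI.evalAt_point
  -- Together with `hlift`: the differential homomorphisms `C → B` are the matrices that lie in all
  -- `G s B`, so `C` represents the intersection.
  have hmem : ∀ s (B : Type u) [CommRing B] [Algebra F B] [Differential B]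
      [DifferentialAlgebra F B] (φ : C →ₐ[F] B), (∀ a, φ a′ = (φ a)′) → mapGL φ g ∈ G s B := by
    intro s B _ _ _ _ φ hφ
    refine (hE s B _).mpr fun e he => ?_
    rw [evalAt_mapGL φ hφ, hev, Ideal.Quotient.eq_zero_iff_mem.mpr, map_zero]
    exact ⟨s, fun A _ _ _ _ g hg => (hE s A g).mp hg e he⟩
  have hlift : ∀ (B : Type u) [CommRing B] [Algebra F B] [Differential B]
      [DifferentialAlgebra F B] (h : (Matrix (Fin n) (Fin n) B)ˣ), (∀ s, h ∈ G s B) →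
      ∃ φ : C →ₐ[F] B, (∀ a, φ a′ = (φ a)′) ∧ mapGL φ g = h := by
    intro B _ _ _ _ h hh
    let φ : C →ₐ[F] B := Ideal.Quotient.liftₐ I (evalAt F h) fun u hu => by
      obtain ⟨s, hs⟩ := hu
      exact hs B h (hh s)
    have hφ : ∀ p, φ (Ideal.Quotient.mk I p) = evalAt F h p := fun p => rfl
    refine ⟨φ, fun a => ?_, ?_⟩
    · obtain ⟨p, rfl⟩ := Ideal.Quotient.mk_surjective a
      rw [hI.mk_deriv, hφ, hφ, evalAt_deriv]
    · ext i j
      change φ (Ideal.Quotient.mk I (MvPolynomial.X (.x i j))) = _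
      rw [hφ, evalAt_X]
      rfl
  -- By Yoneda, the structure maps classify the matrices `g₁⁻¹ g₂`, `1` and `g⁻¹`, which lie in
  -- every member because the members are subgroups.
  have hgp : IsGroupPoint F g :=
    { surjective := fun x => by
        obtain ⟨p, rfl⟩ := Ideal.Quotient.mk_surjective x
        exact ⟨p, hev p⟩
      exists_comul := hlift _ _ fun s => mul_mem
        (inv_mem (hmem s _ _ includeLeft_deriv)) (hmem s _ _ includeRight_deriv)
      exists_counit := hlift _ _ fun s => one_mem _
      exists_antipode := hlift _ _ fun s => inv_mem (hmem s C (AlgHom.id F C) fun _ => rfl) }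
  -- Finite dimension of the space of forms fixes a level beyond which nothing new occurs, and
  -- Hilbert's basis theorem gives finitely many generators of `I` up to that level.
  obtain ⟨m, hm⟩ := monotone_stabilizes_iff_noetherian.mpr
    (inferInstance : IsNoetherian F (Fin n × Fin n → F)) ⟨formSpace g, formSpace_mono g⟩
  obtain ⟨T, hT⟩ := (isNoetherianRing_iff_ideal_fg _).mp
    (inferInstance : IsNoetherianRing (levelPoly n F (m + 1)))
    (I.comap (levelPoly n F (m + 1)).val)
  -- Each generator vanishes on some member; by directedness finitely many vanish on a common one.
  have hTs : ∃ s, ∀ p ∈ T, ∀ (A : Type u) [CommRing A] [Algebra F A] [Differential A]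
      [DifferentialAlgebra F A], ∀ h ∈ G s A, evalAt F h p = 0 := by
    classical
    have hTI : ∀ p ∈ T, p.1 ∈ I := fun p hp => by
      have : p ∈ I.comap (levelPoly n F (m + 1)).val := hT ▸ Submodule.subset_span hp
      exact this
    clear hT
    induction T using Finset.induction_on with
    | empty => exact ⟨Classical.arbitrary ι, by simp⟩
    | insert p T _ ih =>
      obtain ⟨s, hs⟩ := ih fun p hp => hTI p (Finset.mem_insert_of_mem hp)
      obtain ⟨t, ht⟩ := hTI p (Finset.mem_insert_self p T)
      obtain ⟨r, hr⟩ := hdir s t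
      refine ⟨r, fun p' hp' A _ _ _ _ h hh => ?_⟩
      rcases Finset.mem_insert.mp hp' with rfl | hp'
      · exact ht A h ((hr A).2 hh)
      · exact hs p' hp' A h ((hr A).1 hh)
  obtain ⟨s, hs⟩ := hTs
  refine ⟨s, fun t A _ _ _ _ h hh => (hE t A h).mpr fun e he => ?_⟩
  refine evalAt_eq_zero_of_level hgp h (m := m) hm (fun p hp hp0 => ?_) (p := e) ?_
  · have h1 : (⟨p, hp⟩ : levelPoly n F (m + 1)) ∈ I.comap (levelPoly n F (m + 1)).val := by
      rw [hev] at hp0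
      have h3 : p ∈ I := Ideal.Quotient.eq_zero_iff_mem.mp hp0
      exact h3
    have h2 : I.comap (levelPoly n F (m + 1)).val ≤
        RingHom.ker ((evalAt F h).comp (levelPoly n F (m + 1)).val) := by
      rw [← hT]
      exact Submodule.span_le.mpr fun p hp => hs p hp A h hh
    exact h2 h1
  · rw [hev]
    exact Ideal.Quotient.eq_zero_iff_mem.mpr
      ⟨t, fun A _ _ _ _ g hg => (hE t A g).mp hg e he⟩


/-! ### Functoriality of the constructions. -/

section Composition

variable {R S T : Type u} [CommRing R] [CommRing S] [CommRing T]
variable {φ : R →+* S} {ψ : S →+* T} {χ : R →+* T} [RingHomCompTriple φ ψ χ]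
variable {X Y Z : Type u} [AddCommGroup X] [Module R X] [AddCommGroup Y] [Module S Y]
  [AddCommGroup Z] [Module T Z]

theorem altMap_apply_comp (n : ℕ) (g : Y →ₛₗ[ψ] Z) (f : X →ₛₗ[φ] Y)
    (x : ⋀[R]^n X) : altMap n (g.comp f : X →ₛₗ[χ] Z) x = altMap n g (altMap n f x) := by
  have hx : x ∈ Submodule.span R (Set.range (exteriorPower.ιMulti R n (M := X))) := by
    rw [exteriorPower.ιMulti_span]; trivial
  induction hx using Submodule.span_induction with
  | mem x hx =>
    obtain ⟨v, rfl⟩ := hx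
    simp only [altMap_ιMulti, LinearMap.comp_apply]
  | zero => simp
  | add x y _ _ hx hy => simp only [map_add, hx, hy]
  | smul r x _ hx =>
    rw [map_smulₛₗ, map_smulₛₗ, map_smulₛₗ, hx, RingHomCompTriple.comp_apply]

theorem symAlgMap_comp (g : Y →ₛₗ[ψ] Z) (f : X →ₛₗ[φ] Y) (x : SymmetricAlgebra R X) :
    symAlgMap (g.comp f : X →ₛₗ[χ] Z) x = symAlgMap g (symAlgMap f x) := by
  induction x using SymmetricAlgebra.induction with
  | algebraMap r =>
    simp only [Algebra.algebraMap_eq_smul_one, symAlgMap_smul, map_one,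
      RingHomCompTriple.comp_apply (σ₁₂ := φ) (σ₂₃ := ψ) (σ₁₃ := χ)]
  | ι x => simp only [symAlgMap_ι, LinearMap.comp_apply]
  | mul x y hx hy => simp only [map_mul, hx, hy]
  | add x y hx hy => simp only [map_add, hx, hy]

theorem symMap_apply_comp (n : ℕ) (g : Y →ₛₗ[ψ] Z) (f : X →ₛₗ[φ] Y) (x : SymPower R X n) :
    symMap n (g.comp f : X →ₛₗ[χ] Z) x = symMap n g (symMap n f x) :=
  Subtype.ext (symAlgMap_comp g f x)

/-- A base change map carries every basis to a basis. -/
theorem IsBaseChangeMap.exists_basis {f : X →ₛₗ[φ] Y} (hf : IsBaseChangeMap f) {ι : Type*} [Finite ι]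
    (B : Basis ι R X) : ∃ B' : Basis ι S Y, ∀ i, f (B i) = B' i := by
  classical
  have := Fintype.ofFinite ι
  have hli : LinearIndependent S fun i => f (B i) := by
    rw [Fintype.linearIndependent_iff]
    intro c hc i
    -- Pairing with the image of the dual basis isolates one coefficient.
    have h := congrArg (QDifference.dualMap f (B.coord i)) hc
    simp only [map_sum, map_smul, dualMap_apply hf, Basis.coord_apply, Basis.repr_self,
      Finsupp.single_apply, smul_eq_mul, map_zero] at h
    simpa using h
  refine ⟨Basis.mk hli fun y _ => ?_, fun i => by simp⟩
  obtain ⟨n, b, b', h⟩ := hf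
  have hb : ∀ j, b' j ∈ Submodule.span S (Set.range fun i => f (B i)) := fun j => by
    rw [← h, ← B.sum_repr (b j), map_sum]
    refine Submodule.sum_mem _ fun i _ => ?_
    rw [map_smulₛₗ]
    exact Submodule.smul_mem _ _ (Submodule.subset_span ⟨i, rfl⟩)
  rw [← b'.sum_repr y]
  exact Submodule.sum_mem _ fun j _ => Submodule.smul_mem _ _ (hb j)

theorem IsBaseChangeMap.repr_apply {f : X →ₛₗ[φ] Y} {ι : Type*} [Finite ι] {B : Basis ι R X}
    {B' : Basis ι S Y} (h : ∀ i, f (B i) = B' i) (x : X) (i : ι) :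
    B'.repr (f x) i = φ (B.repr x i) := by
  classical
  have := Fintype.ofFinite ι
  have hx : f x = ∑ j, φ (B.repr x j) • B' j := by
    conv_lhs => rw [← B.sum_repr x]
    simp only [map_sum, map_smulₛₗ, h]
  rw [hx]
  simp [Finsupp.single_apply]

theorem IsBaseChangeMap.comp {g : Y →ₛₗ[ψ] Z} {f : X →ₛₗ[φ] Y} (hg : IsBaseChangeMap g) (hf : IsBaseChangeMap f) :
    IsBaseChangeMap (g.comp f : X →ₛₗ[χ] Z) := by
  obtain ⟨n, b, b', h⟩ := hf
  obtain ⟨b'', h'⟩ := hg.exists_basis b'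
  exact ⟨n, b, b'', fun i => by rw [LinearMap.comp_apply, h, h']⟩

theorem dualMap_apply_comp {g : Y →ₛₗ[ψ] Z} {f : X →ₛₗ[φ] Y} (hg : IsBaseChangeMap g) (hf : IsBaseChangeMap f)
    (ξ : Dual R X) : dualMap (g.comp f : X →ₛₗ[χ] Z) ξ = dualMap g (dualMap f ξ) := by
  have hgf : IsBaseChangeMap (g.comp f : X →ₛₗ[χ] Z) := hg.comp hf
  obtain ⟨n, b, b', h⟩ := id hgf
  refine b'.ext fun i => ?_
  rw [← h, dualMap_apply hgf, LinearMap.comp_apply, dualMap_apply hg, dualMap_apply hf,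
    RingHomCompTriple.comp_apply]

variable [Differential R] [Differential S] [Differential T]

theorem Constr.map_comp (hφ : ∀ r, φ (r′) = (φ r)′) (hψ : ∀ r, ψ (r′) = (ψ r)′)
    (hχ : ∀ r, χ (r′) = (χ r)′) {g : Y →ₛₗ[ψ] Z} {f : X →ₛₗ[φ] Y} (hg : IsBaseChangeMap g)
    (hf : IsBaseChangeMap f) (c : Constr) (x : c.obj R X) :
    c.map hχ (g.comp f : X →ₛₗ[χ] Z) x = c.map hψ g (c.map hφ f x) := by
  induction c with
  | base => rfl
  | dsum a b ha hb => exact Prod.ext (ha x.1) (hb x.2)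
  | tensor a b ha hb =>
    have h1 : a.map hχ (g.comp f : X →ₛₗ[χ] Z) = (a.map hψ g).comp (a.map hφ f) :=
      LinearMap.ext ha
    have h2 : b.map hχ (g.comp f : X →ₛₗ[χ] Z) = (b.map hψ g).comp (b.map hφ f) :=
      LinearMap.ext hb
    have h3 : TensorProduct.map (a.map hχ (g.comp f : X →ₛₗ[χ] Z)) (b.map hχ (g.comp f : X →ₛₗ[χ] Z)) =
        (TensorProduct.map (a.map hψ g) (b.map hψ g)).comp
          (TensorProduct.map (a.map hφ f) (b.map hφ f)) := by
      rw [h1, h2, TensorProduct.map_comp]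
    exact LinearMap.congr_fun h3 x
  | sym n a ha =>
    have h1 : a.map hχ (g.comp f : X →ₛₗ[χ] Z) = (a.map hψ g).comp (a.map hφ f) :=
      LinearMap.ext ha
    have h3 : ∀ y : SymPower R (a.obj R X) n, symMap n (a.map hχ (g.comp f : X →ₛₗ[χ] Z)) y =
        symMap n (a.map hψ g) (symMap n (a.map hφ f) y) := fun y => by
      rw [h1]
      exact symMap_apply_comp n _ _ y
    exact h3 x
  | alt n a ha =>
    have h1 : a.map hχ (g.comp f : X →ₛₗ[χ] Z) = (a.map hψ g).comp (a.map hφ f) :=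
      LinearMap.ext ha
    have h3 : ∀ y : ⋀[R]^n (a.obj R X), altMap n (a.map hχ (g.comp f : X →ₛₗ[χ] Z)) y =
        altMap n (a.map hψ g) (altMap n (a.map hφ f) y) := fun y => by
      rw [h1]
      exact altMap_apply_comp n _ _ y
    exact h3 x
  | dual a ha =>
    have h1 : a.map hχ (g.comp f : X →ₛₗ[χ] Z) = (a.map hψ g).comp (a.map hφ f) :=
      LinearMap.ext ha
    have h3 : ∀ y : Dual R (a.obj R X), dualMap (a.map hχ (g.comp f : X →ₛₗ[χ] Z)) y =
        dualMap (a.map hψ g) (dualMap (a.map hφ f) y) := fun y => by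
      rw [h1]
      exact dualMap_apply_comp (a.isBaseChangeMap_map hψ hg) (a.isBaseChangeMap_map hφ hf) y
    exact h3 x
  | prolong a ha => exact Prod.ext (ha x.1) (ha x.2)

/-- Functoriality makes the map idempotent, and an injective idempotent map is the identity. -/
theorem Constr.map_id [Module.Free R X] [Module.Finite R X] (c : Constr) (x : c.obj R X) :
    c.map (φ := RingHom.id R) (fun _ => rfl) (LinearMap.id : X →ₗ[R] X) x = x := by
  have h0 : IsBaseChangeMap (LinearMap.id : X →ₗ[R] X) :=
    isBaseChangeMap_linearEquiv (LinearEquiv.refl R X)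
  have h1 := (c.isBaseChangeMap_map (φ := RingHom.id R) (fun _ => rfl) h0).bijective
    Function.bijective_id
  refine h1.1 ?_
  rw [← Constr.map_comp (χ := RingHom.id R) _ _ _ h0 h0]
  rfl

end Composition

/-! ### Stabilizers as subgroups defined by differential polynomials. -/

section StabilizerEquations

open QDiffModule

variable {F : Type u} [Field F] {X : Type u} [AddCommGroup X] [Module F X]

/-- The action of invertible matrices on `A ⊗ X`. -/
noncomputable def glEquiv {n : ℕ} (b : Basis (Fin n) F X) (A : Type u) [CommRing A] [Algebra F A] :
    (Matrix (Fin n) (Fin n) A)ˣ ≃* ((A ⊗[F] X) ≃ₗ[A] (A ⊗[F] X)) :=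
  (Units.mapEquiv (LinearMap.toMatrixAlgEquiv (b.baseChange A)).symm.toMulEquiv).trans
    (LinearMap.GeneralLinearGroup.generalLinearEquiv A (A ⊗[F] X))

theorem glEquiv_basis {n : ℕ} (b : Basis (Fin n) F X) (A : Type u) [CommRing A] [Algebra F A]
    (g : (Matrix (Fin n) (Fin n) A)ˣ) (j : Fin n) :
    glEquiv b A g (b.baseChange A j) = ∑ i, g.1 i j • b.baseChange A i := by
  change Matrix.toLinAlgEquiv (b.baseChange A) g.1 (b.baseChange A j) = _
  rw [Matrix.toLinAlgEquiv_self]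

/-- The map `p ⊗ x ↦ φ p ⊗ x`. -/
noncomputable def baseChangeAlong {P A : Type u} [CommRing P] [Algebra F P] [CommRing A] [Algebra F A]
    (φ : P →ₐ[F] A) (X : Type u) [AddCommGroup X] [Module F X] :
    P ⊗[F] X →ₛₗ[(φ : P →+* A)] A ⊗[F] X where
  toFun := φ.toLinearMap.rTensor X
  map_add' := map_add _
  map_smul' r z := by
    induction z with
    | zero => simp
    | add x y hx hy => simp only [smul_add, map_add, hx, hy]
    | tmul p x => simp [TensorProduct.smul_tmul']

theorem baseChangeAlong_tmul {P A : Type u} [CommRing P] [Algebra F P] [CommRing A] [Algebra F A]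
    (φ : P →ₐ[F] A) (p : P) (x : X) : baseChangeAlong φ X (p ⊗ₜ x) = φ p ⊗ₜ x := rfl

theorem isBaseChangeMap_baseChangeAlong {P A : Type u} [CommRing P] [Algebra F P] [CommRing A]
    [Algebra F A] (φ : P →ₐ[F] A) {n : ℕ} (b : Basis (Fin n) F X) :
    IsBaseChangeMap (baseChangeAlong φ X) :=
  ⟨n, b.baseChange P, b.baseChange A, fun i => by simp [baseChangeAlong_tmul]⟩

theorem exists_adapted_basis {W : Type*} [AddCommGroup W] [Module F W] [Module.Finite F W]
    (N : Submodule F W) : ∃ (r s : ℕ) (B : Basis (Fin r ⊕ Fin s) F W),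
      N = Submodule.span F (Set.range (B ∘ Sum.inl)) := by
  obtain ⟨N', hN⟩ := Submodule.exists_isCompl N
  refine ⟨_, _, ((Module.finBasis F N).prod (Module.finBasis F N')).map
    (Submodule.prodEquivOfIsCompl N N' hN), ?_⟩
  have : ⇑(((Module.finBasis F N).prod (Module.finBasis F N')).map
      (Submodule.prodEquivOfIsCompl N N' hN)) ∘ Sum.inl = N.subtype ∘ Module.finBasis F N := by
    ext i
    simp
  rw [this, Set.range_comp, ← Submodule.map_span, Basis.span_eq, Submodule.map_top,
    Submodule.range_subtype]

theorem mem_span_inl_iff {A W : Type*} [CommRing A] [AddCommGroup W] [Module A W] {r s : ℕ}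
    (B : Basis (Fin r ⊕ Fin s) A W) {y : W} :
    y ∈ Submodule.span A (Set.range (B ∘ Sum.inl)) ↔ ∀ k, B.repr y (Sum.inr k) = 0 := by
  constructor
  · intro hy k
    induction hy using Submodule.span_induction with
    | mem x hx =>
      obtain ⟨i, rfl⟩ := hx
      simp
    | zero => simp
    | add x y _ _ hx hy => simp [hx, hy]
    | smul a x _ hx => simp [hx]
  · intro h
    rw [← B.sum_repr y, Fintype.sum_sum_type]
    simp only [h, zero_smul, Finset.sum_const_zero, add_zero]
    exact Submodule.sum_mem _ fun i _ => Submodule.smul_mem _ _ (Submodule.subset_span ⟨i, rfl⟩)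

/-- By Cayley-Hamilton and the invertibility of the determinant, `f'` is a polynomial in `f`. No
dimension count is available for a submodule over the ring `A`. -/
theorem mem_of_inverse_of_forall_mem {A W : Type*} [CommRing A] [AddCommGroup W] [Module A W] [Module.Free A W]
    [Module.Finite A W] {f f' : W →ₗ[A] W} (hff : f ∘ₗ f' = LinearMap.id) {N : Submodule A W} (hN : ∀ y ∈ N, f y ∈ N) :
    ∀ y ∈ N, f' y ∈ N := by
  have hpow : ∀ p : Polynomial A, ∀ y ∈ N, Polynomial.aeval f p y ∈ N := fun p y hy => by
    induction p using Polynomial.induction_on' with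
    | add p q hp hq => rw [map_add]; exact add_mem hp hq
    | monomial k a =>
      rw [Polynomial.aeval_monomial, Module.End.mul_apply, Module.algebraMap_end_apply]
      refine N.smul_mem _ ?_
      induction k with
      | zero => exact hy
      | succ k ih => rw [pow_succ', Module.End.mul_apply]; exact hN _ ih
  have hunit : IsUnit (f.charpoly.coeff 0) := by
    have hdet : IsUnit (LinearMap.det f) := by
      refine IsUnit.of_mul_eq_one (LinearMap.det f') ?_
      rw [← LinearMap.det_comp, hff, LinearMap.det_id]
    rw [LinearMap.det_eq_sign_charpoly_coeff] at hdet
    exact isUnit_of_mul_isUnit_right hdet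
  obtain ⟨a, ha⟩ := hunit.exists_left_inv
  intro y hy
  have h1 : Polynomial.aeval f f.charpoly (f' y) = 0 := by
    rw [LinearMap.aeval_self_charpoly, LinearMap.zero_apply]
  rw [← Polynomial.divX_mul_X_add f.charpoly, map_add, map_mul, Polynomial.aeval_X,
    Polynomial.aeval_C, LinearMap.add_apply, Module.End.mul_apply, Module.algebraMap_end_apply,
    ← LinearMap.comp_apply f f', hff, LinearMap.id_apply, add_eq_zero_iff_neg_eq] at h1
  have h2 : f' y = a • (-(Polynomial.aeval f f.charpoly.divX y)) := by
    rw [h1, smul_smul, ha, one_smul]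
  rw [h2]
  exact N.smul_mem _ (neg_mem (hpow _ y hy))

theorem Constr.map_mul [Module.Finite F X] {A : Type u} [CommRing A] [Algebra F A]
    [Differential A] (c : Constr) (g h : (A ⊗[F] X) ≃ₗ[A] (A ⊗[F] X)) (y : c.obj A (A ⊗[F] X)) :
    c.map (φ := RingHom.id A) (fun _ => rfl) (g * h).toLinearMap y =
      c.map (φ := RingHom.id A) (fun _ => rfl) g.toLinearMap
        (c.map (φ := RingHom.id A) (fun _ => rfl) h.toLinearMap y) :=
  Constr.map_comp (χ := RingHom.id A) _ _ _ (isBaseChangeMap_linearEquiv g)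
    (isBaseChangeMap_linearEquiv h) c y

variable [Differential F]
variable (A : Type u) [CommRing A] [Algebra F A] [Differential A] [DifferentialAlgebra F A]

/-- A basis of `c(X)` gives a basis of `c(A ⊗ X)`. -/
theorem exists_baseChange_basis [Module.Finite F X] (c : Constr) {ι : Type*} [Finite ι] (B : Basis ι F (c.obj F X)) :
    ∃ B' : Basis ι A (c.obj A (A ⊗[F] X)),
      ∀ i, c.map (fun f => (deriv_algebraMap (A := F) (B := A) f).symm) (toBaseChange F A X) (B i) =
        B' i :=
  (c.isBaseChangeMap_map _ (isBaseChangeMap_toBaseChange F A X)).exists_basis B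

variable {A}

theorem scalarExtension_eq_span (c : Constr) {N : Submodule F (c.obj F X)} {r s : ℕ}
    {B : Basis (Fin r ⊕ Fin s) F (c.obj F X)} (hN : N = Submodule.span F (Set.range (B ∘ Sum.inl)))
    {B' : Basis (Fin r ⊕ Fin s) A (c.obj A (A ⊗[F] X))}
    (hB : ∀ i, c.map (fun f => (deriv_algebraMap (A := F) (B := A) f).symm)
      (toBaseChange F A X) (B i) = B' i) :
    scalarExtension A c N = Submodule.span A (Set.range (B' ∘ Sum.inl)) := by
  refine le_antisymm (Submodule.span_le.mpr ?_) (Submodule.span_mono ?_)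
  · rintro _ ⟨x, hx, rfl⟩
    refine (mem_span_inl_iff B').mpr fun k => ?_
    rw [IsBaseChangeMap.repr_apply hB, (mem_span_inl_iff B).mp (hN ▸ hx), map_zero]
  · rintro _ ⟨i, rfl⟩
    exact ⟨B (Sum.inl i), hN ▸ Submodule.subset_span ⟨i, rfl⟩, hB _⟩

/-- In a basis adapted to `N`, stability is the vanishing of one block of matrix entries; these
entries supply the equations of the stabilizer. -/
theorem mem_stabilizer_iff_repr (c : Constr) {N : Submodule F (c.obj F X)} {r s : ℕ}
    {B : Basis (Fin r ⊕ Fin s) F (c.obj F X)} (hN : N = Submodule.span F (Set.range (B ∘ Sum.inl)))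
    {B' : Basis (Fin r ⊕ Fin s) A (c.obj A (A ⊗[F] X))}
    (hB : ∀ i, c.map (fun f => (deriv_algebraMap (A := F) (B := A) f).symm)
      (toBaseChange F A X) (B i) = B' i) (g : (A ⊗[F] X) ≃ₗ[A] (A ⊗[F] X)) :
    g ∈ stabilizer A c N ↔ ∀ i k, B'.repr (c.map (φ := RingHom.id A) (fun _ => rfl) g.toLinearMap
      (B' (Sum.inl i))) (Sum.inr k) = 0 := by
  have hs := scalarExtension_eq_span c hN hB
  constructor
  · intro hg i k
    have h := hg (B' (Sum.inl i)) (hs ▸ Submodule.subset_span ⟨i, rfl⟩)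
    exact (mem_span_inl_iff B').mp (hs ▸ h) k
  · intro h y hy
    rw [hs] at hy ⊢
    have : Submodule.span A (Set.range (B' ∘ Sum.inl)) ≤
        (Submodule.span A (Set.range (B' ∘ Sum.inl))).comap
          (c.map (φ := RingHom.id A) (fun _ => rfl) g.toLinearMap) := by
      refine Submodule.span_le.mpr ?_
      rintro _ ⟨i, rfl⟩
      exact (mem_span_inl_iff B').mpr (h i)
    exact this hy

variable [Module.Finite F X]

variable (A) in
/-- The stabilizer as a subgroup of the group of invertible matrices. -/
noncomputable def stabilizerSubgroup {n : ℕ} (b : Basis (Fin n) F X) (c : Constr)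
    (N : Submodule F (c.obj F X)) : Subgroup (Matrix (Fin n) (Fin n) A)ˣ where
  carrier := {g | glEquiv b A g ∈ stabilizer A c N}
  one_mem' y hy := by
    rw [map_one]
    have h : c.map (φ := RingHom.id A) (fun _ => rfl) (LinearMap.id : A ⊗[F] X →ₗ[A] A ⊗[F] X) y ∈
      scalarExtension A c N := by rwa [Constr.map_id]
    exact h
  mul_mem' {g h} hg hh y hy := by
    rw [map_mul, Constr.map_mul]
    exact hg _ (hh y hy)
  inv_mem' {g} hg := by
    have : Module.Finite A (c.obj A (A ⊗[F] X)) :=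
      (c.isBaseChangeMap_map (φ := RingHom.id A) (fun _ => rfl)
        (isBaseChangeMap_linearEquiv (glEquiv b A g))).finite
    have : Module.Free A (c.obj A (A ⊗[F] X)) := by
      obtain ⟨n, b, -⟩ := c.isBaseChangeMap_map (φ := RingHom.id A) (fun _ => rfl)
        (isBaseChangeMap_linearEquiv (glEquiv b A g))
      exact Module.Free.of_basis b
    refine mem_of_inverse_of_forall_mem (LinearMap.ext fun y => ?_) hg
    rw [LinearMap.comp_apply, ← Constr.map_mul, ← map_mul, mul_inv_cancel, map_one]
    exact Constr.map_id c y

variable (F) in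
/-- The polynomials that vanish at all invertible matrices. -/
def vanishingIdeal (n : ℕ) : Ideal (MvPolynomial (Var n) F) where
  carrier := {u | ∀ (A : Type u) [CommRing A] [Algebra F A] [Differential A]
    [DifferentialAlgebra F A] (g : (Matrix (Fin n) (Fin n) A)ˣ), evalAt F g u = 0}
  zero_mem' A _ _ _ _ g := map_zero _
  add_mem' hu hv A _ _ _ _ g := by rw [map_add, hu A g, hv A g, add_zero]
  smul_mem' c u hu A _ _ _ _ g := by rw [smul_eq_mul, map_mul, hu A g, mul_zero]

theorem isCoordIdeal_vanishingIdeal (n : ℕ) : IsCoordIdeal (vanishingIdeal F n) where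
  deriv_mem u hu A _ _ _ _ g := by rw [evalAt_deriv, hu A g, map_zero]
  xy_mem i j A _ _ _ _ g := by
    have h := congrFun (congrFun g.mul_inv i) j
    rw [Matrix.mul_apply] at h
    simp only [map_sub, map_sum, map_mul, evalAt_X, varEval, h, Matrix.one_apply]
    split_ifs <;> simp
  yx_mem i j A _ _ _ _ g := by
    have h := congrFun (congrFun g.inv_mul i) j
    rw [Matrix.mul_apply] at h
    simp only [map_sub, map_sum, map_mul, evalAt_X, varEval, h, Matrix.one_apply]
    split_ifs <;> simp

/-- The equations are the block entries for the universal invertible matrix. Every invertible matrix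
over every `A` is a specialization of it, and constructions commute with specialization, so the same
polynomials serve all `A`. -/
theorem exists_equations {n : ℕ} (b : Basis (Fin n) F X) (c : Constr) (N : Submodule F (c.obj F X)) :
    ∃ E : Set (MvPolynomial (Var n) F), ∀ (A : Type u) [CommRing A] [Algebra F A] [Differential A]
      [DifferentialAlgebra F A] (g : (Matrix (Fin n) (Fin n) A)ˣ),
        g ∈ stabilizerSubgroup A b c N ↔ ∀ e ∈ E, evalAt F g e = 0 := by
  have : Module.Finite F (c.obj F X) :=
    (c.isBaseChangeMap_map (φ := RingHom.id F) (fun _ => rfl)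
      (isBaseChangeMap_linearEquiv (LinearEquiv.refl F X))).finite
  obtain ⟨r, s, B, hN⟩ := exists_adapted_basis N
  have hI := isCoordIdeal_vanishingIdeal (F := F) n
  let := hI.differential
  have := hI.differentialAlgebra
  let P := MvPolynomial (Var n) F ⧸ vanishingIdeal F n
  obtain ⟨BP, hBP⟩ := exists_baseChange_basis P c B
  let ent : Fin r → Fin s → P := fun i k => BP.repr (c.map (φ := RingHom.id P) (fun _ => rfl)
    (glEquiv b P hI.point).toLinearMap (BP (Sum.inl i))) (Sum.inr k)
  refine ⟨{e | ∃ i k, Ideal.Quotient.mk _ e = ent i k}, fun A _ _ _ _ g => ?_⟩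
  obtain ⟨BA, hBA⟩ := exists_baseChange_basis A c B
  let φ : P →ₐ[F] A := Ideal.Quotient.liftₐ _ (evalAt F g) fun u hu => hu A g
  have hφ : ∀ p, φ (Ideal.Quotient.mk _ p) = evalAt F g p := fun p => rfl
  have hφd : ∀ a, (φ : P →+* A) a′ = ((φ : P →+* A) a)′ := fun a => by
    obtain ⟨p, rfl⟩ := Ideal.Quotient.mk_surjective a
    exact evalAt_deriv g p
  have hφB := isBaseChangeMap_baseChangeAlong φ b
  have : RingHomCompTriple (algebraMap F P) (φ : P →+* A) (algebraMap F A) :=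
    ⟨φ.comp_algebraMap⟩
  have hB : ∀ i, c.map hφd (baseChangeAlong φ X) (BP i) = BA i := fun i => by
    rw [← hBP, ← hBA, ← Constr.map_comp _ hφd
      (fun f => (deriv_algebraMap (A := F) (B := A) f).symm) hφB
      (isBaseChangeMap_toBaseChange F P X)]
    congr 2
    ext x
    simp [toBaseChange, baseChangeAlong_tmul]
  have hcomm : ((glEquiv b A g).toLinearMap.comp (baseChangeAlong φ X) :
      P ⊗[F] X →ₛₗ[(φ : P →+* A)] A ⊗[F] X) =
      (baseChangeAlong φ X).comp (glEquiv b P hI.point).toLinearMap := by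
    refine (b.baseChange P).ext fun j => ?_
    rw [LinearMap.comp_apply, LinearMap.comp_apply, LinearEquiv.coe_coe, LinearEquiv.coe_coe,
      glEquiv_basis]
    have h1 : ∀ j, baseChangeAlong φ X (b.baseChange P j) = b.baseChange A j := fun j => by
      simp [baseChangeAlong_tmul]
    rw [h1, glEquiv_basis, map_sum]
    refine Finset.sum_congr rfl fun i _ => ?_
    rw [map_smulₛₗ, h1]
    congr 1
    exact (evalAt_X g (.x i j)).symm
  have hent : ∀ i k, BA.repr (c.map (φ := RingHom.id A) (fun _ => rfl)
      (glEquiv b A g).toLinearMap (BA (Sum.inl i))) (Sum.inr k) = φ (ent i k) := fun i k => by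
    rw [← hB, ← Constr.map_comp (χ := (φ : P →+* A)) hφd _ hφd (isBaseChangeMap_linearEquiv _) hφB,
      hcomm, Constr.map_comp (χ := (φ : P →+* A)) _ hφd hφd hφB (isBaseChangeMap_linearEquiv _)]
    exact IsBaseChangeMap.repr_apply hB _ _
  refine (mem_stabilizer_iff_repr c hN hBA _).trans ⟨?_, ?_⟩
  · rintro h e ⟨i, k, he⟩
    rw [← hφ, he, ← hent, h]
  · intro h i k
    obtain ⟨e, he⟩ := Ideal.Quotient.mk_surjective (ent i k)
    rw [hent, ← he, hφ]
    exact h e ⟨i, k, he⟩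

end StabilizerEquations


/-! ### From a subspace to the line spanned by its top exterior power. -/

section ExteriorLine

variable {A W : Type u} [CommRing A] [AddCommGroup W] [Module A W] {r s : ℕ}

theorem altMap_smul (n : ℕ) {S Y : Type u} [CommRing S] [AddCommGroup Y] [Module S Y] {φ : A →+* S}
    (f : W →ₛₗ[φ] Y) (a : A) (x : ⋀[A]^n W) : altMap n f (a • x) = φ a • altMap n f x :=
  map_smulₛₗ _ _ _

/-- The determinant of the coordinates of the first kind, as a functional on the exterior power. -/
theorem exists_functional_ιMulti_eq_one (B : Basis (Fin r ⊕ Fin s) A W) :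
    ∃ δ : ⋀[A]^r W →ₗ[A] A, δ (exteriorPower.ιMulti A r (B ∘ Sum.inl)) = 1 := by
  refine ⟨exteriorPower.alternatingMapLinearEquiv ((Matrix.detRowAlternating (R := A)
    (n := Fin r)).compLinearMap (LinearMap.pi fun j => B.coord (Sum.inl j))), ?_⟩
  rw [exteriorPower.alternatingMapLinearEquiv_apply_ιMulti, AlternatingMap.compLinearMap_apply]
  refine Eq.trans ?_ (Matrix.det_one (R := A) (n := Fin r))
  change Matrix.det (Matrix.of fun i j => B.repr (B (Sum.inl i)) (Sum.inl j)) = _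
  congr 1
  ext i j
  simp [Matrix.one_apply, Finsupp.single_apply]

/-- Exterior multiplication by `w` followed by the minor of the coordinates `inr k`, `inl _`. -/
theorem exists_functional_coord (B : Basis (Fin r ⊕ Fin s) A W) (k : Fin s) (w : W) :
    ∃ ψ : ⋀[A]^r W →ₗ[A] A,
      ψ (exteriorPower.ιMulti A r (B ∘ Sum.inl)) = B.repr w (Sum.inr k) ∧
      ∀ v : Fin r → W, w ∈ Set.range v → ψ (exteriorPower.ιMulti A r v) = 0 := by
  let C : W →ₗ[A] (Fin (r + 1) → A) := LinearMap.pi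
    (Fin.cons (B.coord (Sum.inr k)) fun j => B.coord (Sum.inl j))
  let Φ := (Matrix.detRowAlternating (R := A) (n := Fin (r + 1))).compLinearMap C
  refine ⟨exteriorPower.alternatingMapLinearEquiv (Φ.curryLeft w), ?_, ?_⟩
  · rw [exteriorPower.alternatingMapLinearEquiv_apply_ιMulti, AlternatingMap.curryLeft_apply_apply,
      AlternatingMap.compLinearMap_apply]
    change Matrix.det (Matrix.of fun i => C (Matrix.vecCons w (B ∘ Sum.inl) i)) = _
    -- The first column holds the `inr k` coordinates and vanishes on all `B (inl i)`, so only the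
    -- entry of `w` survives, with an identity minor.
    rw [Matrix.det_succ_column_zero, Fin.sum_univ_succ, Finset.sum_eq_zero]
    · have h : (Matrix.of fun i => C (Matrix.vecCons w (B ∘ Sum.inl) i)).submatrix
          (Fin.succAbove 0) Fin.succ = 1 := by
        ext i j
        simp [C, Matrix.one_apply, Finsupp.single_apply]
      rw [h, Matrix.det_one]
      simp [C]
    · intro i _
      simp [C]
  · rintro v ⟨i, rfl⟩
    rw [exteriorPower.alternatingMapLinearEquiv_apply_ιMulti, AlternatingMap.curryLeft_apply_apply]
    exact AlternatingMap.map_eq_zero_of_eq _ _ (i := 0) (j := i.succ) (by simp)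
      (Fin.succ_ne_zero i).symm

/-- An automorphism that preserves the line `⋀ʳ N` preserves the span `N` of the `B (inl i)`. -/
theorem repr_eq_zero_of_altMap_eq_smul (B : Basis (Fin r ⊕ Fin s) A W) {h h' : W →ₗ[A] W}
    (hh : h' ∘ₗ h = LinearMap.id) {a : A}
    (ha : altMap r h (exteriorPower.ιMulti A r (B ∘ Sum.inl)) =
      a • exteriorPower.ιMulti A r (B ∘ Sum.inl)) (i : Fin r) (k : Fin s) :
    B.repr (h (B (Sum.inl i))) (Sum.inr k) = 0 := by
  -- Applying the inverse `h'` and the functional `δ` writes `1` as a multiple of `a`. A mere `a ≠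
  -- 0` would not do, as `A` may have zero divisors.
  have hunit : IsUnit a := by
    obtain ⟨δ, hδ⟩ := exists_functional_ιMulti_eq_one B
    have h1 := congrArg (fun z => δ (altMap r h' z)) ha
    simp only [altMap_ιMulti] at h1
    rw [altMap_smul, map_smul] at h1
    have h2 : (fun i => h' (h ((B ∘ Sum.inl) i))) = B ∘ Sum.inl :=
      funext fun i => LinearMap.congr_fun hh _
    rw [h2, hδ] at h1
    exact IsUnit.of_mul_eq_one _ h1.symm
  -- Multiplication by `h (B (inl i))` kills the left side of `ha`, of which it is a factor, and
  -- turns the right side into `a` times the wanted coordinate.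
  obtain ⟨ψ, hψ, hψ'⟩ := exists_functional_coord B k (h (B (Sum.inl i)))
  have h1 := congrArg ψ ha
  rw [altMap_ιMulti, hψ' _ ⟨i, rfl⟩, map_smul, hψ, smul_eq_mul] at h1
  exact (hunit.mul_right_eq_zero.mp h1.symm)

/-- Modulo the line, the wedge is an alternating map on the span of the `B (inl i)`, so it suffices
to test injective families of basis vectors. These are permutations and change the wedge by a sign.
-/
theorem ιMulti_mem_span_of_mem (B : Basis (Fin r ⊕ Fin s) A W) (v : Fin r → W)
    (hv : ∀ i, v i ∈ Submodule.span A (Set.range (B ∘ Sum.inl))) :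
    exteriorPower.ιMulti A r v ∈
      Submodule.span A {exteriorPower.ιMulti A r (B ∘ Sum.inl)} := by
  let L := Submodule.span A {exteriorPower.ιMulti A r (B ∘ Sum.inl)}
  let e := Basis.span (B.linearIndependent.comp Sum.inl Sum.inl_injective)
  let N := Submodule.span A (Set.range (B ∘ Sum.inl))
  have he : ∀ i, (e i : W) = B (Sum.inl i) := fun i => by
    simp [e, Basis.span_apply]
  have h0 : (L.mkQ.compAlternatingMap ((exteriorPower.ιMulti A r (M := W)).compLinearMap
      N.subtype)) = 0 := by
    refine e.ext_alternating fun τ hτ => ?_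
    let p := Equiv.ofBijective τ (Finite.injective_iff_bijective.mp hτ)
    rw [LinearMap.compAlternatingMap_apply, AlternatingMap.zero_apply, Submodule.mkQ_apply,
      Submodule.Quotient.mk_eq_zero, AlternatingMap.compLinearMap_apply]
    have h1 : (fun i => N.subtype (e (τ i))) = (B ∘ Sum.inl) ∘ p := funext fun i => he _
    rw [h1, AlternatingMap.map_perm]
    exact Submodule.smul_of_tower_mem _ _ (Submodule.mem_span_singleton_self _)
  have h2 := congrArg (fun f => f fun i => (⟨v i, hv i⟩ : N)) h0
  exact (Submodule.Quotient.mk_eq_zero L).mp h2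

theorem span_image_span_singleton {F Y : Type*} [CommRing F] [AddCommGroup Y] [Module F Y]
    {φ : F →+* A} (T : Y →ₛₗ[φ] W) (y : Y) :
    Submodule.span A (T '' (Submodule.span F {y} : Set Y)) = Submodule.span A {T y} := by
  refine le_antisymm (Submodule.span_le.mpr ?_) (Submodule.span_mono ?_)
  · rintro _ ⟨x, hx, rfl⟩
    obtain ⟨a, rfl⟩ := Submodule.mem_span_singleton.mp hx
    exact Submodule.mem_span_singleton.mpr ⟨φ a, (map_smulₛₗ _ _ _).symm⟩
  · rintro _ rfl
    exact ⟨y, Submodule.mem_span_singleton_self _, rfl⟩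

variable {F : Type u} [Field F]

theorem finrank_span_ιMulti {W : Type u} [AddCommGroup W] [Module F W] {r s : ℕ}
    (B : Basis (Fin r ⊕ Fin s) F W) :
    Module.finrank F (Submodule.span F {exteriorPower.ιMulti F r (B ∘ Sum.inl)}) = 1 := by
  obtain ⟨δ, hδ⟩ := exists_functional_ιMulti_eq_one B
  refine finrank_span_singleton fun h => ?_
  rw [h, map_zero] at hδ
  exact zero_ne_one hδ

theorem image_span_singleton_eq {W : Type u} [AddCommGroup W] [Module F W] {σ : F ≃+* F}
    {f : W →ₛₗ[(σ : F →+* F)] W} (hf : Function.Injective f) {w : W}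
    (hw : f w ∈ Submodule.span F {w}) :
    f '' (Submodule.span F {w} : Set W) = Submodule.span F {w} := by
  obtain ⟨a, ha⟩ := Submodule.mem_span_singleton.mp hw
  refine Set.Subset.antisymm ?_ fun y hy => ?_
  · rintro _ ⟨x, hx, rfl⟩
    obtain ⟨b, rfl⟩ := Submodule.mem_span_singleton.mp hx
    rw [map_smulₛₗ]
    exact Submodule.smul_mem _ _ hw
  · obtain ⟨b, rfl⟩ := Submodule.mem_span_singleton.mp hy
    by_cases h0 : a = 0
    · have hw0 : w = 0 := hf (by rw [← ha, h0, zero_smul, map_zero])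
      exact ⟨0, zero_mem _, by rw [hw0, smul_zero, map_zero]⟩
    -- This is the preimage of `b • w`, because `f w = a • w` and `f` is `σ`-semilinear.
    · refine ⟨σ.symm (b / a) • w, Submodule.smul_mem _ _ (Submodule.mem_span_singleton_self _), ?_⟩
      rw [map_smulₛₗ, ← ha, smul_smul]
      congr 1
      simp [h0]

theorem image_span_ιMulti {W : Type u} [AddCommGroup W] [Module F W] [Module.Finite F W]
    {σ : F ≃+* F} {f : W →ₛₗ[(σ : F →+* F)] W} (hf : Function.Bijective f) {r s : ℕ}
    (B : Basis (Fin r ⊕ Fin s) F W)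
    (hN : ∀ y ∈ Submodule.span F (Set.range (B ∘ Sum.inl)),
      f y ∈ Submodule.span F (Set.range (B ∘ Sum.inl))) :
    altMap r f '' (Submodule.span F {exteriorPower.ιMulti F r (B ∘ Sum.inl)} : Set (⋀[F]^r W)) =
      Submodule.span F {exteriorPower.ιMulti F r (B ∘ Sum.inl)} := by
  refine image_span_singleton_eq
    (((IsBaseChangeMap.of_bijective hf).altMap r).bijective σ.bijective).1 ?_
  rw [altMap_ιMulti]
  exact ιMulti_mem_span_of_mem B _ fun i => hN _ (Submodule.subset_span ⟨i, rfl⟩)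

end ExteriorLine

section Line

open QDiffModule

variable {F : Type u} [Field F] [Differential F] {X : Type u} [AddCommGroup X] [Module F X]
variable [Module.Finite F X]

/-- The scalar extension of the line is spanned by the wedge of the extended basis, which reduces
the claim to `repr_eq_zero_of_altMap_eq_smul`. Only this inclusion is needed, since the Galois group
preserves the line by definition. -/
theorem stabilizer_span_ιMulti_subset {c : Constr} {N : Submodule F (c.obj F X)} {r s : ℕ}
    {B : Basis (Fin r ⊕ Fin s) F (c.obj F X)} (hN : N = Submodule.span F (Set.range (B ∘ Sum.inl)))
    (A : Type u) [CommRing A] [Algebra F A] [Differential A] [DifferentialAlgebra F A] :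
    stabilizer A (Constr.alt r c) (X := X)
      (Submodule.span F {exteriorPower.ιMulti F r (B ∘ Sum.inl)}) ⊆ stabilizer A c N := by
  intro g hg
  obtain ⟨B', hB⟩ := exists_baseChange_basis A c B
  refine (mem_stabilizer_iff_repr c hN hB g).mpr fun i k => ?_
  let ω := exteriorPower.ιMulti F r (B ∘ Sum.inl)
  let ω' := exteriorPower.ιMulti A r (B' ∘ Sum.inl)
  let T := c.map (fun f => (deriv_algebraMap (A := F) (B := A) f).symm) (toBaseChange F A X)
  have hω : altMap r T ω = ω' := by
    rw [altMap_ιMulti]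
    congr 1
    exact funext fun i => hB _
  let E : Submodule A (⋀[A]^r (c.obj A (A ⊗[F] X))) :=
    scalarExtension A (Constr.alt r c) (X := X) (Submodule.span F {ω})
  have hL : E = Submodule.span A {ω'} := by
    rw [← hω]
    exact span_image_span_singleton (altMap r T) ω
  have h1 : ω' ∈ E := hL ▸ Submodule.mem_span_singleton_self _
  have h2 : altMap r (c.map (φ := RingHom.id A) (fun _ => rfl) g.toLinearMap) ω' ∈ E := hg ω' h1
  obtain ⟨a, ha⟩ := Submodule.mem_span_singleton.mp (hL ▸ h2)
  refine repr_eq_zero_of_altMap_eq_smul B'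
    (h' := c.map (φ := RingHom.id A) (fun _ => rfl) (g⁻¹).toLinearMap)
    (LinearMap.ext fun y => ?_) ha.symm i k
  rw [LinearMap.comp_apply, ← Constr.map_mul, inv_mul_cancel]
  exact Constr.map_id c y

end Line

/-! ### Direct sums make the family of stabilizers directed. -/

section DirectSum

open QDiffModule

variable {F : Type u} [Field F] [Differential F] {X : Type u} [AddCommGroup X] [Module F X]

theorem stabilizer_prod_subset {c d : Constr} (N : Submodule F (c.obj F X))
    (N' : Submodule F (d.obj F X)) (A : Type u) [CommRing A] [Algebra F A] [Differential A]
    [DifferentialAlgebra F A] :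
    stabilizer A (Constr.dsum c d) (X := X) (N.prod N') ⊆ stabilizer A c N ∩ stabilizer A d N' := by
  intro g hg
  have hd : ∀ r, algebraMap F A (r′) = (algebraMap F A r)′ := fun f =>
    (deriv_algebraMap (A := F) (B := A) f).symm
  let E : Submodule A (c.obj A (A ⊗[F] X) × d.obj A (A ⊗[F] X)) :=
    scalarExtension A (Constr.dsum c d) (X := X) (N.prod N')
  have hE : ∀ y ∈ E, y.1 ∈ scalarExtension A c N ∧ y.2 ∈ scalarExtension A d N' := by
    have : E ≤ (scalarExtension A c N).prod (scalarExtension A d N') := by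
      refine Submodule.span_le.mpr ?_
      rintro _ ⟨x, hx, rfl⟩
      exact ⟨Submodule.subset_span ⟨_, hx.1, rfl⟩, Submodule.subset_span ⟨_, hx.2, rfl⟩⟩
    exact fun y hy => this hy
  have h1 : scalarExtension A c N ≤ E.comap (LinearMap.inl A _ _) := by
    refine Submodule.span_le.mpr ?_
    rintro _ ⟨x, hx, rfl⟩
    exact Submodule.subset_span ⟨(x, 0), ⟨hx, zero_mem _⟩, Prod.ext rfl (map_zero (d.map hd _))⟩
  have h2 : scalarExtension A d N' ≤ E.comap (LinearMap.inr A _ _) := by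
    refine Submodule.span_le.mpr ?_
    rintro _ ⟨x, hx, rfl⟩
    exact Submodule.subset_span ⟨(0, x), ⟨zero_mem _, hx⟩, Prod.ext (map_zero (c.map hd _)) rfl⟩
  exact ⟨fun y hy => (hE _ (hg _ (h1 hy))).1, fun y hy => (hE _ (hg _ (h2 hy))).2⟩

theorem image_prodMap_prod {R : Type u} [CommRing R] {σ : R →+* R} {Y Z : Type u} [AddCommGroup Y]
    [Module R Y] [AddCommGroup Z] [Module R Z] {f : Y →ₛₗ[σ] Y} {g : Z →ₛₗ[σ] Z}
    {N : Submodule R Y} {N' : Submodule R Z} (hN : f '' (N : Set Y) = N)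
    (hN' : g '' (N' : Set Z) = N') :
    prodMap f g '' (N.prod N' : Set (Y × Z)) = (N.prod N' : Submodule R (Y × Z)) := by
  rw [Submodule.prod_coe]
  conv_rhs => rw [← hN, ← hN']
  exact Set.prodMap_image_prod f g _ _

end DirectSum


/-! ### Symmetric and exterior powers in the tensor category. -/

section Multiplication

variable {R : Type u} [CommRing R] {X : Type u} [AddCommGroup X] [Module R X]

variable (R X) in
/-- Multiplication `X ⊗ Symⁿ X → Symⁿ⁺¹ X`. -/
noncomputable def symMul (n : ℕ) : X ⊗[R] SymPower R X n →ₗ[R] SymPower R X (n + 1) :=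
  TensorProduct.lift (LinearMap.mk₂ R
    (fun x y => ⟨SymmetricAlgebra.ι R X x * y, by
      rw [SymPower, pow_succ']
      exact Submodule.mul_mem_mul ⟨x, rfl⟩ y.2⟩)
    (fun x x' y => Subtype.ext (by simp [add_mul]))
    (fun r x y => Subtype.ext (by simp))
    (fun x y y' => Subtype.ext (by simp [mul_add]))
    (fun r x y => Subtype.ext (by simp)))

theorem symMul_tmul (n : ℕ) (x : X) (y : SymPower R X n) :
    (symMul R X n (x ⊗ₜ y) : SymmetricAlgebra R X) = SymmetricAlgebra.ι R X x * y := rfl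

theorem symMul_surjective (n : ℕ) : Function.Surjective (symMul R X n) := by
  rintro ⟨z, hz⟩
  have key : ∀ z ∈ SymPower R X (n + 1), ∃ t, (symMul R X n t : SymmetricAlgebra R X) = z := by
    intro z hz
    rw [SymPower, pow_succ'] at hz
    induction hz using Submodule.mul_induction_on' with
    | mem_mul_mem a ha b hb =>
      obtain ⟨x, rfl⟩ := ha
      exact ⟨x ⊗ₜ ⟨b, hb⟩, rfl⟩
    | add a _ b _ ha hb =>
      obtain ⟨s, rfl⟩ := ha
      obtain ⟨t, rfl⟩ := hb
      exact ⟨s + t, by simp⟩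
  obtain ⟨t, ht⟩ := key z hz
  exact ⟨t, Subtype.ext ht⟩

variable (R X) in
/-- Multiplication `X ⊗ ⋀ⁿ X → ⋀ⁿ⁺¹ X`. -/
noncomputable def altMul (n : ℕ) : X ⊗[R] ⋀[R]^n X →ₗ[R] ⋀[R]^(n + 1) X :=
  TensorProduct.lift (LinearMap.mk₂ R
    (fun x y => ⟨ExteriorAlgebra.ι R x * y, by
      rw [ExteriorAlgebra.exteriorPower, pow_succ']
      exact Submodule.mul_mem_mul ⟨x, rfl⟩ y.2⟩)
    (fun x x' y => Subtype.ext (by simp [add_mul]))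
    (fun r x y => Subtype.ext (by simp))
    (fun x y y' => Subtype.ext (by simp [mul_add]))
    (fun r x y => Subtype.ext (by simp)))

theorem altMul_ιMulti (n : ℕ) (x : X) (v : Fin n → X) :
    altMul R X n (x ⊗ₜ exteriorPower.ιMulti R n v) =
      exteriorPower.ιMulti R (n + 1) (Fin.cons x v) := by
  refine Subtype.ext ?_
  change ExteriorAlgebra.ι R x * ExteriorAlgebra.ιMulti R n v =
    ExteriorAlgebra.ιMulti R (n + 1) (Fin.cons x v)
  rw [ExteriorAlgebra.ιMulti_succ_apply]
  rfl

theorem altMul_surjective (n : ℕ) : Function.Surjective (altMul R X n) := by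
  rw [← LinearMap.range_eq_top, eq_top_iff, ← exteriorPower.ιMulti_span, Submodule.span_le]
  rintro _ ⟨v, rfl⟩
  exact ⟨v 0 ⊗ₜ exteriorPower.ιMulti R n (Fin.tail v), by rw [altMul_ιMulti, Fin.cons_self_tail]⟩

variable {σ : R →+* R}

theorem symMul_map (n : ℕ) (f : X →ₛₗ[σ] X) (t : X ⊗[R] SymPower R X n) :
    symMul R X n (TensorProduct.map f (symMap n f) t) = symMap (n + 1) f (symMul R X n t) := by
  induction t with
  | zero => simp
  | add s t hs ht => simp only [map_add, hs, ht]
  | tmul x y =>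
    refine Subtype.ext ?_
    rw [TensorProduct.map_tmul, symMul_tmul]
    change _ = symAlgMap f (SymmetricAlgebra.ι R X x * y)
    rw [map_mul, symAlgMap_ι]
    rfl

theorem altMul_map (n : ℕ) (f : X →ₛₗ[σ] X) (t : X ⊗[R] ⋀[R]^n X) :
    altMul R X n (TensorProduct.map f (altMap n f) t) = altMap (n + 1) f (altMul R X n t) := by
  induction t with
  | zero => simp
  | add s t hs ht => simp only [map_add, hs, ht]
  | tmul x y =>
    have hy : y ∈ Submodule.span R (Set.range (exteriorPower.ιMulti R n (M := X))) := by
      rw [exteriorPower.ιMulti_span]; trivial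
    induction hy using Submodule.span_induction with
    | mem y hy =>
      obtain ⟨v, rfl⟩ := hy
      rw [TensorProduct.map_tmul, altMap_ιMulti, altMul_ιMulti, altMul_ιMulti, altMap_ιMulti]
      congr 1
      ext i
      refine Fin.cases ?_ (fun j => ?_) i <;> simp
    | zero => simp
    | add y z _ _ hy hz => simp only [TensorProduct.tmul_add, map_add, hy, hz]
    | smul r y _ hy => simp only [TensorProduct.tmul_smul, map_smulₛₗ, hy, RingHom.id_apply]

variable (R X) in
/-- The map from `R` onto the zeroth symmetric power. -/
noncomputable def symOne : R →ₗ[R] SymPower R X 0 :=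
  (Algebra.linearMap R (SymmetricAlgebra R X)).codRestrict _ fun r => by
    rw [SymPower, pow_zero]
    exact Submodule.algebraMap_mem r

theorem symOne_surjective : Function.Surjective (symOne R X) := by
  rintro ⟨z, hz⟩
  rw [SymPower, pow_zero] at hz
  obtain ⟨r, hr⟩ := Submodule.mem_one.mp hz
  exact ⟨r, Subtype.ext hr⟩

theorem symOne_map (f : X →ₛₗ[σ] X) (r : R) :
    symOne R X (σ r) = symMap 0 f (symOne R X r) := by
  refine Subtype.ext ?_
  change algebraMap R (SymmetricAlgebra R X) (σ r) =
    symAlgMap f (algebraMap R (SymmetricAlgebra R X) r)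
  rw [Algebra.algebraMap_eq_smul_one, Algebra.algebraMap_eq_smul_one, symAlgMap_smul, map_one]

theorem altZero_map (f : X →ₛₗ[σ] X) (r : R) :
    (exteriorPower.zeroEquiv R X).symm (σ r) =
      altMap 0 f ((exteriorPower.zeroEquiv R X).symm r) := by
  have h : ∀ r : R, (exteriorPower.zeroEquiv R X).symm r =
      r • exteriorPower.ιMulti R 0 (Fin.elim0 : Fin 0 → X) := fun r => by
    rw [LinearEquiv.symm_apply_eq, map_smul, exteriorPower.zeroEquiv_ιMulti, smul_eq_mul, mul_one]
  rw [h, h, altMap_smul, altMap_ιMulti]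
  congr 2
  exact Subsingleton.elim _ _

end Multiplication

section Category

open QDiffModule

variable {F : Type u} [Field F] [Differential F] {σ : F ≃+* F}

/-- Symmetric and exterior powers are not among the operations of the category. They arise by
induction as quotients of `X ⊗ Symⁿ X` and `X ⊗ ⋀ⁿ X`, starting from a quotient of the unit object.
-/
theorem inTensorCategory_constr (hσ : ∀ f : F, (σ : F →+* F) (f′) = ((σ : F →+* F) f)′)
    (M : QDiffModule F σ) (c : Constr) : M.InTensorCategory hσ (M.constr hσ c) := by
  induction c with
  | base => exact .sub (X := M) LinearMap.id (fun _ => rfl) Function.injective_id .gen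
  | dsum a b ha hb =>
    exact .sub (X := (M.constr hσ a).prod (M.constr hσ b)) LinearMap.id (fun _ => rfl)
      Function.injective_id (.prod ha hb)
  | tensor a b ha hb =>
    exact .sub (X := (M.constr hσ a).tensor (M.constr hσ b)) LinearMap.id (fun _ => rfl)
      Function.injective_id (.tensor ha hb)
  | dual a ha =>
    exact .sub (X := (M.constr hσ a).dual) LinearMap.id (fun _ => rfl) Function.injective_id
      (.dual ha)
  | prolong a ha =>
    exact .sub (X := (M.constr hσ a).prolong hσ) LinearMap.id (fun _ => rfl)
      Function.injective_id (.prolong ha)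
  | sym n a ha =>
    induction n with
    | zero =>
      exact .quot (X := QDiffModule.unit F σ) (Y := M.constr hσ (.sym 0 a))
        (symOne F (a.obj F M.carrier)) (symOne_map (a.map hσ M.Sg)) (symOne_surjective (R := F)) .unit
    | succ n ih =>
      exact .quot (X := (M.constr hσ a).tensor (M.constr hσ (.sym n a)))
        (Y := M.constr hσ (.sym (n + 1) a)) (symMul F (a.obj F M.carrier) n)
        (symMul_map n (a.map hσ M.Sg)) (symMul_surjective n) (.tensor ha ih)
  | alt n a ha =>
    induction n with
    | zero =>
      exact .quot (X := QDiffModule.unit F σ) (Y := M.constr hσ (.alt 0 a))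
        (exteriorPower.zeroEquiv F (a.obj F M.carrier)).symm.toLinearMap
        (altZero_map (a.map hσ M.Sg)) (LinearEquiv.surjective _) .unit
    | succ n ih =>
      exact .quot (X := (M.constr hσ a).tensor (M.constr hσ (.alt n a)))
        (Y := M.constr hσ (.alt (n + 1) a)) (altMul F (a.obj F M.carrier) n)
        (altMul_map n (a.map hσ M.Sg)) (altMul_surjective n) (.tensor ha ih)

end Category


/-! ### The least stabilizer and its line. -/

section Main

open QDiffModule

variable {F : Type u} [Field F] [Differential F] {σ : F ≃+* F}

/-- The parameterized Galois group is the stabilizer of a single sub-`q`-difference module. -/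
theorem exists_stabilizer_subset [CharZero F]
    (hσ : ∀ f : F, (σ : F →+* F) (f′) = ((σ : F →+* F) f)′) (M : QDiffModule F σ) :
    ∃ (c : Constr) (N : Submodule F (M.constr hσ c).carrier),
      (M.constr hσ c).Sg '' (N : Set (M.constr hσ c).carrier) = N ∧
      ∀ (A : Type u) [CommRing A] [Algebra F A] [Differential A] [DifferentialAlgebra F A],
        stabilizer A (X := M.carrier) c N ⊆ galoisGroup A hσ M := by
  -- The index set consists of all subobjects of all constructions; the zero subobject shows that it
  -- is nonempty, and direct sums make it directed.
  let ι := {p : Σ c : Constr, Submodule F (M.constr hσ c).carrier //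
    (M.constr hσ p.1).Sg '' (p.2 : Set (M.constr hσ p.1).carrier) = p.2}
  have : Nonempty ι := ⟨⟨.base, ⊥⟩, by simp⟩
  let b := Module.finBasis F M.carrier
  obtain ⟨⟨⟨c, N⟩, hN⟩, h⟩ := exists_least_of_directed (ι := ι)
    (fun p A _ _ _ _ => stabilizerSubgroup A b p.1.1 p.1.2)
    (fun p => exists_equations b p.1.1 p.1.2)
    (fun p p' => ⟨⟨⟨.dsum p.1.1 p'.1.1, p.1.2.prod p'.1.2⟩, image_prodMap_prod p.2 p'.2⟩,
      fun A _ _ _ _ => ⟨fun g hg => (stabilizer_prod_subset p.1.2 p'.1.2 A hg).1,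
        fun g hg => (stabilizer_prod_subset p.1.2 p'.1.2 A hg).2⟩⟩)
  refine ⟨c, N, hN, fun A _ _ _ _ g hg c' N' hN' => ?_⟩
  obtain ⟨g, rfl⟩ := (glEquiv b A).surjective g
  exact h ⟨⟨c', N'⟩, hN'⟩ A hg

end Main

end QDifference

theorem mainTheorem11 {K : Type v} [Field K] [CharZero K] (q : K) (hq0 : q ≠ 0) (hq1 : q ≠ 1)
    {F : Type u} [Field F] [Algebra (RatFunc K) F] [Differential F] (σ : F ≃+* F)
    (hσq : ∀ f : RatFunc K, σ (algebraMap (RatFunc K) F f) =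
      algebraMap (RatFunc K) F (QDifference.qDilation q hq0 f))
    (hσ : ∀ f : F, (σ : F →+* F) (f′) = ((σ : F →+* F) f)′)
    (M : QDifference.QDiffModule F σ) :
    ∃ (c : QDifference.Constr) (L : Submodule F (M.constr hσ c).carrier)
      (hL : (M.constr hσ c).Sg '' (L : Set (M.constr hσ c).carrier) = L),
      Module.finrank F L = 1 ∧
      M.InTensorCategory hσ ((M.constr hσ c).sub L hL) ∧
      ∀ (A : Type u) [CommRing A] [Algebra F A] [Differential A] [DifferentialAlgebra F A],
        QDifference.QDiffModule.galoisGroup A hσ M =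
          QDifference.QDiffModule.stabilizer A (X := M.carrier) c L := by
  have : CharZero (RatFunc K) :=
    charZero_of_injective_algebraMap (algebraMap K (RatFunc K)).injective
  have : CharZero F := charZero_of_injective_algebraMap (algebraMap (RatFunc K) F).injective
  obtain ⟨c, N, hN, h⟩ := QDifference.exists_stabilizer_subset hσ M
  obtain ⟨r, s, B, hB⟩ := QDifference.exists_adapted_basis N
  have hNB : ∀ y ∈ Submodule.span F (Set.range (B ∘ Sum.inl)),
      (M.constr hσ c).Sg y ∈ Submodule.span F (Set.range (B ∘ Sum.inl)) := fun y hy => by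
    rw [← hB] at hy ⊢
    exact hN.subset ⟨y, hy, rfl⟩
  have hL := QDifference.image_span_ιMulti (M.constr hσ c).bijective B hNB
  -- Here `r = dim N`. For `N = 0` the line is all of `⋀⁰`.
  refine ⟨.alt r c, Submodule.span F {exteriorPower.ιMulti F r (B ∘ Sum.inl)}, hL,
    QDifference.finrank_span_ιMulti B, ?_, fun A _ _ _ _ => Set.Subset.antisymm ?_ ?_⟩
  · exact .sub (X := M.constr hσ (.alt r c)) (Submodule.subtype _) (fun _ => rfl)
      Subtype.val_injective (QDifference.inTensorCategory_constr hσ M _)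
  -- The line is itself a sub-`q`-difference module of a construction, hence one of those in the
  -- definition of the Galois group.
  · exact fun g hg => hg (.alt r c) _ hL
  · exact (QDifference.stabilizer_span_ιMulti_subset hB A).trans (h A)
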